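/- Work with complex algebraic varieties. Let $N$ be odd, $m\ge 0$, and $n:=N-m-1\ge 1$. Let $\mathfrak a^{rs}$ be the variety of $a=(a_1,\dots,a_N)\in\mathbb C^N$ with $\sum a_i=0$ and $a_i\ne a_j$ for $i\neq j$ (the regular semisimple locus of the diagonal Cartan subspace of $\mathfrak{sl}_N$), let $W=S_N$ act on it by permutations, and put $d_i=\prod_{j\ne i}(a_j-a_i)$. For $k\geq 1$ let $I_k=(\mathbb Z/2)^k/(\mathbb Z/2)$ (quotient by the diagonal); $W$ acts on $I_N$ and $I_{N+1}$ by permuting the first $N$ coordinates. All spaces below are families over $\mathfrak a^{rs}$. * $X_m$ has fibres $\{[v]\in\mathbb P^{N-1}\mid \sum_j a_j^iv_j^2=0,\ 0\le i<m\}$, and $X'_m$ has fibres $\{[v]\in\mathbb P^{N-1}\mid\sum_j \frac{a_j^i}{d_j}v_j^2=0,\ 0\le i<m\}$. * $\widetilde X_m$ has fibres $\{[v,\epsilon]\in\mathbb P^{N}\mid\sum_j a_j^iv_j^2=0\ (0\le i<m),\ \sum_j a_j^mv_j^2=\epsilon^2\}$, and $\widetilde X'_m$ is defined in the same way with $a_j^i/d_j$,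 $a_j^m/d_j$ in place of $a_j^i$, $a_j^m$. * $C$, resp. $\widetilde C$, is the family of smooth projective curves $C_a$, resp. $\widetilde C_a$, with function field $\mathbb C(t)\big((\tfrac{t-a_i}{t-a_1})^{1/2}_{2\le i\le N}\big)$, resp. $\mathbb C(t)\big((t-a_i)^{1/2}_{1\le i\le N}\big)$; concretely $C_a=\{[y]\in\mathbb P^{N-1}\mid \exists\, t,u:\ y_i^2=t-a_iu\}$ and $\widetilde C_a=\{[y]\in\mathbb P^{N}\mid\exists\, t,u:\ y_i^2=t-a_iu\ (i\le N),\ y_{N+1}^2=u\}$. * $\mathcal Y_m=C^n/(\bar I_N\rtimes S_n)$ and $\widetilde{\mathcal Y}_m=\widetilde C^n/(\bar I_{N+1}\rtimes S_n)$, where the powers are fibre powers over $\mathfrak a^{rs}$ and $\bar I_k=\ker(\mathrm{sum}:I_k^n\to I_k)$. * $\tilde{\mathfrak a}^{rs}=\{(a,c)\in\mathfrak a^{rs}\times\mathbb C^N\mid c_i^2=d_i\}/\{\pm1\}$, an $I_N$-torsor over $\mathfrak a^{rs}$. The groups $I_N$, $I_{N+1}$ act by sign changes of the coordinates $v_i$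 (with $v_{N+1}=\epsilon$), $y_i$ and $c_i$; on $\mathcal Y_m$ and $\widetilde{\mathcal Y}_m$ they act as $I_k\cong I_k^n/\bar I_k$. The group $W$ acts by simultaneously permuting the indices $1,\dots,N$ of $a_i,v_i,y_i,c_i$ (diagonally on fibre powers), except that on $\widetilde X_m$ it acts through $SO_N$, by means of the matrices $\mathrm{sgn}(w)P_w\in SO_N$ ($P_w$ the permutation matrices): $w\cdot(a,[v,\epsilon])=(wa,[\mathrm{sgn}(w)P_wv,\epsilon])$. Let $\kappa:I_N\to I_{N+1}$ be the composition of $I_N\cong\{\zeta\in(\mathbb Z/2)^N\mid\sum\zeta_i=0\}$ with $\zeta\mapsto(\zeta,0)$. Then the following hold. 1. There is an $I_N\rtimes W$-equivariant isomorphism over $\mathfrak a^{rs}$ $$X_m\simeq\mathcal Y_m^t:=(\mathcal Y_m\times_{\mathfrak a^{rs}}\tilde{\mathfrak a}^{rs})/I_N .$$ 2. There is an $I_{N+1}\rtimes W$-equivariant isomorphism over $\mathfrak a^{rs}$ $$\widetilde X_m\simeq\widetilde{\mathcal Y}_m^t:=(\widetilde{\mathcal Y}_m\times_{\mathfrak a^{rs}}\tilde{\mathfrak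 a}^{rs})/I_N,$$ where $I_N$ acts on $\widetilde{\mathcal Y}_m$ through $\kappa$. In both cases $I_N$ acts diagonally on the fibre product, $W$ acts diagonally on the twist, and $I_N$, resp. $I_{N+1}$, acts on the twist through the first factor. 3. Let $\widetilde V'_m\subset\mathbb C^{N+1}\times\mathfrak a^{rs}$ be the bundle with fibres given by $\sum_j\frac{a_j^i}{d_j}v_j=0$ $(0\le i<m)$, $\sum_j\frac{a_j^m}{d_j}v_j=v_{N+1}$. There is an isomorphism of vector bundles $\mathbb C^{n+1}\times\mathfrak a^{rs}\simeq\widetilde V'_m$ over $\mathfrak a^{rs}$ under which the coordinates $v_i$, $1\le i\le N$, pull back to $H_{a,i}=x_1+a_ix_2+\dots+a_i^{n}x_{n+1}$ and $v_{N+1}$ pulls back to $H_{a,N+1}=x_{n+1}$. 4. There is an $I_{N+1}\rtimes W$-equivariant isomorphism $\psi:\widetilde X'_m\simeq\widetilde{\mathcal Y}_m$ over $\mathfrak a^{rs}$ covering the isomorphism $\mathbb P(\widetilde V'_m)\simeq\mathbb P^n\times\mathfrak a^{rs}$ of 3, with respect to the maps $\widetilde X'_m\to\mathbb P(\widetilde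 V'_m)$, $[v]\mapsto[v_1^2,\dots,v_{N+1}^2]$, and $\widetilde{\mathcal Y}_m\to(\mathbb P^1)^n/S_n\times\mathfrak a^{rs}\simeq\mathbb P^n\times\mathfrak a^{rs}$, where $([t_k:u_k])_k$ corresponds to the point whose coordinates $x_1,\dots,x_{n+1}$ are the coefficients of $T^0,\dots,T^n$ in $\prod_k(u_kT-t_k)$. It induces an $I_N\rtimes W$-equivariant isomorphism $X'_m\simeq\widetilde X'_m/(\mathbb Z/2)\simeq\widetilde{\mathcal Y}_m/(\mathbb Z/2)\simeq\mathcal Y_m$ over $\mathfrak a^{rs}$, where $\mathbb Z/2$ acts through the last coordinate of $I_{N+1}$ and the outer isomorphisms are induced by forgetting the last coordinates ($\epsilon$, resp. $y_{N+1}$). -/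

import Mathlib

open scoped LinearAlgebra.Projectivization

namespace QuadricTwist

noncomputable section

/-! ### Complex varieties as spaces with functions

A classical complex algebraic variety is regarded as a set of points with its Zariski topology and
its sheaf of regular functions; the sheaf is recorded through the predicate "the (germ of the)
complex valued function `f` is regular at the point `x`".  A function is regular on an open set iff
it is regular at all of its points. Only the structures built below from affine spaces by taking
subvarieties, products and quotients are used. -/

/-- A topology and a notion of regularity at a point for complex valued functions. -/
class SpaceWithFunctions (X : Type*) where
  /-- the Zariski topology -/
  zariski : TopologicalSpace X
  /-- `RegularAt f x`: the function `f` is regular in a neighbourhood of `x` -/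
  RegularAt : (X → ℂ) → X → Prop

namespace SpaceWithFunctions

/-- Zariski open subsets. -/
def IsOpenZ {X : Type*} (s : SpaceWithFunctions X) (U : Set X) : Prop :=
  @IsOpen X s.zariski U

/-- Affine space: the distinguished open sets `P ≠ 0` form a basis of the topology, and regular
functions are locally quotients of polynomials. -/
instance affine (ι : Type*) : SpaceWithFunctions (ι → ℂ) where
  zariski := TopologicalSpace.generateFrom
    {U | ∃ P : MvPolynomial ι ℂ, U = {x | MvPolynomial.eval x P ≠ 0}}
  RegularAt f x := ∃ P Q : MvPolynomial ι ℂ, MvPolynomial.eval x Q ≠ 0 ∧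
    ∀ y, MvPolynomial.eval y Q ≠ 0 → f y = MvPolynomial.eval y P / MvPolynomial.eval y Q

/-- The structure induced along a map `π : Z → X` (a subvariety, when `π` is an inclusion):
the induced topology, and locally restrictions of regular functions. -/
@[reducible] def pull {Z X : Type*} (π : Z → X) (s : SpaceWithFunctions X) : SpaceWithFunctions Z where
  zariski := s.zariski.induced π
  RegularAt f z := ∃ F : X → ℂ, s.RegularAt F (π z) ∧
    ∃ U : Set X, s.IsOpenZ U ∧ π z ∈ U ∧ ∀ z', π z' ∈ U → f z' = F (π z')

/-- The quotient structure along a surjection `π : Z → X`: the quotient topology, and a function is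
regular on an open set iff its pullback is regular. -/
@[reducible] def push {Z X : Type*} (π : Z → X) (s : SpaceWithFunctions Z) : SpaceWithFunctions X where
  zariski := s.zariski.coinduced π
  RegularAt f x := ∃ U : Set X, s.IsOpenZ (π ⁻¹' U) ∧ x ∈ U ∧
    ∀ z, π z ∈ U → s.RegularAt (f ∘ π) z

/-- The functions on `Z` that are polynomial expressions in functions each of which is, for some
`k`, regular on `U k` for the structure `s k`. -/
def joinFunctions {Z κ : Type*} (s : κ → SpaceWithFunctions Z) (U : κ → Set Z) :
    Subalgebra ℂ (Z → ℂ) :=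
  Algebra.adjoin ℂ {g | ∃ k, ∀ z ∈ U k, (s k).RegularAt g z}

/-- The coarsest structure containing finitely many given ones.  For the structures pulled back
from the factors of a product this is the product variety: the open sets
`{z ∈ ⋂ U_k | q z ≠ 0}`, with `q` a sum of products of functions regular on the `U_k`, form a
basis, and regular functions are locally quotients of such sums. -/
@[reducible] def join {Z κ : Type*} [Finite κ] (s : κ → SpaceWithFunctions Z) : SpaceWithFunctions Z where
  zariski := TopologicalSpace.generateFrom
    {B | ∃ U : κ → Set Z, (∀ k, (s k).IsOpenZ (U k)) ∧ ∃ q ∈ joinFunctions s U,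
      B = {z | (∀ k, z ∈ U k) ∧ q z ≠ 0}}
  RegularAt f z := ∃ U : κ → Set Z, (∀ k, (s k).IsOpenZ (U k)) ∧ (∀ k, z ∈ U k) ∧
    ∃ p ∈ joinFunctions s U, ∃ q ∈ joinFunctions s U, q z ≠ 0 ∧
      ∀ z', (∀ k, z' ∈ U k) → q z' ≠ 0 → f z' = p z' / q z'

instance subtype {X : Type*} [s : SpaceWithFunctions X] (p : X → Prop) :
    SpaceWithFunctions {x // p x} := pull Subtype.val s

instance prod {X Y : Type*} [s : SpaceWithFunctions X] [t : SpaceWithFunctions Y] :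
    SpaceWithFunctions (X × Y) :=
  join (fun b : Bool => if b then pull Prod.fst s else pull Prod.snd t)

instance pi {κ : Type*} [Finite κ] {X : κ → Type*} [s : ∀ k, SpaceWithFunctions (X k)] :
    SpaceWithFunctions (∀ k, X k) :=
  join (fun k => pull (fun z => z k) (s k))

instance quotient {X : Type*} [s : SpaceWithFunctions X] (r : Setoid X) :
    SpaceWithFunctions (Quotient r) := push (Quotient.mk r) s

/-- Projective space, the quotient of the punctured affine space by scalars. -/
instance projective (ι : Type*) : SpaceWithFunctions (ℙ ℂ (ι → ℂ)) :=
  push (Projectivization.mk' ℂ) (subtype (X := ι → ℂ) (fun v => v ≠ 0))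

/-- Morphisms: continuous maps under which regular functions pull back to regular functions. -/
def IsMorphism {X Y : Type*} [s : SpaceWithFunctions X] [t : SpaceWithFunctions Y]
    (φ : X → Y) : Prop :=
  @Continuous X Y s.zariski t.zariski φ ∧
    ∀ (f : Y → ℂ) (x : X), t.RegularAt f (φ x) → s.RegularAt (f ∘ φ) x

/-- Isomorphisms of varieties: bijections that are morphisms in both directions. -/
def IsIsomorphism {X Y : Type*} [SpaceWithFunctions X] [SpaceWithFunctions Y]
    (φ : X ≃ Y) : Prop :=
  IsMorphism φ ∧ IsMorphism φ.symm

end SpaceWithFunctions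

/-! ### The Cartan subspace, the groups -/

/-- The Weyl group `W = S_N`. It acts on `Fin N`, and on `Option (Fin N)`, the set of `N + 1`
indices, by permuting the first `N` of them and fixing the last one `none`. -/
abbrev W (N : ℕ) : Type := Equiv.Perm (Fin N)

/-- Regular semisimple elements of the Cartan subspace of diagonal matrices in `sl_N`: pairwise
distinct diagonal entries with sum zero. -/
def Ars (N : ℕ) : Type := {a : Fin N → ℂ // Function.Injective a ∧ ∑ i, a i = 0}

instance (N : ℕ) : SpaceWithFunctions (Ars N) :=
  inferInstanceAs (SpaceWithFunctions {a : Fin N → ℂ // Function.Injective a ∧ ∑ i, a i = 0})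

@[ext] theorem Ars.ext {N : ℕ} {a b : Ars N} (h : ∀ i, a.1 i = b.1 i) : a = b :=
  Subtype.ext (funext h)

instance (N : ℕ) : MulAction (W N) (Ars N) where
  smul w a := ⟨fun i => a.1 (w⁻¹ • i), a.2.1.comp (w⁻¹).injective,
    (Equiv.sum_comp (w⁻¹) a.1).trans a.2.2⟩
  one_smul a := rfl
  mul_smul w w' a := by
    ext i
    change a.1 ((w * w')⁻¹ • i) = a.1 (w'⁻¹ • w⁻¹ • i)
    rw [mul_inv_rev, mul_smul]

theorem Ars.smul_apply {N : ℕ} (w : W N) (a : Ars N) (i : Fin N) :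
    (w • a).1 i = a.1 (w⁻¹ • i) := rfl

/-- `d_i = ∏_{j ≠ i} (a_j - a_i)`. -/
def d {N : ℕ} (a : Ars N) (i : Fin N) : ℂ := ∏ j ∈ Finset.univ.erase i, (a.1 j - a.1 i)

theorem d_smul {N : ℕ} (w : W N) (a : Ars N) (i : Fin N) : d (w • a) i = d a (w⁻¹ • i) := by
  refine Finset.prod_bij (fun j _ => w⁻¹ • j) ?_ ?_ ?_ ?_
  · intro j hj
    simpa using hj
  · intro j _ k _ h
    exact MulAction.injective w⁻¹ h
  · intro j hj
    refine ⟨w • j, ?_, by simp⟩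
    simp only [Finset.mem_erase, Finset.mem_univ, and_true] at hj ⊢
    intro h
    exact hj (by rw [← h]; simp)
  · intro j _
    rfl

/-- The diagonal subgroup of `(ℤ/2)^ι`; the group `ℤ/2` is written multiplicatively as `ℤˣ`. -/
def diagSigns (ι : Type) : Subgroup (ι → ℤˣ) := (Pi.constMonoidHom ι ℤˣ).range

theorem mem_diagSigns {ι : Type} {ζ : ι → ℤˣ} : ζ ∈ diagSigns ι ↔ ∃ e : ℤˣ, ∀ i, ζ i = e := by
  constructor
  · rintro ⟨e, rfl⟩
    exact ⟨e, fun i => rfl⟩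
  · rintro ⟨e, h⟩
    exact ⟨e, (funext h).symm⟩

/-- `I_ι = (ℤ/2)^ι / (ℤ/2)`: the group `I_N` for `ι = Fin N`, and `I_{N+1}` for
`ι = Option (Fin N)`. -/
abbrev I (ι : Type) : Type := (ι → ℤˣ) ⧸ diagSigns ι

section WeylOnI

variable {N : ℕ} {ι : Type} [MulAction (W N) ι]

/-- Permutation of the coordinates of `(ℤ/2)^ι`. -/
def permSigns (w : W N) : (ι → ℤˣ) →* (ι → ℤˣ) where
  toFun ζ i := ζ (w⁻¹ • i)
  map_one' := rfl
  map_mul' _ _ := rfl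

/-- `W` acts on `I_ι` by permuting coordinates. -/
instance : MulAction (W N) (I ι) where
  smul w := QuotientGroup.map (diagSigns ι) (diagSigns ι) (permSigns w) (by
    intro ζ h
    obtain ⟨e, he⟩ := mem_diagSigns.1 h
    exact mem_diagSigns.2 ⟨e, fun i => he _⟩)
  one_smul g := by
    induction g using QuotientGroup.induction_on with
    | H ζ => exact congrArg QuotientGroup.mk (funext fun i => by simp [permSigns])
  mul_smul w w' g := by
    induction g using QuotientGroup.induction_on with
    | H ζ =>
      refine congrArg QuotientGroup.mk (funext fun i => ?_)
      simp [permSigns, mul_smul]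

theorem smul_mk_I (w : W N) (ζ : ι → ℤˣ) :
    w • (QuotientGroup.mk ζ : I ι) = QuotientGroup.mk (permSigns w ζ) := rfl

theorem smul_mul_I (w : W N) (g h : I ι) : w • (g * h) = (w • g) * (w • h) := by
  induction g using QuotientGroup.induction_on with
  | H ζ =>
    induction h using QuotientGroup.induction_on with
    | H ξ => rfl

theorem smul_one_I (w : W N) : w • (1 : I ι) = 1 := rfl

end WeylOnI

/-- A `W`-equivariant homomorphism `I_N → I_ι`, through which `I_N` acts on families with an action
of `I_ι`. -/
structure IHom (N : ℕ) (ι : Type) [MulAction (W N) ι] where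
  hom : I (Fin N) →* I ι
  map_smul : ∀ (w : W N) (g : I (Fin N)), hom (w • g) = w • hom g

/-- The identity of `I_N`. -/
def IHom.id (N : ℕ) : IHom N (Fin N) := ⟨MonoidHom.id _, fun _ _ => rfl⟩

/-- A lift of `ζ ∈ (ℤ/2)^N` modulo the diagonal to the elements with product one (for odd `N`),
followed by `(ζ_1, …, ζ_N) ↦ (ζ_1, …, ζ_N, 1)`. -/
def kappaSigns (N : ℕ) : (Fin N → ℤˣ) →* (Option (Fin N) → ℤˣ) where
  toFun ζ o := o.elim 1 (fun i => ζ i * ∏ j, ζ j)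
  map_one' := by
    funext o
    cases o <;> simp
  map_mul' ζ ξ := by
    funext o
    cases o
    · simp
    · simp [Finset.prod_mul_distrib, mul_mul_mul_comm]

/-- The homomorphism `κ : I_N ≅ {ζ ∈ (ℤ/2)^N | ∏ ζ_i = 1} → (ℤ/2)^{N+1} → I_{N+1}`, `N` odd. -/
def kappa {N : ℕ} (hN : Odd N) : IHom N (Option (Fin N)) where
  hom := QuotientGroup.map _ _ (kappaSigns N) (by
    intro ζ h
    obtain ⟨e, he⟩ := mem_diagSigns.1 h
    refine mem_diagSigns.2 ⟨1, fun o => ?_⟩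
    cases o with
    | none => rfl
    | some i =>
      change ζ i * ∏ j, ζ j = 1
      simp only [he, Finset.prod_const, Finset.card_univ, Fintype.card_fin]
      rw [← pow_succ', ← Nat.two_mul_div_two_of_even hN.add_one, pow_mul, Int.units_sq, one_pow])
  map_smul w g := by
    induction g using QuotientGroup.induction_on with
    | H ζ =>
      refine congrArg QuotientGroup.mk (funext fun o => ?_)
      cases o with
      | none => rfl
      | some i =>
        change ζ (w⁻¹ • i) * ∏ j, ζ (w⁻¹ • j) = ζ (w⁻¹ • i) * ∏ j, ζ j
        rw [show ∏ j, ζ (w⁻¹ • j) = ∏ j, ζ j from Equiv.prod_comp (w⁻¹) ζ]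

/-- The element `(1, …, 1, -1)` of `I_{N+1}`, i.e. the image of `1 ∈ ℤ/2` under the inclusion of
the last coordinate. -/
def lastSign (N : ℕ) : I (Option (Fin N)) :=
  QuotientGroup.mk (fun o => o.elim (-1) (fun _ => 1))

/-! ### Families of intersections of diagonal quadrics

All the families of complete intersections and all the curves in this development are of the form
`{(a, [v]) | (v_i²)_i ∈ E_a}` for a family of linear subspaces `E_a ⊆ ℂ^ι` depending
`W`-equivariantly on `a`. -/

section Proj

variable {N : ℕ} {ι : Type}

/-- The vector of squares of the coordinates. -/
def sq (v : ι → ℂ) : ι → ℂ := fun i => v i ^ 2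

/-- The diagonal matrix with given signs. -/
def signL (ζ : ι → ℤˣ) : (ι → ℂ) →ₗ[ℂ] (ι → ℂ) where
  toFun v i := ((ζ i : ℤ) : ℂ) * v i
  map_add' v w := by funext i; simp [mul_add]
  map_smul' c v := by funext i; simp [mul_left_comm]

theorem sign_mul_self (e : ℤˣ) : ((e : ℤ) : ℂ) * ((e : ℤ) : ℂ) = 1 := by
  rcases Int.units_eq_one_or e with rfl | rfl <;> simp

theorem signL_injective (ζ : ι → ℤˣ) : Function.Injective (signL ζ) := by
  intro v w h
  funext i
  have h1 : ((ζ i : ℤ) : ℂ) * v i = ((ζ i : ℤ) : ℂ) * w i := congrFun h i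
  have h2 := congrArg (fun x => ((ζ i : ℤ) : ℂ) * x) h1
  simpa [← mul_assoc, sign_mul_self] using h2

theorem sq_signL (ζ : ι → ℤˣ) (v : ι → ℂ) : sq (signL ζ v) = sq v := by
  funext i
  change (((ζ i : ℤ) : ℂ) * v i) ^ 2 = v i ^ 2
  rw [mul_pow, pow_two ((ζ i : ℤ) : ℂ), sign_mul_self, one_mul]

/-- Sign changes of the homogeneous coordinates, as an action of `(ℤ/2)^ι`. -/
def signEnd (ι : Type) : (ι → ℤˣ) →* Function.End (ℙ ℂ (ι → ℂ)) where
  toFun ζ := Projectivization.map (signL ζ) (signL_injective ζ)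
  map_one' := by
    funext x
    induction x using Projectivization.ind with
    | h v hv =>
      change Projectivization.mk ℂ _ _ = Projectivization.mk ℂ _ _
      congr 1
      funext i
      simp [signL]
  map_mul' ζ ξ := by
    funext x
    induction x using Projectivization.ind with
    | h v hv =>
      change Projectivization.mk ℂ _ _ = Projectivization.mk ℂ _ _
      congr 1
      funext i
      simp [signL, mul_assoc]

/-- `I_ι` acts on projective space by sign changes of the homogeneous coordinates. -/
def IEnd (ι : Type) : I ι →* Function.End (ℙ ℂ (ι → ℂ)) :=
  QuotientGroup.lift (diagSigns ι) (signEnd ι) (by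
    intro ζ h
    obtain ⟨e, he⟩ := mem_diagSigns.1 h
    funext x
    induction x using Projectivization.ind with
    | h v hv =>
      change Projectivization.mk ℂ _ _ = Projectivization.mk ℂ _ _
      rw [Projectivization.mk_eq_mk_iff']
      refine ⟨((e : ℤ) : ℂ), ?_⟩
      funext i
      simp [signL, he])

theorem IEnd_mk (ζ : ι → ℤˣ) (v : ι → ℂ) (hv : v ≠ 0) :
    IEnd ι (QuotientGroup.mk ζ) (Projectivization.mk ℂ v hv) =
      Projectivization.mk ℂ (signL ζ v) (fun h => hv (signL_injective ζ (h.trans (map_zero _).symm))) :=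
  rfl

variable [MulAction (W N) ι]

/-- Permutation of coordinates, `(w v)_i = v_{w⁻¹ i}`. -/
def permL (w : W N) : (ι → ℂ) →ₗ[ℂ] (ι → ℂ) := LinearMap.funLeft ℂ ℂ (fun i => w⁻¹ • i)

theorem permL_apply (w : W N) (v : ι → ℂ) (i : ι) : permL w v i = v (w⁻¹ • i) := rfl

theorem permL_injective (w : W N) : Function.Injective (permL w : (ι → ℂ) →ₗ[ℂ] (ι → ℂ)) :=
  LinearMap.funLeft_injective_of_surjective ℂ ℂ _ (MulAction.surjective w⁻¹)

/-- Permutation of the homogeneous coordinates. -/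
def permP (w : W N) : ℙ ℂ (ι → ℂ) → ℙ ℂ (ι → ℂ) :=
  Projectivization.map (permL w) (permL_injective w)

end Proj

/-- A `W`-equivariant family of linear subspaces `E_a ⊆ ℂ^ι`, `a ∈ 𝔞^{rs}`. -/
structure LinFamily (N : ℕ) (ι : Type) [MulAction (W N) ι] where
  E : Ars N → Submodule ℂ (ι → ℂ)
  perm_mem : ∀ (w : W N) (a : Ars N) (q : ι → ℂ), q ∈ E a → permL w q ∈ E (w • a)

section Families

variable {N : ℕ} {ι : Type} [MulAction (W N) ι]

/-- The total space of the vector bundle over `𝔞^{rs}` with fibres `E_a`. -/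
def VectorBundle (F : LinFamily N ι) : Type := {p : Ars N × (ι → ℂ) // p.2 ∈ F.E p.1}

instance (F : LinFamily N ι) : SpaceWithFunctions (VectorBundle F) :=
  inferInstanceAs (SpaceWithFunctions {p : Ars N × (ι → ℂ) // p.2 ∈ F.E p.1})

/-- The family over `𝔞^{rs}` with fibres `{[v] | (v_i²)_i ∈ E_a}`. -/
def SqFamily (F : LinFamily N ι) : Type :=
  {p : Ars N × ℙ ℂ (ι → ℂ) // sq p.2.rep ∈ F.E p.1}

instance (F : LinFamily N ι) : SpaceWithFunctions (SqFamily F) :=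
  inferInstanceAs (SpaceWithFunctions {p : Ars N × ℙ ℂ (ι → ℂ) // sq p.2.rep ∈ F.E p.1})

theorem sq_rep_mem_iff (S : Submodule ℂ (ι → ℂ)) (v : ι → ℂ) (hv : v ≠ 0) :
    sq (Projectivization.mk ℂ v hv).rep ∈ S ↔ sq v ∈ S := by
  obtain ⟨c, hc⟩ := Projectivization.exists_smul_eq_mk_rep ℂ v hv
  rw [← hc]
  have h : sq (c • v) = (c ^ 2) • sq v := by
    funext i
    simp [sq, Units.smul_def, mul_pow]
  rw [h]
  exact Submodule.smul_mem_iff' S _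

/-- The projection to `𝔞^{rs}`. -/
def SqFamily.base {F : LinFamily N ι} (x : SqFamily F) : Ars N := x.1.1

/-- `I_ι` acts fibrewise by sign changes of the homogeneous coordinates. -/
instance (F : LinFamily N ι) : MulAction (I ι) (SqFamily F) where
  smul g x := ⟨(x.1.1, IEnd ι g x.1.2), by
    obtain ⟨⟨a, p⟩, hp⟩ := x
    induction g using QuotientGroup.induction_on with
    | H ζ =>
      induction p using Projectivization.ind with
      | h v hv =>
        rw [IEnd_mk]
        rw [sq_rep_mem_iff] at hp ⊢
        rwa [sq_signL]⟩
  one_smul x := Subtype.ext (Prod.ext rfl (by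
    change IEnd ι 1 x.1.2 = x.1.2
    rw [map_one]; rfl))
  mul_smul g h x := Subtype.ext (Prod.ext rfl (by
    change IEnd ι (g * h) x.1.2 = IEnd ι g (IEnd ι h x.1.2)
    rw [map_mul]; rfl))

/-- `W` acts by permuting the entries of `a` and the homogeneous coordinates. -/
instance (F : LinFamily N ι) : MulAction (W N) (SqFamily F) where
  smul w x := ⟨(w • x.1.1, permP w x.1.2), by
    obtain ⟨⟨a, p⟩, hp⟩ := x
    induction p using Projectivization.ind with
    | h v hv =>
      change sq (Projectivization.mk ℂ _ _).rep ∈ _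
      rw [sq_rep_mem_iff] at hp ⊢
      exact F.perm_mem w a _ hp⟩
  one_smul x := by
    obtain ⟨⟨a, p⟩, hp⟩ := x
    refine Subtype.ext (Prod.ext (one_smul _ a) ?_)
    induction p using Projectivization.ind with
    | h v hv =>
      change Projectivization.mk ℂ _ _ = Projectivization.mk ℂ _ _
      congr 1
      funext i
      simp [permL_apply]
  mul_smul w w' x := by
    obtain ⟨⟨a, p⟩, hp⟩ := x
    refine Subtype.ext (Prod.ext (mul_smul w w' a) ?_)
    induction p using Projectivization.ind with
    | h v hv =>
      change Projectivization.mk ℂ _ _ = Projectivization.mk ℂ _ _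
      congr 1
      funext i
      simp [permL_apply, mul_smul]

theorem SqFamily.base_smul {F : LinFamily N ι} (g : I ι) (x : SqFamily F) :
    (g • x).base = x.base := rfl

theorem SqFamily.base_smul' {F : LinFamily N ι} (w : W N) (x : SqFamily F) :
    (w • x).base = w • x.base := rfl

/-- The two actions combine to an action of `I_ι ⋊ W`. -/
theorem SqFamily.smul_smul_comm {F : LinFamily N ι} (w : W N) (g : I ι) (x : SqFamily F) :
    w • g • x = (w • g) • w • x := by
  obtain ⟨⟨a, p⟩, hp⟩ := x
  refine Subtype.ext (Prod.ext rfl ?_)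
  change permP w (IEnd ι g p) = IEnd ι (w • g) (permP w p)
  induction g using QuotientGroup.induction_on with
  | H ζ =>
    induction p using Projectivization.ind with
    | h v hv =>
      change Projectivization.mk ℂ _ _ = Projectivization.mk ℂ _ _
      congr 1

/-! ### Quotients of fibre powers -/

/-- The `n`-fold fibre power over `𝔞^{rs}`. -/
def FibrePower (F : LinFamily N ι) (n : ℕ) : Type :=
  {p : Ars N × (Fin n → SqFamily F) // ∀ k, (p.2 k).base = p.1}

instance (F : LinFamily N ι) (n : ℕ) : SpaceWithFunctions (FibrePower F n) :=
  inferInstanceAs (SpaceWithFunctions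
    {p : Ars N × (Fin n → SqFamily F) // ∀ k, (p.2 k).base = p.1})

/-- Orbits of `Ī ⋊ S_n` on the fibre power, where `Ī` is the kernel of the summation (here:
multiplication) map `I_ι^n → I_ι`. -/
def powerSetoid (F : LinFamily N ι) (n : ℕ) : Setoid (FibrePower F n) where
  r z z' := z'.1.1 = z.1.1 ∧ ∃ (σ : Equiv.Perm (Fin n)) (g : Fin n → I ι),
    ∏ k, g k = 1 ∧ ∀ k, z'.1.2 k = g k • z.1.2 (σ k)
  iseqv := {
    refl := fun z => ⟨rfl, 1, 1, by simp, by simp⟩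
    symm := by
      rintro z z' ⟨h, σ, g, hg, hz⟩
      refine ⟨h.symm, σ⁻¹, fun k => (g (σ⁻¹ k))⁻¹, ?_, fun k => ?_⟩
      · rw [Equiv.prod_comp (σ⁻¹) (fun k => (g k)⁻¹), Finset.prod_inv_distrib, hg, inv_one]
      · rw [hz]
        simp
    trans := by
      rintro z z' z'' ⟨h, σ, g, hg, hz⟩ ⟨h', σ', g', hg', hz'⟩
      refine ⟨h'.trans h, σ * σ', fun k => g' k * g (σ' k), ?_, fun k => ?_⟩
      · rw [Finset.prod_mul_distrib, hg', Equiv.prod_comp σ' g, hg, one_mul]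
      · rw [hz', hz, mul_smul]
        rfl }

/-- The quotient `C^n / (Ī ⋊ S_n)` of the fibre power. -/
def PowerQuot (F : LinFamily N ι) (n : ℕ) : Type := Quotient (powerSetoid F n)

instance (F : LinFamily N ι) (n : ℕ) : SpaceWithFunctions (PowerQuot F n) :=
  inferInstanceAs (SpaceWithFunctions (Quotient (powerSetoid F n)))

/-- The quotient map. -/
def PowerQuot.mk {F : LinFamily N ι} {n : ℕ} (z : FibrePower F n) : PowerQuot F n :=
  Quotient.mk (powerSetoid F n) z

/-- The projection to `𝔞^{rs}`. -/
def PowerQuot.base {F : LinFamily N ι} {n : ℕ} : PowerQuot F n → Ars N :=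
  Quotient.lift (fun z : FibrePower F n => z.1.1) (fun _ _ h => h.1.symm)

/-- The action of `I_ι^n` on the fibre power. -/
def FibrePower.signs {F : LinFamily N ι} {n : ℕ} (h : Fin n → I ι) (z : FibrePower F n) :
    FibrePower F n :=
  ⟨(z.1.1, fun k => h k • z.1.2 k), fun k => z.2 k⟩

/-- The element `(g, 1, …, 1)` of `I_ι^n`, of product `g` when `n ≥ 1`. -/
def firstSign (n : ℕ) (g : I ι) : Fin n → I ι := fun k => if k.val = 0 then g else 1

/-- The residual action of `I_ι = I_ι^n / Ī` on the quotient (`n ≥ 1`), through the lift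
`(g, 1, …, 1)` of `g`. -/
instance (F : LinFamily N ι) (n : ℕ) : MulAction (I ι) (PowerQuot F n) where
  smul g := Quotient.map (FibrePower.signs (firstSign n g)) (by
    rintro z z' ⟨h, σ, f, hf, hz⟩
    refine ⟨h, σ, fun k => firstSign n g k * f k * (firstSign n g (σ k))⁻¹, ?_, fun k => ?_⟩
    · rw [Finset.prod_mul_distrib, Finset.prod_mul_distrib, hf, mul_one, Finset.prod_inv_distrib,
        Equiv.prod_comp σ, mul_inv_cancel]
    · change firstSign n g k • z'.1.2 k = _ • firstSign n g (σ k) • z.1.2 (σ k)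
      rw [hz, smul_smul, smul_smul, inv_mul_cancel_right])
  one_smul y := by
    induction y using Quotient.inductionOn with
    | h z =>
      refine congrArg (Quotient.mk _) (Subtype.ext (Prod.ext rfl (funext fun k => ?_)))
      change firstSign n 1 k • z.1.2 k = z.1.2 k
      simp [firstSign]
  mul_smul g g' y := by
    induction y using Quotient.inductionOn with
    | h z =>
      refine congrArg (Quotient.mk _) (Subtype.ext (Prod.ext rfl (funext fun k => ?_)))
      change firstSign n (g * g') k • z.1.2 k = firstSign n g k • firstSign n g' k • z.1.2 k
      rw [smul_smul]
      by_cases hk : k.val = 0 <;> simp [firstSign, hk]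

/-- Every `h ∈ I_ι^n` acts on the quotient through its product, so the action of `I_ι` is the
residual one. -/
theorem PowerQuot.mk_signs {F : LinFamily N ι} {n : ℕ} (hn : 1 ≤ n) (h : Fin n → I ι)
    (z : FibrePower F n) :
    PowerQuot.mk (FibrePower.signs h z) = (∏ k, h k) • PowerQuot.mk z := by
  obtain ⟨n, rfl⟩ := Nat.exists_eq_add_of_le' hn
  refine Quotient.sound ⟨rfl, 1, fun k => firstSign (n + 1) (∏ k, h k) k * (h k)⁻¹, ?_, fun k => ?_⟩
  · rw [Finset.prod_mul_distrib, Finset.prod_inv_distrib]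
    have : ∏ k, firstSign (n + 1) (∏ k, h k) k = ∏ k, h k := by
      rw [Fin.prod_univ_succ (fun k => firstSign (n + 1) (∏ k, h k) k)]
      simp [firstSign]
    rw [this, mul_inv_cancel]
  · change firstSign (n + 1) (∏ k, h k) k • z.1.2 k = _ • h k • z.1.2 k
    rw [smul_smul, inv_mul_cancel_right]

/-- The diagonal action of `W` on the fibre power. -/
def FibrePower.perm {F : LinFamily N ι} {n : ℕ} (w : W N) (z : FibrePower F n) :
    FibrePower F n :=
  ⟨(w • z.1.1, fun k => w • z.1.2 k), fun k => congrArg (w • ·) (z.2 k)⟩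

/-- The action of `W` on the quotient, induced by the diagonal action on the fibre power. -/
instance (F : LinFamily N ι) (n : ℕ) : MulAction (W N) (PowerQuot F n) where
  smul w := Quotient.map (FibrePower.perm w) (by
    rintro z z' ⟨h, σ, f, hf, hz⟩
    refine ⟨congrArg (w • ·) h, σ, fun k => w • f k, ?_, fun k => ?_⟩
    · have : ∀ s : Finset (Fin n), ∏ k ∈ s, w • f k = w • ∏ k ∈ s, f k := by
        intro s
        classical
        induction s using Finset.induction_on with
        | empty => rfl
        | insert a s ha ih => rw [Finset.prod_insert ha, Finset.prod_insert ha, ih, smul_mul_I]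
      rw [this, hf, smul_one_I]
    · change w • z'.1.2 k = _ • w • z.1.2 (σ k)
      rw [hz, SqFamily.smul_smul_comm])
  one_smul y := by
    induction y using Quotient.inductionOn with
    | h z =>
      exact congrArg (Quotient.mk _) (Subtype.ext (Prod.ext (one_smul _ _)
        (funext fun k => one_smul _ _)))
  mul_smul w w' y := by
    induction y using Quotient.inductionOn with
    | h z =>
      exact congrArg (Quotient.mk _) (Subtype.ext (Prod.ext (mul_smul _ _ _)
        (funext fun k => mul_smul _ _ _)))

theorem PowerQuot.base_smul {F : LinFamily N ι} {n : ℕ} (g : I ι) (y : PowerQuot F n) :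
    (g • y).base = y.base := by
  induction y using Quotient.inductionOn with
  | h z => rfl

theorem PowerQuot.base_smul' {F : LinFamily N ι} {n : ℕ} (w : W N) (y : PowerQuot F n) :
    (w • y).base = w • y.base := by
  induction y using Quotient.inductionOn with
  | h z => rfl

theorem PowerQuot.smul_smul_comm {F : LinFamily N ι} {n : ℕ} (w : W N) (g : I ι)
    (y : PowerQuot F n) : w • g • y = (w • g) • w • y := by
  induction y using Quotient.inductionOn with
  | h z =>
    refine congrArg (Quotient.mk _) (Subtype.ext (Prod.ext rfl (funext fun k => ?_)))
    change w • firstSign n g k • z.1.2 k = firstSign n (w • g) k • w • z.1.2 k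
    rw [SqFamily.smul_smul_comm]
    by_cases hk : k.val = 0 <;> simp [firstSign, hk, smul_one_I]

end Families

/-! ### The torsor -/

/-- The `(ℤ/2)^N`-torsor `{(a, c) | c_i² = d_i}` over `𝔞^{rs}`. -/
def RootCover (N : ℕ) : Type := {p : Ars N × (Fin N → ℂ) // ∀ i, p.2 i ^ 2 = d p.1 i}

instance (N : ℕ) : SpaceWithFunctions (RootCover N) :=
  inferInstanceAs (SpaceWithFunctions {p : Ars N × (Fin N → ℂ) // ∀ i, p.2 i ^ 2 = d p.1 i})

/-- Sign changes of the `c_i`. -/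
def RootCover.signs {N : ℕ} (ζ : Fin N → ℤˣ) (p : RootCover N) : RootCover N :=
  ⟨(p.1.1, signL ζ p.1.2), fun i => (congrFun (sq_signL ζ p.1.2) i).trans (p.2 i)⟩

theorem RootCover.signs_mul {N : ℕ} (ζ ξ : Fin N → ℤˣ) (p : RootCover N) :
    RootCover.signs (ζ * ξ) p = RootCover.signs ζ (RootCover.signs ξ p) := by
  refine Subtype.ext (Prod.ext rfl (funext fun i => ?_))
  simp [RootCover.signs, signL, mul_assoc]

theorem RootCover.signs_one {N : ℕ} (p : RootCover N) : RootCover.signs 1 p = p := by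
  refine Subtype.ext (Prod.ext rfl (funext fun i => ?_))
  simp [RootCover.signs, signL]

/-- Orbits of the diagonal `ℤ/2 ⊆ (ℤ/2)^N`. -/
def rootSetoid (N : ℕ) : Setoid (RootCover N) where
  r p q := ∃ ζ ∈ diagSigns (Fin N), q = RootCover.signs ζ p
  iseqv := {
    refl := fun p => ⟨1, one_mem _, (RootCover.signs_one p).symm⟩
    symm := by
      rintro p q ⟨ζ, hζ, rfl⟩
      exact ⟨ζ⁻¹, inv_mem hζ, by rw [← RootCover.signs_mul, inv_mul_cancel, RootCover.signs_one]⟩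
    trans := by
      rintro p q r ⟨ζ, hζ, rfl⟩ ⟨ξ, hξ, rfl⟩
      exact ⟨ξ * ζ, mul_mem hξ hζ, RootCover.signs_mul _ _ _ |>.symm⟩ }

/-- The `I_N`-torsor `𝔞̃^{rs}` over `𝔞^{rs}`: the quotient of `{(a, c) | c_i² = d_i}` by the diagonal
`ℤ/2`. -/
def ATilde (N : ℕ) : Type := Quotient (rootSetoid N)

instance (N : ℕ) : SpaceWithFunctions (ATilde N) :=
  inferInstanceAs (SpaceWithFunctions (Quotient (rootSetoid N)))

/-- The projection to `𝔞^{rs}`. -/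
def ATilde.base {N : ℕ} : ATilde N → Ars N :=
  Quotient.lift (fun p : RootCover N => p.1.1) (by rintro p q ⟨ζ, _, rfl⟩; rfl)

/-- The action of `(ℤ/2)^N` on `𝔞̃^{rs}`. -/
def ATilde.signsEnd (N : ℕ) : (Fin N → ℤˣ) →* Function.End (ATilde N) where
  toFun ζ := Quotient.map (RootCover.signs ζ) (by
    rintro p q ⟨ξ, hξ, rfl⟩
    exact ⟨ξ, hξ, by rw [← RootCover.signs_mul, ← RootCover.signs_mul, mul_comm]⟩)
  map_one' := by
    funext c
    induction c using Quotient.inductionOn with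
    | h p => exact congrArg (Quotient.mk _) (RootCover.signs_one p)
  map_mul' ζ ξ := by
    funext c
    induction c using Quotient.inductionOn with
    | h p => exact congrArg (Quotient.mk _) (RootCover.signs_mul ζ ξ p)

/-- The action of `I_N` on the torsor `𝔞̃^{rs}`. -/
instance (N : ℕ) : MulAction (I (Fin N)) (ATilde N) :=
  MulAction.ofEndHom (QuotientGroup.lift (diagSigns (Fin N)) (ATilde.signsEnd N) (by
    intro ζ hζ
    funext c
    induction c using Quotient.inductionOn with
    | h p =>
      refine (Quotient.sound ?_ : Quotient.mk (rootSetoid N) p = _).symm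
      exact ⟨ζ, hζ, rfl⟩))

/-- Permutation of the `a_i` and the `c_i`. -/
def RootCover.perm {N : ℕ} (w : W N) (p : RootCover N) : RootCover N :=
  ⟨(w • p.1.1, permL w p.1.2), fun i => (p.2 _).trans (d_smul w p.1.1 i).symm⟩

theorem RootCover.perm_signs {N : ℕ} (w : W N) (ζ : Fin N → ℤˣ) (p : RootCover N) :
    RootCover.perm w (RootCover.signs ζ p) =
      RootCover.signs (permSigns w ζ) (RootCover.perm w p) := rfl

/-- The action of `W` on `𝔞̃^{rs}`. -/
instance (N : ℕ) : MulAction (W N) (ATilde N) where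
  smul w := Quotient.map (RootCover.perm w) (by
    rintro p q ⟨ξ, hξ, rfl⟩
    obtain ⟨e, he⟩ := mem_diagSigns.1 hξ
    exact ⟨permSigns w ξ, mem_diagSigns.2 ⟨e, fun i => he _⟩, RootCover.perm_signs w ξ p⟩)
  one_smul c := by
    induction c using Quotient.inductionOn with
    | h p =>
      refine congrArg (Quotient.mk _) (Subtype.ext (Prod.ext (one_smul _ p.1.1) ?_))
      funext i
      simp [RootCover.perm, permL_apply]
  mul_smul w w' c := by
    induction c using Quotient.inductionOn with
    | h p =>
      refine congrArg (Quotient.mk _) (Subtype.ext (Prod.ext (mul_smul w w' p.1.1) ?_))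
      funext i
      simp [RootCover.perm, permL_apply]

theorem ATilde.base_smul {N : ℕ} (g : I (Fin N)) (c : ATilde N) : (g • c).base = c.base := by
  induction g using QuotientGroup.induction_on with
  | H ζ =>
    induction c using Quotient.inductionOn with
    | h p => rfl

theorem ATilde.base_smul' {N : ℕ} (w : W N) (c : ATilde N) : (w • c).base = w • c.base := by
  induction c using Quotient.inductionOn with
  | h p => rfl

theorem ATilde.smul_smul_comm {N : ℕ} (w : W N) (g : I (Fin N)) (c : ATilde N) :
    w • g • c = (w • g) • w • c := by
  induction g using QuotientGroup.induction_on with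
  | H ζ =>
    induction c using Quotient.inductionOn with
    | h p => exact congrArg (Quotient.mk _) (RootCover.perm_signs w ζ p)

/-! ### The twist -/

section Twist

variable {N : ℕ} {ι : Type} [MulAction (W N) ι]

/-- The fibre product of `C^n / (Ī ⋊ S_n)` and `𝔞̃^{rs}` over `𝔞^{rs}`. -/
def FibreProduct (F : LinFamily N ι) (n : ℕ) : Type :=
  {p : PowerQuot F n × ATilde N // p.1.base = p.2.base}

instance (F : LinFamily N ι) (n : ℕ) : SpaceWithFunctions (FibreProduct F n) :=
  inferInstanceAs (SpaceWithFunctions {p : PowerQuot F n × ATilde N // p.1.base = p.2.base})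

/-- Orbits of the diagonal action of `I_N` on the fibre product, where `I_N` acts on the first
factor through a homomorphism `κ : I_N → I_ι`. -/
def twistSetoid (F : LinFamily N ι) (n : ℕ) (κ : IHom N ι) : Setoid (FibreProduct F n) where
  r p q := ∃ g : I (Fin N), q.1 = (κ.hom g • p.1.1, g • p.1.2)
  iseqv := {
    refl := fun p => ⟨1, by simp⟩
    symm := by
      rintro p q ⟨g, h⟩
      exact ⟨g⁻¹, by rw [h]; simp⟩
    trans := by
      rintro p q r ⟨g, h⟩ ⟨g', h'⟩
      exact ⟨g' * g, by rw [h', h]; simp [mul_smul]⟩ }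

/-- The twist `(C^n / (Ī ⋊ S_n) ×_{𝔞^{rs}} 𝔞̃^{rs}) / I_N`. -/
def Twist (F : LinFamily N ι) (n : ℕ) (κ : IHom N ι) : Type := Quotient (twistSetoid F n κ)

instance (F : LinFamily N ι) (n : ℕ) (κ : IHom N ι) : SpaceWithFunctions (Twist F n κ) :=
  inferInstanceAs (SpaceWithFunctions (Quotient (twistSetoid F n κ)))

/-- The projection to `𝔞^{rs}`. -/
def Twist.base {F : LinFamily N ι} {n : ℕ} {κ : IHom N ι} : Twist F n κ → Ars N :=
  Quotient.lift (fun p : FibreProduct F n => p.1.1.base) (by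
    rintro p q ⟨g, h⟩
    rw [h]
    exact (PowerQuot.base_smul _ _).symm)

/-- `I_ι` acts on the twist through the first factor. -/
instance (F : LinFamily N ι) (n : ℕ) (κ : IHom N ι) : MulAction (I ι) (Twist F n κ) where
  smul f := Quotient.map
    (fun p : FibreProduct F n => (⟨(f • p.1.1, p.1.2), (PowerQuot.base_smul _ _).trans p.2⟩ :
      FibreProduct F n)) (by
    rintro p q ⟨g, h⟩
    refine ⟨g, ?_⟩
    change (f • q.1.1, q.1.2) = (κ.hom g • f • p.1.1, g • p.1.2)
    rw [h, smul_smul, smul_smul, mul_comm])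
  one_smul y := by
    induction y using Quotient.inductionOn with
    | h p => exact congrArg (Quotient.mk _) (Subtype.ext (Prod.ext (one_smul _ _) rfl))
  mul_smul f f' y := by
    induction y using Quotient.inductionOn with
    | h p => exact congrArg (Quotient.mk _) (Subtype.ext (Prod.ext (mul_smul _ _ _) rfl))

/-- `W` acts diagonally on the twist. -/
instance (F : LinFamily N ι) (n : ℕ) (κ : IHom N ι) : MulAction (W N) (Twist F n κ) where
  smul w := Quotient.map
    (fun p : FibreProduct F n => (⟨(w • p.1.1, w • p.1.2), by
      change (w • p.1.1).base = (w • p.1.2).base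
      rw [PowerQuot.base_smul', ATilde.base_smul', p.2]⟩ : FibreProduct F n)) (by
    rintro p q ⟨g, h⟩
    refine ⟨w • g, ?_⟩
    change (w • q.1.1, w • q.1.2) = (κ.hom (w • g) • w • p.1.1, (w • g) • w • p.1.2)
    rw [h, κ.map_smul, ← PowerQuot.smul_smul_comm, ← ATilde.smul_smul_comm])
  one_smul y := by
    induction y using Quotient.inductionOn with
    | h p => exact congrArg (Quotient.mk _) (Subtype.ext (Prod.ext (one_smul _ _) (one_smul _ _)))
  mul_smul w w' y := by
    induction y using Quotient.inductionOn with
    | h p =>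
      exact congrArg (Quotient.mk _) (Subtype.ext (Prod.ext (mul_smul _ _ _) (mul_smul _ _ _)))

end Twist

/-! ### The families of the theorem -/

section Concrete

/-- The subspaces `{q ∈ ℂ^N | ∑_j a_j^i c_j(a) q_j = 0, 0 ≤ i < m}`, with weights `c_j(a)`. -/
def quadFamily {N : ℕ} (c : Ars N → Fin N → ℂ)
    (hc : ∀ (w : W N) (a : Ars N) (j : Fin N), c (w • a) j = c a (w⁻¹ • j)) (m : ℕ) :
    LinFamily N (Fin N) where
  E a :=
    { carrier := {q | ∀ i < m, ∑ j, a.1 j ^ i * c a j * q j = 0}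
      zero_mem' := by intro i _; simp
      add_mem' := by
        intro q r hq hr i hi
        simp [mul_add, Finset.sum_add_distrib, hq i hi, hr i hi]
      smul_mem' := by
        intro s q hq i hi
        simp only [Pi.smul_apply, smul_eq_mul, mul_left_comm _ s, ← Finset.mul_sum, hq i hi,
          mul_zero] }
  perm_mem w a q hq i hi := by
    refine Eq.trans ?_ (hq i hi)
    rw [← Equiv.sum_comp (w⁻¹) (fun j => a.1 j ^ i * c a j * q j)]
    refine Finset.sum_congr rfl fun j _ => ?_
    rw [hc]
    rfl

/-- The subspaces of `ℂ^{N+1}` given by `∑_j a_j^i c_j(a) q_j = 0`, `0 ≤ i < m`, and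
`∑_j a_j^m c_j(a) q_j - q_{N+1} = 0`. -/
def quadFamilyTilde {N : ℕ} (c : Ars N → Fin N → ℂ)
    (hc : ∀ (w : W N) (a : Ars N) (j : Fin N), c (w • a) j = c a (w⁻¹ • j)) (m : ℕ) :
    LinFamily N (Option (Fin N)) where
  E a :=
    { carrier := {q | (∀ i < m, ∑ j, a.1 j ^ i * c a j * q (some j) = 0) ∧
        ∑ j, a.1 j ^ m * c a j * q (some j) - q none = 0}
      zero_mem' := by simp
      add_mem' := by
        rintro q r ⟨hq, hq'⟩ ⟨hr, hr'⟩
        refine ⟨fun i hi => ?_, ?_⟩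
        · simp [mul_add, Finset.sum_add_distrib, hq i hi, hr i hi]
        · simp only [Pi.add_apply, mul_add, Finset.sum_add_distrib]
          linear_combination hq' + hr'
      smul_mem' := by
        rintro s q ⟨hq, hq'⟩
        refine ⟨fun i hi => ?_, ?_⟩
        · simp only [Pi.smul_apply, smul_eq_mul, mul_left_comm _ s, ← Finset.mul_sum, hq i hi,
            mul_zero]
        · simp only [Pi.smul_apply, smul_eq_mul, mul_left_comm _ s, ← Finset.mul_sum, ← mul_sub,
            hq', mul_zero] }
  perm_mem w a q hq := by
    have key : ∀ i, ∑ j, (w • a).1 j ^ i * c (w • a) j * (permL w q) (some j) =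
        ∑ j, a.1 j ^ i * c a j * q (some j) := by
      intro i
      rw [← Equiv.sum_comp (w⁻¹) (fun j => a.1 j ^ i * c a j * q (some j))]
      refine Finset.sum_congr rfl fun j _ => ?_
      rw [hc]
      rfl
    refine ⟨fun i hi => (key i).trans (hq.1 i hi), ?_⟩
    rw [key]
    exact hq.2

theorem d_inv_smul {N : ℕ} (w : W N) (a : Ars N) (j : Fin N) :
    (d (w • a) j)⁻¹ = (d a (w⁻¹ • j))⁻¹ := by rw [d_smul]

/-- `X_m|_{𝔞^{rs}}`: the intersections of quadrics `∑_j a_j^i v_j² = 0`, `0 ≤ i < m`. -/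
abbrev X (N m : ℕ) : Type := SqFamily (quadFamily (N := N) (fun _ _ => 1) (fun _ _ _ => rfl) m)

/-- `X'_m|_{𝔞^{rs}}`: the intersections of quadrics `∑_j (a_j^i / d_j) v_j² = 0`, `0 ≤ i < m`. -/
abbrev X' (N m : ℕ) : Type := SqFamily (quadFamily (N := N) (fun a j => (d a j)⁻¹) d_inv_smul m)

/-- `X̃_m|_{𝔞^{rs}}`: the intersections of quadrics `∑_j a_j^i v_j² = 0`, `0 ≤ i < m`, and
`∑_j a_j^m v_j² - ε² = 0`, where `ε = v_{N+1}`. -/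
abbrev XTilde (N m : ℕ) : Type :=
  SqFamily (quadFamilyTilde (N := N) (fun _ _ => 1) (fun _ _ _ => rfl) m)

/-- The bundle `Ṽ'_m` of subspaces of `ℂ^{N+1}` given by `∑_j (a_j^i / d_j) v_j = 0`, `0 ≤ i < m`,
and `∑_j (a_j^m / d_j) v_j - v_{N+1} = 0`. -/
abbrev VTilde' (N m : ℕ) : LinFamily N (Option (Fin N)) :=
  quadFamilyTilde (N := N) (fun a j => (d a j)⁻¹) d_inv_smul m

/-- `X̃'_m|_{𝔞^{rs}}`: the intersections of quadrics `∑_j (a_j^i / d_j) v_j² = 0`, `0 ≤ i < m`, and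
`∑_j (a_j^m / d_j) v_j² - ε² = 0`. -/
abbrev XTilde' (N m : ℕ) : Type := SqFamily (VTilde' N m)

/-- The family of planes `{(t - a_i u)_i | t, u ∈ ℂ}` in `ℂ^N`. -/
def curveFamily (N : ℕ) : LinFamily N (Fin N) where
  E a :=
    { carrier := {q | ∃ t u : ℂ, ∀ i, q i = t - a.1 i * u}
      zero_mem' := ⟨0, 0, by simp⟩
      add_mem' := by
        rintro q r ⟨t, u, h⟩ ⟨t', u', h'⟩
        exact ⟨t + t', u + u', fun i => by simp only [Pi.add_apply, h, h']; ring⟩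
      smul_mem' := by
        rintro s q ⟨t, u, h⟩
        exact ⟨s * t, s * u, fun i => by simp only [Pi.smul_apply, h, smul_eq_mul]; ring⟩ }
  perm_mem := by
    rintro w a q ⟨t, u, h⟩
    exact ⟨t, u, fun i => h _⟩

/-- The family of planes `{((t - a_i u)_i, u) | t, u ∈ ℂ}` in `ℂ^{N+1}`. -/
def curveFamilyTilde (N : ℕ) : LinFamily N (Option (Fin N)) where
  E a :=
    { carrier := {q | ∃ t u : ℂ, (∀ i, q (some i) = t - a.1 i * u) ∧ q none = u}
      zero_mem' := ⟨0, 0, by simp⟩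
      add_mem' := by
        rintro q r ⟨t, u, h, k⟩ ⟨t', u', h', k'⟩
        exact ⟨t + t', u + u', fun i => by simp only [Pi.add_apply, h, h']; ring,
          by simp only [Pi.add_apply, k, k']⟩
      smul_mem' := by
        rintro s q ⟨t, u, h, k⟩
        exact ⟨s * t, s * u, fun i => by simp only [Pi.smul_apply, h, smul_eq_mul]; ring,
          by simp only [Pi.smul_apply, k, smul_eq_mul]⟩ }
  perm_mem := by
    rintro w a q ⟨t, u, h, k⟩
    exact ⟨t, u, fun i => h _, k⟩

/-- `C → 𝔞^{rs}`: the fibre `C_a = {[y_1, …, y_N] | y_i² = t - a_i u for some t, u}` is the smooth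
projective model of `ℂ(t)(((t - a_i)/(t - a_1))^{1/2}, i = 2, …, N)`, with `t = [t : u]` the map to
`ℙ¹` and `y_i / y_1` the square roots. (This is for `N ≥ 3`.) -/
abbrev Curve (N : ℕ) : Type := SqFamily (curveFamily N)

/-- `C̃ → 𝔞^{rs}`: the fibre `C̃_a = {[y_1, …, y_{N+1}] | y_i² = t - a_i u, y_{N+1}² = u for some t, u}`
is the smooth projective model of `ℂ(t)((t - a_i)^{1/2}, i = 1, …, N)`, with `t = [t : u]` the map
to `ℙ¹` and `y_i / y_{N+1}` the square roots. -/
abbrev CurveTilde (N : ℕ) : Type := SqFamily (curveFamilyTilde N)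

/-- The quotient `C^n / (Ī ⋊ S_n)`; this is `𝒴_m` for `n = N - m - 1`. -/
abbrev Y (N n : ℕ) : Type := PowerQuot (curveFamily N) n

/-- The quotient `C̃^n / (Ī ⋊ S_n)`; this is `𝒴̃_m` for `n = N - m - 1`. -/
abbrev YTilde (N n : ℕ) : Type := PowerQuot (curveFamilyTilde N) n

/-- `𝒴_m^t = (𝒴_m ×_{𝔞^{rs}} 𝔞̃^{rs}) / I_N`. -/
abbrev YTwist (N n : ℕ) : Type := Twist (curveFamily N) n (IHom.id N)

/-- `𝒴̃_m^t = (𝒴̃_m ×_{𝔞^{rs}} 𝔞̃^{rs}) / I_N`, where `I_N` acts on `𝒴̃_m` through `κ`. -/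
abbrev YTildeTwist {N : ℕ} (hN : Odd N) (n : ℕ) : Type :=
  Twist (curveFamilyTilde N) n (kappa hN)

end Concrete

/-! ### The Weyl group action on `X̃_m` coming from `K = SO_N` -/

/-- The element `(sgn w, …, sgn w, 1)` of `I_{N+1}`. -/
def soSign {N : ℕ} (w : W N) : I (Option (Fin N)) :=
  QuotientGroup.mk (fun o => o.elim 1 (fun _ => Equiv.Perm.sign w))

/-- The action of `W` on families in `ℙ(V ⊕ ℂ)` induced by the natural action of
`K = SO(V)` on `V`: for odd `N`, the Weyl group is realized in the normalizer of the diagonal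
Cartan subspace in `SO_N` by the matrices `sgn(w) P_w` of determinant one, where `P_w` are the
permutation matrices, so that `w (a, [v, ε]) = (w a, [sgn(w) P_w v, ε])`. -/
def weylK {N : ℕ} {F : LinFamily N (Option (Fin N))} (w : W N) (x : SqFamily F) : SqFamily F :=
  soSign w • w • x

theorem soSign_mul {N : ℕ} (w w' : W N) : soSign (w * w') = soSign w * soSign w' := by
  refine congrArg QuotientGroup.mk (funext fun o => ?_)
  cases o <;> simp

theorem smul_soSign {N : ℕ} (w w' : W N) : w • soSign w' = soSign w' := by
  refine congrArg QuotientGroup.mk (funext fun o => ?_)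
  cases o <;> rfl

theorem weylK_mul {N : ℕ} {F : LinFamily N (Option (Fin N))} (w w' : W N) (x : SqFamily F) :
    weylK (w * w') x = weylK w (weylK w' x) := by
  unfold weylK
  rw [SqFamily.smul_smul_comm, smul_soSign, soSign_mul, mul_smul, mul_smul]

theorem weylK_one {N : ℕ} {F : LinFamily N (Option (Fin N))} (x : SqFamily F) :
    weylK 1 x = x := by
  have : soSign (1 : W N) = 1 := by
    refine congrArg QuotientGroup.mk (funext fun o => ?_)
    cases o <;> simp
  rw [weylK, this, one_smul, one_smul]

/-! ### Forgetting the last coordinate -/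

/-- Conditions under which `(a, [v, ε]) ↦ (a, [v])` is well defined. -/
structure Forgets {N : ℕ} (F' : LinFamily N (Option (Fin N))) (F : LinFamily N (Fin N)) :
    Prop where
  mem : ∀ a q, q ∈ F'.E a → (fun i => q (some i)) ∈ F.E a
  eq_zero : ∀ a q, q ∈ F'.E a → (∀ i, q (some i) = 0) → q none = 0

section Forget

variable {N : ℕ} {F' : LinFamily N (Option (Fin N))} {F : LinFamily N (Fin N)}

theorem Forgets.ne_zero (h : Forgets F' F) {a : Ars N} {v : Option (Fin N) → ℂ}
    (hv : v ≠ 0) (hq : sq v ∈ F'.E a) : (fun i => v (some i)) ≠ 0 := by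
  intro h0
  apply hv
  have h1 : ∀ i, v (some i) = 0 := congrFun h0
  have h2 := h.eq_zero a _ hq (fun i => by simp [sq, h1 i])
  funext o
  cases o with
  | none => simpa [sq] using h2
  | some i => exact h1 i

/-- The map `(a, [v, ε]) ↦ (a, [v])`. -/
def forget (h : Forgets F' F) (x : SqFamily F') : SqFamily F :=
  ⟨(x.1.1, Projectivization.mk ℂ (fun i => x.1.2.rep (some i))
    (h.ne_zero x.1.2.rep_nonzero x.2)), (sq_rep_mem_iff _ _ _).2 (h.mem _ _ x.2)⟩

theorem forget_mk (h : Forgets F' F) (a : Ars N) (v : Option (Fin N) → ℂ) (hv : v ≠ 0)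
    (hx : sq (Projectivization.mk ℂ v hv).rep ∈ F'.E a) :
    (forget h ⟨(a, Projectivization.mk ℂ v hv), hx⟩).1 =
      (a, Projectivization.mk ℂ (fun i => v (some i))
        (h.ne_zero hv ((sq_rep_mem_iff _ _ _).1 hx))) := by
  refine Prod.ext rfl ?_
  change Projectivization.mk ℂ _ _ = Projectivization.mk ℂ _ _
  obtain ⟨c, hc⟩ := Projectivization.exists_smul_eq_mk_rep ℂ v hv
  rw [Projectivization.mk_eq_mk_iff]
  exact ⟨c, by funext i; simp [← hc]⟩

/-- `I_{N+1} → I_N`, forgetting the last coordinate. -/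
def forgetI (N : ℕ) : I (Option (Fin N)) →* I (Fin N) :=
  QuotientGroup.map (diagSigns (Option (Fin N))) (diagSigns (Fin N))
    { toFun := fun ζ i => ζ (some i), map_one' := rfl, map_mul' := fun _ _ => rfl } (by
      intro ζ h
      obtain ⟨e, he⟩ := mem_diagSigns.1 h
      exact mem_diagSigns.2 ⟨e, fun i => he _⟩)

theorem forget_smul (h : Forgets F' F) (g : I (Option (Fin N))) (x : SqFamily F') :
    forget h (g • x) = forgetI N g • forget h x := by
  obtain ⟨⟨a, p⟩, hp⟩ := x
  induction g using QuotientGroup.induction_on with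
  | H ζ =>
    induction p using Projectivization.ind with
    | h v hv =>
      apply Subtype.ext
      refine Eq.trans (forget_mk h a (signL ζ v) _ _) ?_
      have := forget_mk h a v hv hp
      refine Prod.ext rfl ?_
      change _ = IEnd (Fin N) (forgetI N (QuotientGroup.mk ζ)) (forget h _).1.2
      rw [this]
      rfl

/-- The map on the quotients of the fibre powers induced by forgetting the last coordinates. -/
def forgetPower (h : Forgets F' F) (n : ℕ) : PowerQuot F' n → PowerQuot F n :=
  Quotient.map (fun z : FibrePower F' n =>
    (⟨(z.1.1, fun k => forget h (z.1.2 k)), fun k => z.2 k⟩ : FibrePower F n)) (by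
    rintro z z' ⟨hb, σ, g, hg, hz⟩
    refine ⟨hb, σ, fun k => forgetI N (g k), ?_, fun k => ?_⟩
    · rw [← map_prod, hg, map_one]
    · change forget h (z'.1.2 k) = _ • forget h (z.1.2 (σ k))
      rw [hz, forget_smul])

end Forget

/-- The double cover `X̃'_m → X'_m`, `(a, [v, ε]) ↦ (a, [v])`, is defined. -/
theorem forgets_X' (N m : ℕ) :
    Forgets (VTilde' N m) (quadFamily (N := N) (fun a j => (d a j)⁻¹) d_inv_smul m) where
  mem a q hq := hq.1
  eq_zero a q hq h := by
    have := hq.2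
    simpa [h] using this

/-- The map `C̃ → C` forgetting the last coordinate is defined. -/
theorem forgets_curve {N : ℕ} (hN : 2 ≤ N) : Forgets (curveFamilyTilde N) (curveFamily N) where
  mem := by
    rintro a q ⟨t, u, h, -⟩
    exact ⟨t, u, h⟩
  eq_zero := by
    rintro a q ⟨t, u, h, hu⟩ h0
    by_contra hne
    have h1 : (⟨0, by omega⟩ : Fin N) = ⟨1, by omega⟩ := by
      apply a.2.1
      have e0 := (h ⟨0, by omega⟩).symm.trans (h0 _)
      have e1 := (h ⟨1, by omega⟩).symm.trans (h0 _)
      rw [hu] at hne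
      apply mul_right_cancel₀ hne
      linear_combination e1 - e0
    simp at h1

/-- `p : X → Y` is the quotient of `X` by the subgroup `ℤ/2` of `I_{N+1}` generated by the last
coordinate: it induces an isomorphism from the orbit space onto `Y`. -/
def IsLastSignQuotient {N : ℕ} {X Y : Type} [SpaceWithFunctions X] [SpaceWithFunctions Y]
    [MulAction (I (Option (Fin N))) X] (p : X → Y) : Prop :=
  ∃ e : Quotient (MulAction.orbitRel (Subgroup.zpowers (lastSign N)) X) ≃ Y,
    SpaceWithFunctions.IsIsomorphism e ∧ ∀ x, e (Quotient.mk _ x) = p x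

/-! ### Hyperplane configurations -/

/-- The linear forms `H_{a,i} = x_1 + a_i x_2 + ⋯ + a_i^n x_{n+1}`, `i = 1, …, N`, and
`H_{a,N+1} = x_{n+1}` on `ℂ^{n+1}`. -/
def H {N n : ℕ} (a : Ars N) (o : Option (Fin N)) (x : Fin (n + 1) → ℂ) : ℂ :=
  o.elim (x (Fin.last n)) (fun i => ∑ k : Fin (n + 1), a.1 i ^ (k : ℕ) * x k)

/-- The homogeneous coordinates of the image of `([t_k : u_k])_k` under
`(ℙ¹)^n → (ℙ¹)^n / S_n ≅ ℙ^n`: the coefficients of `∏_k (u_k T - t_k)`.  On this point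
`H_{a,i}` takes the value `∏_k (u_k a_i - t_k)` and `H_{a,N+1}` the value `∏_k u_k`. -/
def symCoords {n : ℕ} (t u : Fin n → ℂ) : Fin (n + 1) → ℂ := fun j =>
  (∏ k, (Polynomial.C (u k) * Polynomial.X - Polynomial.C (t k))).coeff j

/-- A map `ψ : X̃'_m → 𝒴̃_m` covers the equivalence of configurations `ℙ^n × 𝔞^{rs} ≅ ℙ(Ṽ'_m)`,
`x ↦ (H_{a,o}(x))_o`: if `ψ (a, [v])` is the class of a tuple of points of `C̃_a` lying over
`([t_k : u_k])_k`, then `[v_o²]_o = [H_{a,o}(x)]_o`, where `x` is the point of `ℙ^n`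
corresponding to `([t_k : u_k])_k`. -/
def CoversConfigurations {N m n : ℕ} (ψ : XTilde' N m → YTilde N n) : Prop :=
  ∀ (x : XTilde' N m) (z : FibrePower (curveFamilyTilde N) n), ψ x = PowerQuot.mk z →
    ∀ t u : Fin n → ℂ,
      (∀ k, (∀ i, (z.1.2 k).1.2.rep (some i) ^ 2 = t k - z.1.1.1 i * u k) ∧
        (z.1.2 k).1.2.rep none ^ 2 = u k) →
      ∃ c : ℂ, c ≠ 0 ∧ ∀ o, x.1.2.rep o ^ 2 = c * H z.1.1 o (symCoords t u)

end

end QuadricTwist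

open QuadricTwist

/-! Lagrange interpolation explains the weights 1/d_j. For N odd and a polynomial p with deg p + i <
N, the sum of a_j^i p(a_j)/d_j is the coefficient of T^(N-1-i) in p (`sum_pow_mul_eval_div_d`). Read
a vector q as the values q_j = p(a_j). The equations of X'_m then kill the coefficients of p from
the top until deg p ≤ n, and the additional equation makes the last coordinate the coefficient of
T^n (`mem_VTilde'_iff`). So the bundle of part 3 is the space of binary forms of degree n, evaluated
at the a_j and at infinity.

A binary form is a product of linear forms, unique up to order and scalars. The value of ∏(u_k T -
t_k) at a_i is (-1)^n ∏(t_k - a_i u_k), and on the curve each t_k - a_i u_k is a square y_{k,i}².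
Hence v_i = I^n ∏_k y_{k,i} (with I² = -1) and v_{N+1} = ∏_k y_{k,N+1} define a map from tuples of
points of the curve to X'_m or its double cover. It is surjective, since square roots of the linear
factors exist and wrong signs can be corrected at one point (`MultiCone.toCone_surjective`). Two
tuples with the same image lie over the same points of ℙ¹ up to order, and differ by signs whose
product is the same in every coordinate, so they agree in the quotient
(`PowerQuot.toConfig_injective`). A `Marking` of the indices treats N and N + 1 coordinates at once.

It remains to see that the inverse is regular: a function is regular on the target once its pullback
to tuples is (`MultiCone.descends`). The pullback is a fraction of multihomogeneous functions;
numerator and denominator are averaged over permutations and sign changes of product one. The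
average of a monomial vanishes unless each coordinate has the same exponent parity in all the y_k.
What survives is a product of coordinates v_o times a symmetric multihomogeneous function of the
pairs (t_k, u_k). Polarization expresses the latter through the coefficients of ∏(u_k T - t_k),
which interpolation recovers from the v_i² (`sum_act_monomial_mem`). The averaged denominator might
vanish, but some power sum of its conjugates does not (`exists_sum_pow_ne_zero`). The same
averaging, for plain square roots, gives `SqrtCover.descends`, which serves the quotient by the last
sign and the torsor.

For the twist, let δ be the multiple of the Vandermonde determinant with δ² = ∏ d_i. On the torsor
r_j = c_j (∏ c_i)/(δ d_j) satisfies r_j² = 1/d_j, so multiplying v_j by r_j turns the weighted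
families into the unweighted ones. Being of even degree N + 1 in c, r_j survives c ↦ -c, and a sign
change ζ multiplies it by ζ_j ∏ ζ_i, which is κ. A permutation multiplies δ by its sign. This is the
factor sgn(w) in the action through SO_N; without the coordinate ε it is a scalar and disappears. -/

namespace QuadricTwist

noncomputable section

/-! ### Sheaf properties, universal properties of the constructions, and descent of regularity. -/

namespace SpaceWithFunctions

/-! ### General properties of spaces with functions -/

section Opens

variable {X : Type*} (s : SpaceWithFunctions X)

theorem isOpenZ_univ : s.IsOpenZ Set.univ := @isOpen_univ X s.zariski

theorem IsOpenZ.inter {s : SpaceWithFunctions X} {U V : Set X} (hU : s.IsOpenZ U)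
    (hV : s.IsOpenZ V) : s.IsOpenZ (U ∩ V) := @IsOpen.inter X s.zariski _ _ hU hV

theorem isOpenZ_iInter {s : SpaceWithFunctions X} {κ : Type*} [Finite κ] {U : κ → Set X}
    (hU : ∀ k, s.IsOpenZ (U k)) : s.IsOpenZ (⋂ k, U k) :=
  @isOpen_iInter_of_finite X κ s.zariski _ _ hU

theorem isOpenZ_iff {s : SpaceWithFunctions X} {U : Set X} :
    s.IsOpenZ U ↔ ∀ x ∈ U, ∃ V, s.IsOpenZ V ∧ x ∈ V ∧ V ⊆ U := by
  let := s.zariski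
  refine (isOpen_iff_forall_mem_open (s := U)).trans ?_
  exact forall₂_congr fun x _ => ⟨fun ⟨V, h1, h2, h3⟩ => ⟨V, h2, h3, h1⟩,
    fun ⟨V, h1, h2, h3⟩ => ⟨V, h3, h1, h2⟩⟩

end Opens

/-- The expected properties of a sheaf of regular functions. -/
class IsGood {X : Type*} (s : SpaceWithFunctions X) : Prop where
  const : ∀ (c : ℂ) (x : X), s.RegularAt (fun _ => c) x
  add : ∀ {f g : X → ℂ} {x : X}, s.RegularAt f x → s.RegularAt g x → s.RegularAt (f + g) x
  mul : ∀ {f g : X → ℂ} {x : X}, s.RegularAt f x → s.RegularAt g x → s.RegularAt (f * g) x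
  inv : ∀ {f : X → ℂ} {x : X}, s.RegularAt f x → f x ≠ 0 → s.RegularAt f⁻¹ x
  ne_zero : ∀ {f : X → ℂ} {x : X}, s.RegularAt f x → f x ≠ 0 →
    ∃ U, s.IsOpenZ U ∧ x ∈ U ∧ ∀ y ∈ U, f y ≠ 0
  congr : ∀ {f g : X → ℂ} {x : X} {U : Set X}, s.RegularAt f x → s.IsOpenZ U → x ∈ U →
    (∀ y ∈ U, g y = f y) → s.RegularAt g x
  near : ∀ {f : X → ℂ} {x : X}, s.RegularAt f x →
    ∃ U, s.IsOpenZ U ∧ x ∈ U ∧ ∀ y ∈ U, s.RegularAt f y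

section Indicator

open Classical in
/-- The function that is one on `U` and zero elsewhere. -/
def indicatorFn {X : Type*} (U : Set X) : X → ℂ := fun x => if x ∈ U then 1 else 0

theorem indicatorFn_ne_zero {X : Type*} {U : Set X} {x : X} : indicatorFn U x ≠ 0 ↔ x ∈ U := by
  classical
  simp [indicatorFn]

/-- Regularity is a local condition, so the indicator of an open set is regular on that set. Through
such functions the topology is visible to pullback of functions, and continuity becomes a
consequence of regularity. -/
theorem regularAt_indicatorFn {X : Type*} {s : SpaceWithFunctions X} [h : IsGood s] {U : Set X}
    (hU : s.IsOpenZ U) {x : X} (hx : x ∈ U) : s.RegularAt (indicatorFn U) x :=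
  h.congr (h.const 1 x) hU hx fun y hy => by simp [indicatorFn, hy]

end Indicator

/-! ### Affine space -/

section Affine

variable {ι : Type*}

/-- The generating sets P ≠ 0 are already a basis, since intersecting two of them amounts to
multiplying the polynomials. -/
theorem affine_basis {U : Set (ι → ℂ)} (hU : (affine ι).IsOpenZ U) {x : ι → ℂ} (hx : x ∈ U) :
    ∃ P : MvPolynomial ι ℂ, MvPolynomial.eval x P ≠ 0 ∧
      ∀ y, MvPolynomial.eval y P ≠ 0 → y ∈ U := by
  induction hU with
  | basic U h =>
    obtain ⟨P, rfl⟩ := h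
    exact ⟨P, hx, fun y hy => hy⟩
  | univ => exact ⟨1, by simp, fun y _ => trivial⟩
  | inter U V _ _ h1 h2 =>
    obtain ⟨P, hP, hP'⟩ := h1 hx.1
    obtain ⟨Q, hQ, hQ'⟩ := h2 hx.2
    refine ⟨P * Q, by simp [hP, hQ], fun y hy => ?_⟩
    rw [map_mul] at hy
    exact ⟨hP' y (left_ne_zero_of_mul hy), hQ' y (right_ne_zero_of_mul hy)⟩
  | sUnion S _ h =>
    obtain ⟨U, hU, hxU⟩ := hx
    obtain ⟨P, hP, hP'⟩ := h U hU hxU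
    exact ⟨P, hP, fun y hy => ⟨U, hU, hP' y hy⟩⟩

theorem affine_isOpenZ_ne_zero (P : MvPolynomial ι ℂ) :
    (affine ι).IsOpenZ {x | MvPolynomial.eval x P ≠ 0} :=
  TopologicalSpace.GenerateOpen.basic _ ⟨P, rfl⟩

instance : IsGood (affine ι) where
  const c x := ⟨MvPolynomial.C c, 1, by simp, by simp⟩
  add := by
    rintro f g x ⟨P, Q, hQ, h⟩ ⟨P', Q', hQ', h'⟩
    refine ⟨P * Q' + P' * Q, Q * Q', by simp [hQ, hQ'], fun y hy => ?_⟩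
    rw [map_mul] at hy
    have h1 := left_ne_zero_of_mul hy
    have h2 := right_ne_zero_of_mul hy
    simp only [Pi.add_apply, h y h1, h' y h2, map_add, map_mul]
    field_simp
  mul := by
    rintro f g x ⟨P, Q, hQ, h⟩ ⟨P', Q', hQ', h'⟩
    refine ⟨P * P', Q * Q', by simp [hQ, hQ'], fun y hy => ?_⟩
    rw [map_mul] at hy
    simp only [Pi.mul_apply, h y (left_ne_zero_of_mul hy), h' y (right_ne_zero_of_mul hy), map_mul]
    rw [div_mul_div_comm]
  inv := by
    rintro f x ⟨P, Q, hQ, h⟩ hf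
    have hP : MvPolynomial.eval x P ≠ 0 := fun h0 => hf (by rw [h x hQ, h0, zero_div])
    refine ⟨Q * Q, P * Q, by simp [hQ, hP], fun y hy => ?_⟩
    rw [map_mul] at hy
    have h2 := right_ne_zero_of_mul hy
    simp only [Pi.inv_apply, h y h2, map_mul]
    rw [inv_div, mul_div_mul_right _ _ h2]
  ne_zero := by
    rintro f x ⟨P, Q, hQ, h⟩ hf
    have hP : MvPolynomial.eval x P ≠ 0 := fun h0 => hf (by rw [h x hQ, h0, zero_div])
    refine ⟨_, affine_isOpenZ_ne_zero (P * Q), by simp [hP, hQ], fun y hy => ?_⟩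
    simp only [Set.mem_ofPred_eq, map_mul] at hy
    rw [h y (right_ne_zero_of_mul hy)]
    exact div_ne_zero (left_ne_zero_of_mul hy) (right_ne_zero_of_mul hy)
  congr := by
    rintro f g x U ⟨P, Q, hQ, h⟩ hU hx hg
    obtain ⟨R, hR, hRU⟩ := affine_basis hU hx
    refine ⟨P * R, Q * R, by simp [hQ, hR], fun y hy => ?_⟩
    rw [map_mul] at hy
    have h2 := right_ne_zero_of_mul hy
    rw [hg y (hRU y h2), h y (left_ne_zero_of_mul hy), map_mul, map_mul, mul_div_mul_right _ _ h2]
  near := by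
    rintro f x ⟨P, Q, hQ, h⟩
    exact ⟨_, affine_isOpenZ_ne_zero Q, hQ, fun y hy => ⟨P, Q, hy, h⟩⟩

theorem affine_regularAt_coord (i : ι) (x : ι → ℂ) : (affine ι).RegularAt (fun y => y i) x :=
  ⟨MvPolynomial.X i, 1, by simp, by simp⟩

end Affine

/-! ### Induced structures -/

section Pull

variable {Z X : Type*} {π : Z → X} {s : SpaceWithFunctions X}

theorem pull_isOpenZ {U : Set X} (hU : s.IsOpenZ U) : (pull π s).IsOpenZ (π ⁻¹' U) :=
  ⟨U, hU, rfl⟩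

theorem pull_basis {V : Set Z} (hV : (pull π s).IsOpenZ V) : ∃ U, s.IsOpenZ U ∧ π ⁻¹' U = V := hV

instance [h : IsGood s] : IsGood (pull π s) where
  const c z := ⟨fun _ => c, h.const c _, _, isOpenZ_univ s, trivial, fun _ _ => rfl⟩
  add := by
    rintro f g x ⟨F, hF, U, hU, hx, hf⟩ ⟨G, hG, V, hV, hx', hg⟩
    exact ⟨F + G, h.add hF hG, U ∩ V, hU.inter hV, ⟨hx, hx'⟩, fun z hz => by
      simp [hf z hz.1, hg z hz.2]⟩
  mul := by
    rintro f g x ⟨F, hF, U, hU, hx, hf⟩ ⟨G, hG, V, hV, hx', hg⟩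
    exact ⟨F * G, h.mul hF hG, U ∩ V, hU.inter hV, ⟨hx, hx'⟩, fun z hz => by
      simp [hf z hz.1, hg z hz.2]⟩
  inv := by
    rintro f x ⟨F, hF, U, hU, hx, hf⟩ h0
    exact ⟨F⁻¹, h.inv hF (by rwa [← hf x hx]), U, hU, hx, fun z hz => by simp [hf z hz]⟩
  ne_zero := by
    rintro f x ⟨F, hF, U, hU, hx, hf⟩ h0
    obtain ⟨V, hV, hxV, hne⟩ := h.ne_zero hF (by rwa [← hf x hx])
    refine ⟨_, pull_isOpenZ (hU.inter hV), ⟨hx, hxV⟩, fun z hz => ?_⟩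
    rw [hf z hz.1]
    exact hne _ hz.2
  congr := by
    rintro f g x W ⟨F, hF, U, hU, hx, hf⟩ hW hxW hg
    obtain ⟨V, hV, rfl⟩ := pull_basis hW
    exact ⟨F, hF, U ∩ V, hU.inter hV, ⟨hx, hxW⟩, fun z hz => by rw [hg z hz.2, hf z hz.1]⟩
  near := by
    rintro f x ⟨F, hF, U, hU, hx, hf⟩
    obtain ⟨V, hV, hxV, hreg⟩ := h.near hF
    exact ⟨_, pull_isOpenZ (hU.inter hV), ⟨hx, hxV⟩, fun z hz =>
      ⟨F, hreg _ hz.2, U, hU, hz.1, hf⟩⟩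

end Pull

/-! ### Quotient structures -/

section Push

variable {Z X : Type*} {π : Z → X} {s : SpaceWithFunctions Z}

instance [h : IsGood s] : IsGood (push π s) where
  const c z := ⟨Set.univ, isOpenZ_univ s, trivial, fun _ _ => h.const c _⟩
  add := by
    rintro f g x ⟨U, hU, hx, hf⟩ ⟨V, hV, hx', hg⟩
    exact ⟨U ∩ V, IsOpenZ.inter hU hV, ⟨hx, hx'⟩, fun z hz => h.add (hf z hz.1) (hg z hz.2)⟩
  mul := by
    rintro f g x ⟨U, hU, hx, hf⟩ ⟨V, hV, hx', hg⟩
    exact ⟨U ∩ V, IsOpenZ.inter hU hV, ⟨hx, hx'⟩, fun z hz => h.mul (hf z hz.1) (hg z hz.2)⟩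
  inv := by
    rintro f x ⟨U, hU, hx, hf⟩ h0
    refine ⟨{y | y ∈ U ∧ f y ≠ 0}, ?_, ⟨hx, h0⟩, fun z hz => h.inv (hf z hz.1) hz.2⟩
    refine isOpenZ_iff.2 fun z hz => ?_
    obtain ⟨V, hV, hzV, hne⟩ := h.ne_zero (hf z hz.1) hz.2
    exact ⟨π ⁻¹' U ∩ V, hU.inter hV, ⟨hz.1, hzV⟩, fun y hy => ⟨hy.1, hne y hy.2⟩⟩
  ne_zero := by
    rintro f x ⟨U, hU, hx, hf⟩ h0
    refine ⟨{y | y ∈ U ∧ f y ≠ 0}, ?_, ⟨hx, h0⟩, fun z hz => hz.2⟩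
    refine (isOpenZ_iff (s := s)).2 fun z hz => ?_
    obtain ⟨V, hV, hzV, hne⟩ := h.ne_zero (hf z hz.1) hz.2
    exact ⟨π ⁻¹' U ∩ V, hU.inter hV, ⟨hz.1, hzV⟩, fun y hy => ⟨hy.1, hne y hy.2⟩⟩
  congr := by
    rintro f g x V ⟨U, hU, hx, hf⟩ hV hxV hg
    have hV' : s.IsOpenZ (π ⁻¹' V) := hV
    exact ⟨U ∩ V, IsOpenZ.inter hU hV', ⟨hx, hxV⟩, fun z hz =>
      h.congr (hf z hz.1) hV' hz.2 fun y hy => hg _ hy⟩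
  near := by
    rintro f x ⟨U, hU, hx, hf⟩
    exact ⟨U, hU, hx, fun y hy => ⟨U, hU, hy, hf⟩⟩

end Push

/-! ### Products -/

section Join

theorem joinFunctions_mono {Z κ : Type*} {s : κ → SpaceWithFunctions Z} {U V : κ → Set Z}
    (h : ∀ k, V k ⊆ U k) :
    joinFunctions s U ≤ joinFunctions s V :=
  Algebra.adjoin_mono fun _ ⟨k, hk⟩ => ⟨k, fun z hz => hk z (h k hz)⟩

variable {Z κ : Type*} [Finite κ] {s : κ → SpaceWithFunctions Z}

theorem join_isOpenZ {U : κ → Set Z} (hU : ∀ k, (s k).IsOpenZ (U k)) {q : Z → ℂ}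
    (hq : q ∈ joinFunctions s U) : (join s).IsOpenZ {z | (∀ k, z ∈ U k) ∧ q z ≠ 0} :=
  TopologicalSpace.GenerateOpen.basic _ ⟨U, hU, q, hq, rfl⟩

theorem join_basis {V : Set Z} (hV : (join s).IsOpenZ V) {z : Z} (hz : z ∈ V) :
    ∃ U : κ → Set Z, (∀ k, (s k).IsOpenZ (U k)) ∧ (∀ k, z ∈ U k) ∧
      ∃ q ∈ joinFunctions s U, q z ≠ 0 ∧ ∀ y, (∀ k, y ∈ U k) → q y ≠ 0 → y ∈ V := by
  induction hV with
  | basic V h =>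
    obtain ⟨U, hU, q, hq, rfl⟩ := h
    exact ⟨U, hU, hz.1, q, hq, hz.2, fun y h1 h2 => ⟨h1, h2⟩⟩
  | univ => exact ⟨fun _ => Set.univ, fun k => isOpenZ_univ _, fun _ => trivial, 1, one_mem _,
      one_ne_zero, fun _ _ _ => trivial⟩
  | inter V W _ _ h1 h2 =>
    obtain ⟨U, hU, hzU, q, hq, hqz, hV⟩ := h1 hz.1
    obtain ⟨U', hU', hzU', q', hq', hqz', hV'⟩ := h2 hz.2
    refine ⟨fun k => U k ∩ U' k, fun k => (hU k).inter (hU' k), fun k => ⟨hzU k, hzU' k⟩, q * q',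
      mul_mem (joinFunctions_mono (fun k => Set.inter_subset_left) hq)
        (joinFunctions_mono (fun k => Set.inter_subset_right) hq'),
      mul_ne_zero hqz hqz', fun y hy hqy => ⟨hV y (fun k => (hy k).1) (left_ne_zero_of_mul hqy),
        hV' y (fun k => (hy k).2) (right_ne_zero_of_mul hqy)⟩⟩
  | sUnion S _ h =>
    obtain ⟨V, hV, hzV⟩ := hz
    obtain ⟨U, hU, hzU, q, hq, hqz, hU'⟩ := h V hV hzV
    exact ⟨U, hU, hzU, q, hq, hqz, fun y h1 h2 => ⟨V, hV, hU' y h1 h2⟩⟩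

instance : IsGood (join s) where
  const c z := ⟨fun _ => Set.univ, fun k => isOpenZ_univ _, fun _ => trivial, fun _ => c,
    Subalgebra.algebraMap_mem _ c, 1, one_mem _, one_ne_zero, fun _ _ _ => by simp⟩
  add := by
    rintro f g x ⟨U, hU, hx, p, hp, q, hq, hqx, hf⟩ ⟨U', hU', hx', p', hp', q', hq', hqx', hg⟩
    have i1 := joinFunctions_mono (s := s) (U := U) (V := fun k => U k ∩ U' k)
      (fun k => Set.inter_subset_left)
    have i2 := joinFunctions_mono (s := s) (U := U') (V := fun k => U k ∩ U' k)
      (fun k => Set.inter_subset_right)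
    refine ⟨fun k => U k ∩ U' k, fun k => (hU k).inter (hU' k), fun k => ⟨hx k, hx' k⟩,
      p * q' + p' * q, add_mem (mul_mem (i1 hp) (i2 hq')) (mul_mem (i2 hp') (i1 hq)), q * q',
      mul_mem (i1 hq) (i2 hq'), mul_ne_zero hqx hqx', fun z hz hqz => ?_⟩
    have h1 : q z ≠ 0 := left_ne_zero_of_mul hqz
    have h2 : q' z ≠ 0 := right_ne_zero_of_mul hqz
    simp only [Pi.add_apply, hf z (fun k => (hz k).1) h1, hg z (fun k => (hz k).2) h2, Pi.mul_apply]
    field_simp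
  mul := by
    rintro f g x ⟨U, hU, hx, p, hp, q, hq, hqx, hf⟩ ⟨U', hU', hx', p', hp', q', hq', hqx', hg⟩
    have i1 := joinFunctions_mono (s := s) (U := U) (V := fun k => U k ∩ U' k)
      (fun k => Set.inter_subset_left)
    have i2 := joinFunctions_mono (s := s) (U := U') (V := fun k => U k ∩ U' k)
      (fun k => Set.inter_subset_right)
    refine ⟨fun k => U k ∩ U' k, fun k => (hU k).inter (hU' k), fun k => ⟨hx k, hx' k⟩,
      p * p', mul_mem (i1 hp) (i2 hp'), q * q',
      mul_mem (i1 hq) (i2 hq'), mul_ne_zero hqx hqx', fun z hz hqz => ?_⟩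
    have h1 : q z ≠ 0 := left_ne_zero_of_mul hqz
    have h2 : q' z ≠ 0 := right_ne_zero_of_mul hqz
    simp only [Pi.mul_apply, hf z (fun k => (hz k).1) h1, hg z (fun k => (hz k).2) h2]
    rw [div_mul_div_comm]
  inv := by
    rintro f x ⟨U, hU, hx, p, hp, q, hq, hqx, hf⟩ h0
    have hpx : p x ≠ 0 := fun h => h0 (by rw [hf x hx hqx, h, zero_div])
    refine ⟨U, hU, hx, q * q, mul_mem hq hq, p * q, mul_mem hp hq, mul_ne_zero hpx hqx,
      fun z hz hqz => ?_⟩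
    have h2 : q z ≠ 0 := right_ne_zero_of_mul hqz
    simp only [Pi.inv_apply, hf z hz h2, Pi.mul_apply]
    rw [inv_div, mul_div_mul_right _ _ h2]
  ne_zero := by
    rintro f x ⟨U, hU, hx, p, hp, q, hq, hqx, hf⟩ h0
    have hpx : p x ≠ 0 := fun h => h0 (by rw [hf x hx hqx, h, zero_div])
    refine ⟨_, join_isOpenZ hU (mul_mem hp hq), ⟨hx, mul_ne_zero hpx hqx⟩, fun z hz => ?_⟩
    have h1 : p z ≠ 0 := left_ne_zero_of_mul hz.2
    have h2 : q z ≠ 0 := right_ne_zero_of_mul hz.2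
    rw [hf z hz.1 h2]
    exact div_ne_zero h1 h2
  congr := by
    rintro f g x V ⟨U, hU, hx, p, hp, q, hq, hqx, hf⟩ hV hxV hg
    obtain ⟨U', hU', hx', q', hq', hqx', hV'⟩ := join_basis hV hxV
    have i1 := joinFunctions_mono (s := s) (U := U) (V := fun k => U k ∩ U' k)
      (fun k => Set.inter_subset_left)
    have i2 := joinFunctions_mono (s := s) (U := U') (V := fun k => U k ∩ U' k)
      (fun k => Set.inter_subset_right)
    refine ⟨fun k => U k ∩ U' k, fun k => (hU k).inter (hU' k), fun k => ⟨hx k, hx' k⟩,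
      p * q', mul_mem (i1 hp) (i2 hq'), q * q', mul_mem (i1 hq) (i2 hq'), mul_ne_zero hqx hqx',
      fun z hz hqz => ?_⟩
    have h1 : q z ≠ 0 := left_ne_zero_of_mul hqz
    have h2 : q' z ≠ 0 := right_ne_zero_of_mul hqz
    rw [hg z (hV' z (fun k => (hz k).2) h2), hf z (fun k => (hz k).1) h1, Pi.mul_apply, Pi.mul_apply,
      mul_div_mul_right _ _ h2]
  near := by
    rintro f x ⟨U, hU, hx, p, hp, q, hq, hqx, hf⟩
    exact ⟨_, join_isOpenZ hU hq, ⟨hx, hqx⟩, fun y hy => ⟨U, hU, hy.1, p, hp, q, hq, hy.2, hf⟩⟩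

end Join

instance {X : Type*} [s : SpaceWithFunctions X] [IsGood s] (p : X → Prop) :
    IsGood (subtype p) := inferInstanceAs (IsGood (pull Subtype.val s))

instance {X Y : Type*} [SpaceWithFunctions X] [SpaceWithFunctions Y] :
    IsGood (prod (X := X) (Y := Y)) :=
  inferInstanceAs (IsGood (join _))

instance {κ : Type*} [Finite κ] {X : κ → Type*} [s : ∀ k, SpaceWithFunctions (X k)] :
    IsGood (pi (X := X)) :=
  inferInstanceAs (IsGood (join _))

instance {X : Type*} [s : SpaceWithFunctions X] [IsGood s] (r : Setoid X) :
    IsGood (quotient r) := inferInstanceAs (IsGood (push (Quotient.mk r) s))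

instance (ι : Type*) : IsGood (projective ι) :=
  inferInstanceAs (IsGood (push (Projectivization.mk' ℂ) (subtype (X := ι → ℂ) (fun v => v ≠ 0))))

/-! ### Regular functions and morphisms -/

section Regular

variable {X : Type*} [s : SpaceWithFunctions X] [h : IsGood s]

variable (X) in
/-- The algebra of global regular functions. -/
def regularFunctions : Subalgebra ℂ (X → ℂ) where
  carrier := {f | ∀ x, s.RegularAt f x}
  mul_mem' hf hg x := h.mul (hf x) (hg x)
  add_mem' hf hg x := h.add (hf x) (hg x)
  algebraMap_mem' c x := h.const c x

variable (s) in
/-- The algebra of functions regular at a point. -/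
def regularFunctionsAt (x : X) : Subalgebra ℂ (X → ℂ) where
  carrier := {f | s.RegularAt f x}
  mul_mem' hf hg := h.mul hf hg
  add_mem' hf hg := h.add hf hg
  algebraMap_mem' c := h.const c x

theorem inv_mem_regularFunctions {f : X → ℂ} (hf : f ∈ regularFunctions X) (h0 : ∀ x, f x ≠ 0) :
    f⁻¹ ∈ regularFunctions X := fun x => h.inv (hf x) (h0 x)

theorem regularAt_div {f g : X → ℂ} {x : X} (hf : s.RegularAt f x) (hg : s.RegularAt g x)
    (h0 : g x ≠ 0) : s.RegularAt (f / g) x := by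
  rw [div_eq_mul_inv]
  exact h.mul hf (h.inv hg h0)

end Regular

/-- Regular functions at the image of a point pull back to regular functions at the point. -/
def RegMapAt {X Y : Type*} (s : SpaceWithFunctions X) (t : SpaceWithFunctions Y) (φ : X → Y)
    (x : X) : Prop := ∀ f : Y → ℂ, t.RegularAt f (φ x) → s.RegularAt (f ∘ φ) x

section RegMap

variable {X Y Z : Type*} {s : SpaceWithFunctions X} {t : SpaceWithFunctions Y}
  {u : SpaceWithFunctions Z}

theorem RegMapAt.comp {ψ : Y → Z} {φ : X → Y} {x : X} (hψ : RegMapAt t u ψ (φ x))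
    (hφ : RegMapAt s t φ x) : RegMapAt s u (ψ ∘ φ) x := fun f hf => hφ _ (hψ f hf)

theorem RegMapAt.congr [h : IsGood s] {φ ψ : X → Y} {x : X} {U : Set X} (hφ : RegMapAt s t φ x)
    (hU : s.IsOpenZ U) (hx : x ∈ U) (hψ : ∀ y ∈ U, ψ y = φ y) : RegMapAt s t ψ x := fun f hf =>
  h.congr (hφ f (by rwa [← hψ x hx])) hU hx fun y hy => congrArg f (hψ y hy)

/-- Continuity at a point. -/
theorem RegMapAt.preimage [hs : IsGood s] [ht : IsGood t] {φ : X → Y} {x : X}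
    (hφ : RegMapAt s t φ x) {V : Set Y} (hV : t.IsOpenZ V) (hx : φ x ∈ V) :
    ∃ U, s.IsOpenZ U ∧ x ∈ U ∧ ∀ y ∈ U, φ y ∈ V := by
  obtain ⟨U, hU, hxU, h⟩ := hs.ne_zero (hφ _ (regularAt_indicatorFn hV hx))
    (indicatorFn_ne_zero.2 hx)
  exact ⟨U, hU, hxU, fun y hy => indicatorFn_ne_zero.1 (h y hy)⟩

theorem isOpenZ_preimage [hs : IsGood s] [ht : IsGood t] {φ : X → Y}
    (hφ : ∀ x, RegMapAt s t φ x) {V : Set Y} (hV : t.IsOpenZ V) : s.IsOpenZ (φ ⁻¹' V) :=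
  isOpenZ_iff.2 fun x hx => (hφ x).preimage hV hx

/-- Continuity comes for free: the indicator of an open set pulls back to a regular function, whose
nonvanishing locus is a neighbourhood. -/
theorem isMorphism_iff [hs : IsGood s] [ht : IsGood t] {φ : X → Y} :
    IsMorphism φ ↔ ∀ x, RegMapAt s t φ x :=
  ⟨fun h x f hf => h.2 f x hf, fun h => ⟨by
    let := s.zariski
    let := t.zariski
    exact ⟨fun V hV => isOpenZ_preimage h hV⟩, fun f x hf => h x f hf⟩⟩

theorem regMapAt_pull_map {π : X → Y} (x : X) : RegMapAt (pull π t) t π x :=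
  fun f hf => ⟨f, hf, _, isOpenZ_univ t, trivial, fun _ _ => rfl⟩

theorem regMapAt_pull [hs : IsGood s] [ht : IsGood t] {π : Z → Y} {φ : X → Z} {x : X}
    (h : RegMapAt s t (π ∘ φ) x) : RegMapAt s (pull π t) φ x := by
  rintro f ⟨F, hF, U, hU, hx, hf⟩
  obtain ⟨V, hV, hxV, hVU⟩ := h.preimage hU hx
  exact hs.congr (h F hF) hV hxV fun y hy => hf _ (hVU y hy)

theorem regMapAt_push_map {π : X → Y} (x : X) : RegMapAt s (push π s) π x := by
  rintro f ⟨U, hU, hx, hf⟩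
  exact hf x hx

theorem regMapAt_push [hs : IsGood s] [hu : IsGood u] {π : X → Y} {φ : Y → Z}
    (h : ∀ x, RegMapAt s u (φ ∘ π) x) (y : Y) : RegMapAt (push π s) u φ y := by
  intro f hf
  -- Regularity at one point spreads to a neighbourhood V; its preimage in Y is the set, with open
  -- preimage upstairs, that the quotient structure asks for.
  obtain ⟨V, hV, hyV, hreg⟩ := hu.near hf
  exact ⟨φ ⁻¹' V, isOpenZ_preimage h hV, hyV, fun z hz => h z f (hreg _ hz)⟩

theorem regMapAt_join_map {κ : Type*} [Finite κ] {s : κ → SpaceWithFunctions Z}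
    [h : ∀ k, IsGood (s k)] (k : κ) (z : Z) : RegMapAt (join s) (s k) (fun y => y) z := by
  classical
  intro f hf
  obtain ⟨U, hU, hz, hreg⟩ := (h k).near hf
  -- This family of open sets is U at the index k and the whole space at every other index.
  refine ⟨fun l => {y | l = k → y ∈ U}, fun l => ?_, fun l _ => hz, f,
    Algebra.subset_adjoin ⟨k, fun y hy => hreg y (hy rfl)⟩, 1, one_mem _, one_ne_zero,
    fun y _ _ => by simp⟩
  by_cases hl : l = k
  · subst hl
    simpa using hU
  · simpa [hl] using isOpenZ_univ (s l)

theorem regMapAt_join [hs : IsGood s] {κ : Type*} [Finite κ] {t : κ → SpaceWithFunctions Y}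
    [ht : ∀ k, IsGood (t k)] {φ : X → Y} {x : X} (h : ∀ k, RegMapAt s (t k) φ x) :
    RegMapAt s (join t) φ x := by
  rintro f ⟨U, hU, hx, p, hp, q, hq, hqx, hf⟩
  have key : ∀ p ∈ joinFunctions t U, s.RegularAt (p ∘ φ) x := by
    intro p hp
    refine Algebra.adjoin_induction (p := fun p _ => s.RegularAt (p ∘ φ) x) ?_
      (fun c => hs.const c x) (fun _ _ _ _ h1 h2 => hs.add h1 h2)
      (fun _ _ _ _ h1 h2 => hs.mul h1 h2) hp
    rintro g ⟨k, hk⟩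
    exact h k g (hk _ (hx k))
  choose V hV hxV hVU using fun k => (h k).preimage (hU k) (hx k)
  obtain ⟨W, hW, hxW, hWq⟩ := hs.ne_zero (key q hq) hqx
  refine hs.congr (regularAt_div (key p hp) (key q hq) hqx) ((isOpenZ_iInter hV).inter hW)
    ⟨Set.mem_iInter.2 hxV, hxW⟩ fun y hy => ?_
  exact hf _ (fun k => hVU k y (Set.mem_iInter.1 hy.1 k)) (hWq y hy.2)

theorem regMapAt_affine [hs : IsGood s] {ι : Type*} {φ : X → ι → ℂ} {x : X}
    (h : ∀ i, s.RegularAt (fun y => φ y i) x) : RegMapAt s (affine ι) φ x := by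
  rintro f ⟨P, Q, hQ, hf⟩
  have key : ∀ P : MvPolynomial ι ℂ, s.RegularAt (fun y => MvPolynomial.eval (φ y) P) x := by
    intro P
    induction P using MvPolynomial.induction_on with
    | C c => simpa using hs.const c x
    | add P Q hP hQ =>
      simp only [map_add]
      exact hs.add hP hQ
    | mul_X P i hP =>
      simp only [map_mul, MvPolynomial.eval_X]
      exact hs.mul hP (h i)
  obtain ⟨W, hW, hxW, hWq⟩ := hs.ne_zero (key Q) hQ
  exact hs.congr (regularAt_div (key P) (key Q) hQ) hW hxW fun y hy => hf _ (hWq y hy)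

end RegMap

section Products

theorem regMapAt_subtype_val {X : Type*} [s : SpaceWithFunctions X] {p : X → Prop}
    (x : {x // p x}) :
    RegMapAt (subtype p) s Subtype.val x := regMapAt_pull_map x

theorem regMapAt_subtype {X Y : Type*} {s : SpaceWithFunctions X} [t : SpaceWithFunctions Y]
    [IsGood s] [IsGood t] {p : Y → Prop} {φ : X → {y // p y}} {x : X}
    (h : RegMapAt s t (fun y => (φ y).1) x) : RegMapAt s (subtype p) φ x :=
  regMapAt_pull (s := s) (π := Subtype.val) h

variable {X Y Z : Type*} {u : SpaceWithFunctions Z} [s : SpaceWithFunctions X]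
  [t : SpaceWithFunctions Y] [IsGood s] [IsGood t] [IsGood u]

instance (b : Bool) : IsGood
    (if b then pull (Prod.fst : X × Y → X) s else pull (Prod.snd : X × Y → Y) t) := by
  cases b
  · exact inferInstanceAs (IsGood (pull Prod.snd t))
  · exact inferInstanceAs (IsGood (pull Prod.fst s))

theorem regMapAt_fst (z : X × Y) : RegMapAt prod s Prod.fst z :=
  RegMapAt.comp (φ := fun y => y) (regMapAt_pull_map (t := s) z)
    (regMapAt_join_map (s := fun b : Bool => if b then pull (Prod.fst : X × Y → X) s
      else pull (Prod.snd : X × Y → Y) t) true z)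

theorem regMapAt_snd (z : X × Y) : RegMapAt prod t Prod.snd z :=
  RegMapAt.comp (φ := fun y => y) (regMapAt_pull_map (t := t) z)
    (regMapAt_join_map (s := fun b : Bool => if b then pull (Prod.fst : X × Y → X) s
      else pull (Prod.snd : X × Y → Y) t) false z)

theorem regMapAt_prod {φ : Z → X × Y} {z : Z} (h1 : RegMapAt u s (fun z => (φ z).1) z)
    (h2 : RegMapAt u t (fun z => (φ z).2) z) : RegMapAt u prod φ z := by
  refine regMapAt_join fun b => ?_
  cases b
  · exact regMapAt_pull (t := t) (π := Prod.snd) h2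
  · exact regMapAt_pull (t := s) (π := Prod.fst) h1

variable {κ : Type*} [Finite κ] {A : κ → Type*} [a : ∀ k, SpaceWithFunctions (A k)]
  [∀ k, IsGood (a k)]

theorem regMapAt_eval (k : κ) (z : ∀ k, A k) : RegMapAt pi (a k) (fun z => z k) z :=
  RegMapAt.comp (φ := fun y => y) (regMapAt_pull_map (t := a k) z)
    (regMapAt_join_map (s := fun k => pull (fun z : ∀ k, A k => z k) (a k)) k z)

theorem regMapAt_pi {φ : Z → ∀ k, A k} {z : Z} (h : ∀ k, RegMapAt u (a k) (fun z => φ z k) z) :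
    RegMapAt u pi φ z :=
  regMapAt_join fun k => regMapAt_pull (t := a k) (π := fun z : ∀ k, A k => z k) (h k)

end Products

/-! ### Descent of regularity along surjections -/

/-- A function is regular at a point if its pullback is regular at all points above it. -/
def Descends {Z X : Type*} [s : SpaceWithFunctions Z] [t : SpaceWithFunctions X] (π : Z → X) :
    Prop := ∀ (f : X → ℂ) (x : X), (∀ z, π z = x → s.RegularAt (f ∘ π) z) → t.RegularAt f x

section Descent

variable {X Y Z : Type*} [s : SpaceWithFunctions X] [t : SpaceWithFunctions Y]
  [u : SpaceWithFunctions Z]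

theorem Descends.comp {p : Y → X} {q : Z → Y} (hp : Descends p) (hq : Descends q) :
    Descends (p ∘ q) := fun f _ h => hp f _ fun y hy => hq (f ∘ p) y fun z hz =>
  h z (by rw [Function.comp_apply, hz, hy])

/-- The criterion behind all the isomorphisms that involve quotients. Pulled back along p ∘ q, the
function f ∘ p⁻¹ becomes f ∘ q, which is regular; descent along p ∘ q then makes f ∘ p⁻¹ regular. -/
theorem isIsomorphism_of_descends [IsGood s] [IsGood t] {p : Y ≃ X} {q : Z → Y}
    (hp : ∀ y, RegMapAt t s p y) (hq : ∀ z, RegMapAt u t q z) (h : Descends (p ∘ q)) :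
    IsIsomorphism p := by
  refine ⟨isMorphism_iff.2 hp, isMorphism_iff.2 fun _ f hf => h _ _ fun z hz => ?_⟩
  have e : (f ∘ p.symm) ∘ (p ∘ q) = f ∘ q := by
    funext z
    simp
  rw [e]
  refine hq z f ?_
  rwa [← hz, Function.comp_apply, Equiv.symm_apply_apply] at hf

theorem IsIsomorphism.symm {φ : X ≃ Y} (h : IsIsomorphism φ) : IsIsomorphism φ.symm := ⟨h.2, h.1⟩

theorem IsMorphism.comp {ψ : Y → Z} {φ : X → Y} (hψ : IsMorphism ψ) (hφ : IsMorphism φ) :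
    IsMorphism (ψ ∘ φ) :=
  ⟨@Continuous.comp _ _ _ s.zariski t.zariski u.zariski _ _ hψ.1 hφ.1,
    fun f _ hf => hφ.2 _ _ (hψ.2 f _ hf)⟩

theorem IsIsomorphism.trans {φ : X ≃ Y} {ψ : Y ≃ Z} (h : IsIsomorphism φ) (h' : IsIsomorphism ψ) :
    IsIsomorphism (φ.trans ψ) := ⟨h'.1.comp h.1, h.2.comp h'.2⟩

end Descent

/-! ### Quasi-affine structures -/

section Coordinates

variable {Z κ : Type*} (e : κ → Z → ℂ)

/-- The structure of a subvariety of affine space given by coordinate functions. -/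
@[reducible] def coordinates : SpaceWithFunctions Z := pull (fun z k => e k z) (affine κ)

variable {e}

theorem coordinates_regular (k : κ) (z : Z) : (coordinates e).RegularAt (e k) z :=
  regMapAt_pull_map (t := affine κ) (π := fun z k => e k z) z _ (affine_regularAt_coord k _)

theorem regMapAt_coordinates {X : Type*} {s : SpaceWithFunctions X} [IsGood s] {φ : X → Z} {x : X}
    (h : ∀ k, s.RegularAt (fun y => e k (φ y)) x) : RegMapAt s (coordinates e) φ x :=
  regMapAt_pull (t := affine κ) (regMapAt_affine h)

/-- A local fraction becomes a globally valid identity f q = p after multiplying both sides by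
polynomials that vanish outside the domain of the local expression. Global validity is what permits
averaging over a group that moves points out of the neighbourhood. -/
theorem coordinates_regularAt {f : Z → ℂ} {z : Z} (h : (coordinates e).RegularAt f z) :
    ∃ p ∈ Algebra.adjoin ℂ (Set.range e), ∃ q ∈ Algebra.adjoin ℂ (Set.range e),
      q z ≠ 0 ∧ f * q = p := by
  obtain ⟨F, ⟨P, Q, hQ, hF⟩, U, hU, hz, hf⟩ := h
  obtain ⟨R, hR, hRU⟩ := affine_basis hU hz
  have hev : ∀ P : MvPolynomial κ ℂ, (fun z => MvPolynomial.eval (fun k => e k z) P) ∈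
      Algebra.adjoin ℂ (Set.range e) := by
    intro P
    induction P using MvPolynomial.induction_on with
    | C c =>
      simp only [MvPolynomial.eval_C]
      exact Subalgebra.algebraMap_mem (Algebra.adjoin ℂ (Set.range e)) c
    | add P Q hP hQ =>
      simp only [map_add]
      exact add_mem hP hQ
    | mul_X P i hP =>
      simp only [map_mul, MvPolynomial.eval_X]
      exact mul_mem hP (Algebra.subset_adjoin ⟨i, rfl⟩)
  refine ⟨_, hev (P * Q * R * R), _, hev (Q * Q * R * R), by simp [hQ, hR], ?_⟩
  funext w
  simp only [Pi.mul_apply, map_mul]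
  by_cases hRw : MvPolynomial.eval (fun k => e k w) R = 0
  · simp [hRw]
  by_cases hQw : MvPolynomial.eval (fun k => e k w) Q = 0
  · simp [hQw]
  rw [hf w (hRU _ hRw), hF _ hQw]
  field_simp

end Coordinates

/-! ### Averaging over finite groups -/

/-- If all power sums `∑ q_g^j`, `j ≥ 1`, vanish, then all `q_g` vanish. -/
theorem exists_sum_pow_ne_zero {G : Type*} [Fintype G] (q : G → ℂ) (g₀ : G) (h : q g₀ ≠ 0) :
    ∃ j, ∑ g, q g ^ (j + 1) ≠ 0 := by
  classical
  by_contra! hsum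
  have key : ∀ p : Polynomial ℂ, ∑ g, q g * p.eval (q g) = 0 := by
    intro p
    induction p using Polynomial.induction_on' with
    | add p r hp hr => simp [mul_add, Finset.sum_add_distrib, hp, hr]
    | monomial j c =>
      have := hsum j
      simp only [Polynomial.eval_monomial]
      rw [← mul_zero c, ← this, Finset.mul_sum]
      exact Finset.sum_congr rfl fun g _ => by ring
  -- The test polynomial vanishes at all values of q other than q g₀, so the sum counts the fibre
  -- over this value, with a nonzero weight b. In characteristic zero the count is nonzero.
  have h1 := key (∏ s ∈ (Finset.univ.image q).erase (q g₀), (Polynomial.X - Polynomial.C s))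
  simp only [Polynomial.eval_prod, Polynomial.eval_sub, Polynomial.eval_X, Polynomial.eval_C] at h1
  set b := q g₀ * ∏ s ∈ (Finset.univ.image q).erase (q g₀), (q g₀ - s) with hb
  have hb0 : b ≠ 0 := by
    refine mul_ne_zero h (Finset.prod_ne_zero_iff.2 fun s hs => ?_)
    exact sub_ne_zero.2 (Finset.ne_of_mem_erase hs).symm
  have h2 : ∀ g, q g * ∏ s ∈ (Finset.univ.image q).erase (q g₀), (q g - s) =
      if q g = q g₀ then b else 0 := by
    intro g
    split_ifs with hg
    · rw [hg]
    · rw [Finset.prod_eq_zero (i := q g)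
        (Finset.mem_erase.2 ⟨hg, Finset.mem_image_of_mem _ (Finset.mem_univ _)⟩) (sub_self _),
        mul_zero]
  simp only [h2, Finset.sum_ite, Finset.sum_const_zero, add_zero, Finset.sum_const,
    nsmul_eq_mul] at h1
  rcases mul_eq_zero.1 h1 with h3 | h3
  · rw [Nat.cast_eq_zero, Finset.card_eq_zero] at h3
    exact Finset.notMem_empty g₀ (h3 ▸ Finset.mem_filter.2 ⟨Finset.mem_univ _, rfl⟩)
  · exact hb0 h3

/-- A function whose pullback is a fraction is regular, if averages of the powers of the
denominator, and of their products with the numerator, come from regular functions. -/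
theorem regularAt_of_averages {Z X G : Type*} [s : SpaceWithFunctions X] [hs : IsGood s]
    [Fintype G] {π : Z → X} (act : G → Z → Z) (hact : ∀ g z, π (act g z) = π z) {f : X → ℂ}
    {P Q : Z → ℂ} (hf : ∀ z, f (π z) * Q z = P z) (hπ : Function.Surjective π) {z : Z} (g₀ : G)
    (hz : Q (act g₀ z) ≠ 0)
    (hQ : ∀ j : ℕ, ∃ h ∈ regularFunctions X, ∀ z, ∑ g, Q (act g z) ^ (j + 1) = h (π z))
    (hP : ∀ j : ℕ, ∃ h ∈ regularFunctions X,
      ∀ z, ∑ g, P (act g z) * Q (act g z) ^ j = h (π z)) :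
    s.RegularAt f (π z) := by
  -- The plain average of Q may vanish at z. With a suitable j, f is written as (∑ P Q^j) / (∑
  -- Q^(j+1)) along orbits, with nonvanishing denominator.
  obtain ⟨j, hj⟩ := exists_sum_pow_ne_zero (fun g => Q (act g z)) g₀ hz
  obtain ⟨h, hh, e⟩ := hQ j
  obtain ⟨k, hk, e'⟩ := hP j
  rw [e] at hj
  obtain ⟨U, hU, hxU, hne⟩ := hs.ne_zero (hh _) hj
  refine hs.congr (regularAt_div (hk _) (hh _) hj) hU hxU fun y hy => ?_
  obtain ⟨w, rfl⟩ := hπ y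
  rw [Pi.div_apply, eq_div_iff (hne _ hy), ← e, ← e', Finset.mul_sum]
  refine Finset.sum_congr rfl fun g _ => ?_
  rw [← hf, hact]
  ring

end SpaceWithFunctions

end

end QuadricTwist

/-! ### Regularity on the families: local representatives, cones, and covers by square roots. -/

namespace QuadricTwist

noncomputable section

open SpaceWithFunctions

/-! ### Regularity on the spaces at hand -/

section GoodSpaces

variable {N : ℕ} {ι : Type} [MulAction (W N) ι]

instance : IsGood (instSpaceWithFunctionsArs N) :=
  inferInstanceAs (IsGood (subtype (X := Fin N → ℂ) _))

instance (F : LinFamily N ι) : IsGood (instSpaceWithFunctionsVectorBundle F) :=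
  inferInstanceAs (IsGood (subtype (X := Ars N × (ι → ℂ)) _))

instance (F : LinFamily N ι) : IsGood (instSpaceWithFunctionsSqFamily F) :=
  inferInstanceAs (IsGood (subtype (X := Ars N × ℙ ℂ (ι → ℂ)) _))

instance (F : LinFamily N ι) (n : ℕ) : IsGood (instSpaceWithFunctionsFibrePower F n) :=
  inferInstanceAs (IsGood (subtype (X := Ars N × (Fin n → SqFamily F)) _))

instance (F : LinFamily N ι) (n : ℕ) : IsGood (instSpaceWithFunctionsPowerQuot F n) :=
  inferInstanceAs (IsGood (quotient (powerSetoid F n)))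

instance : IsGood (instSpaceWithFunctionsRootCover N) :=
  inferInstanceAs (IsGood (subtype (X := Ars N × (Fin N → ℂ)) _))

instance : IsGood (instSpaceWithFunctionsATilde N) :=
  inferInstanceAs (IsGood (quotient (rootSetoid N)))

instance (F : LinFamily N ι) (n : ℕ) : IsGood (instSpaceWithFunctionsFibreProduct F n) :=
  inferInstanceAs (IsGood (subtype (X := PowerQuot F n × ATilde N) _))

instance (F : LinFamily N ι) (n : ℕ) (κ : IHom N ι) :
    IsGood (instSpaceWithFunctionsTwist F n κ) :=
  inferInstanceAs (IsGood (quotient (twistSetoid F n κ)))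

end GoodSpaces

section Maps

variable {N : ℕ} {ι : Type} [MulAction (W N) ι] {X : Type*} {s : SpaceWithFunctions X} [IsGood s]

theorem regularAt_ars (i : Fin N) (a : Ars N) :
    (instSpaceWithFunctionsArs N).RegularAt (fun a => a.1 i) a :=
  regMapAt_subtype_val (X := Fin N → ℂ) a _ (affine_regularAt_coord i _)

theorem regMapAt_ars {φ : X → Ars N} {x : X} (h : ∀ i, s.RegularAt (fun y => (φ y).1 i) x) :
    RegMapAt s (instSpaceWithFunctionsArs N) φ x :=
  regMapAt_subtype (Y := Fin N → ℂ) (regMapAt_affine h)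

/-- The homogeneous coordinates of a ratio `p_i / p_j` are regular where `p_j ≠ 0`. -/
theorem regularAt_ratio (i j : ι) {p : ℙ ℂ (ι → ℂ)} (hp : p.rep j ≠ 0) :
    (projective ι).RegularAt (fun p => p.rep i / p.rep j) p := by
  have hrep : ∀ v : {v : ι → ℂ // v ≠ 0}, ∃ c : ℂ, c ≠ 0 ∧
      ∀ i, (Projectivization.mk' ℂ v).rep i = c * v.1 i := by
    intro v
    obtain ⟨c, hc⟩ := Projectivization.exists_smul_eq_mk_rep ℂ v.1 v.2
    exact ⟨c, c.ne_zero, fun i => (congrFun hc i).symm⟩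
  have hopen : (subtype (X := ι → ℂ) (fun v => v ≠ 0)).IsOpenZ
      {v : {v : ι → ℂ // v ≠ 0} | v.1 j ≠ 0} := by
    refine ⟨_, affine_isOpenZ_ne_zero (MvPolynomial.X j), ?_⟩
    ext v
    simp
  have hpre : Projectivization.mk' ℂ ⁻¹' {p : ℙ ℂ (ι → ℂ) | p.rep j ≠ 0} =
      {v : {v : ι → ℂ // v ≠ 0} | v.1 j ≠ 0} := by
    ext v
    obtain ⟨c, hc, h⟩ := hrep v
    change (Projectivization.mk' ℂ v).rep j ≠ 0 ↔ v.1 j ≠ 0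
    rw [h]
    simp [hc]
  refine ⟨{p | p.rep j ≠ 0}, ?_, hp, fun v hv => ?_⟩
  · rw [hpre]
    exact hopen
  · replace hv : v ∈ {v : {v : ι → ℂ // v ≠ 0} | v.1 j ≠ 0} := hpre ▸ hv
    have hdiv := regularAt_div (s := subtype (X := ι → ℂ) (fun v => v ≠ 0)) (x := v)
      (f := fun v => v.1 i) (g := fun v => v.1 j)
      (regMapAt_subtype_val (X := ι → ℂ) v _ (affine_regularAt_coord i _))
      (regMapAt_subtype_val (X := ι → ℂ) v _ (affine_regularAt_coord j _)) hv
    refine IsGood.congr hdiv hopen hv fun w _ => ?_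
    obtain ⟨c, hc, h⟩ := hrep w
    simp only [Function.comp_apply, Pi.div_apply, h]
    rw [mul_div_mul_left _ _ hc]

theorem regMapAt_projective {φ : X → ℙ ℂ (ι → ℂ)} {v : X → ι → ℂ} {x : X}
    (hv : ∀ o, s.RegularAt (fun y => v y o) x) (hx : v x ≠ 0)
    (h : ∀ y (hy : v y ≠ 0), φ y = Projectivization.mk ℂ (v y) hy) :
    RegMapAt s (projective ι) φ x := by
  classical
  obtain ⟨o, ho⟩ := Function.ne_iff.1 hx
  obtain ⟨U, hU, hxU, hne⟩ := IsGood.ne_zero (hv o) ho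
  have hne' : ∀ y ∈ U, v y ≠ 0 := fun y hy => Function.ne_iff.2 ⟨o, hne y hy⟩
  let ψ : X → {v : ι → ℂ // v ≠ 0} := fun y => if hy : v y ≠ 0 then ⟨v y, hy⟩ else ⟨v x, hx⟩
  have hψ : RegMapAt s (subtype (X := ι → ℂ) (fun v => v ≠ 0)) ψ x := by
    refine regMapAt_subtype (Y := ι → ℂ) ?_
    refine RegMapAt.congr (regMapAt_affine hv) hU hxU fun y hy => ?_
    simp only [ψ, dif_pos (hne' y hy)]
  refine RegMapAt.congr (RegMapAt.comp (u := projective ι) (regMapAt_push_map (ψ x)) hψ)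
    hU hxU fun y hy => ?_
  simp only [ψ, Function.comp_apply, dif_pos (hne' y hy)]
  exact h y _

theorem regMapAt_sqFamily {F : LinFamily N ι} {φ : X → SqFamily F} {v : X → ι → ℂ} {x : X}
    (ha : ∀ i, s.RegularAt (fun y => (φ y).1.1.1 i) x)
    (hv : ∀ o, s.RegularAt (fun y => v y o) x) (hx : v x ≠ 0)
    (h : ∀ y (hy : v y ≠ 0), (φ y).1.2 = Projectivization.mk ℂ (v y) hy) :
    RegMapAt s (instSpaceWithFunctionsSqFamily F) φ x :=
  regMapAt_subtype (Y := Ars N × ℙ ℂ (ι → ℂ))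
    (regMapAt_prod (regMapAt_ars ha) (regMapAt_projective hv hx h))

variable (F : LinFamily N ι)

theorem regMapAt_sqFamily_base (x : SqFamily F) : RegMapAt (instSpaceWithFunctionsSqFamily F)
    (instSpaceWithFunctionsArs N) SqFamily.base x :=
  RegMapAt.comp (regMapAt_fst _) (regMapAt_subtype_val (X := Ars N × ℙ ℂ (ι → ℂ)) x)

theorem regularAt_sqFamily_ratio (i j : ι) {x : SqFamily F} (hx : x.1.2.rep j ≠ 0) :
    (instSpaceWithFunctionsSqFamily F).RegularAt (fun x => x.1.2.rep i / x.1.2.rep j) x :=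
  RegMapAt.comp (regMapAt_snd _) (regMapAt_subtype_val (X := Ars N × ℙ ℂ (ι → ℂ)) x) _
    (regularAt_ratio i j hx)

end Maps

/-! ### Affine cones -/

section Cone

variable {N : ℕ} {ι : Type} [MulAction (W N) ι] {F : LinFamily N ι}

/-- The punctured affine cones over the fibres of a family. -/
def Cone (F : LinFamily N ι) : Type :=
  {p : Ars N × (ι → ℂ) // p.2 ≠ 0 ∧ sq p.2 ∈ F.E p.1}

/-- The coordinates `a_i`, `v_o`. -/
def Cone.coord (F : LinFamily N ι) : Fin N ⊕ ι → Cone F → ℂ :=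
  Sum.elim (fun i z => z.1.1.1 i) (fun o z => z.1.2 o)

instance (F : LinFamily N ι) : SpaceWithFunctions (Cone F) := coordinates (Cone.coord F)

instance (F : LinFamily N ι) : IsGood (instSpaceWithFunctionsCone F) :=
  inferInstanceAs (IsGood (coordinates _))

theorem Cone.coord_mem (k : Fin N ⊕ ι) : Cone.coord F k ∈ regularFunctions (Cone F) :=
  fun z => coordinates_regular k z

/-- The point of projective space below a point of the cone. -/
def Cone.proj (z : Cone F) : SqFamily F :=
  ⟨(z.1.1, Projectivization.mk ℂ z.1.2 z.2.1), (sq_rep_mem_iff _ _ _).2 z.2.2⟩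

theorem Cone.proj_eq_iff {z z' : Cone F} :
    z.proj = z'.proj ↔ z.1.1 = z'.1.1 ∧ ∃ c : ℂ, c ≠ 0 ∧ ∀ o, z'.1.2 o = c * z.1.2 o := by
  refine Subtype.ext_iff.trans (Prod.ext_iff.trans (and_congr Iff.rfl (eq_comm.trans
    ((Projectivization.mk_eq_mk_iff ℂ _ _ z'.2.1 z.2.1).trans ?_))))
  exact ⟨fun ⟨c, hc⟩ => ⟨c, c.ne_zero, fun o => (congrFun hc o).symm⟩,
    fun ⟨c, hc, h⟩ => ⟨Units.mk0 c hc, (funext h).symm⟩⟩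

/-- The chosen representative of a point. -/
def SqFamily.rep (x : SqFamily F) : Cone F := ⟨(x.1.1, x.1.2.rep), x.1.2.rep_nonzero, x.2⟩

theorem SqFamily.proj_rep (x : SqFamily F) : x.rep.proj = x :=
  Subtype.ext (Prod.ext rfl x.1.2.mk_rep)

theorem Cone.exists_rep_proj (z : Cone F) :
    ∃ c : ℂ, c ≠ 0 ∧ ∀ o, z.proj.1.2.rep o = c * z.1.2 o :=
  (Cone.proj_eq_iff.1 z.proj.proj_rep.symm).2

theorem Cone.proj_surjective : Function.Surjective (Cone.proj (F := F)) :=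
  fun x => ⟨_, x.proj_rep⟩

theorem Cone.regMapAt_proj (z : Cone F) :
    RegMapAt (instSpaceWithFunctionsCone F) (instSpaceWithFunctionsSqFamily F) Cone.proj z :=
  regMapAt_sqFamily (v := fun z : Cone F => z.1.2) (fun i => Cone.coord_mem (Sum.inl i) z)
    (fun o => Cone.coord_mem (Sum.inr o) z) z.2.1 fun _ _ => rfl

theorem SqFamily.rep_div_mem (x : SqFamily F) {o : ι} (ho : x.1.2.rep o ≠ 0) :
    (fun i => x.1.2.rep i / x.1.2.rep o) ≠ 0 ∧
      sq (fun i => x.1.2.rep i / x.1.2.rep o) ∈ F.E x.1.1 := by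
  refine ⟨Function.ne_iff.2 ⟨o, by simp [ho]⟩, ?_⟩
  have : sq (fun i => x.1.2.rep i / x.1.2.rep o) = ((x.1.2.rep o)⁻¹ ^ 2) • sq x.1.2.rep := by
    funext i
    simp only [sq, Pi.smul_apply, smul_eq_mul]
    ring
  rw [this]
  exact Submodule.smul_mem _ _ x.2

open Classical in
/-- The representative with one coordinate normalized to one, where possible. -/
def SqFamily.normalize (o : ι) (x : SqFamily F) : Cone F :=
  if ho : x.1.2.rep o ≠ 0 then
    ⟨(x.1.1, fun i => x.1.2.rep i / x.1.2.rep o), x.rep_div_mem ho⟩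
  else x.rep

theorem SqFamily.normalize_of_ne {o : ι} {x : SqFamily F} (ho : x.1.2.rep o ≠ 0) :
    x.normalize o = ⟨(x.1.1, fun i => x.1.2.rep i / x.1.2.rep o), x.rep_div_mem ho⟩ :=
  dif_pos ho

theorem SqFamily.proj_normalize (o : ι) (x : SqFamily F) : (x.normalize o).proj = x := by
  by_cases ho : x.1.2.rep o ≠ 0
  · rw [SqFamily.normalize_of_ne ho]
    conv_rhs => rw [← x.proj_rep]
    refine Cone.proj_eq_iff.2 ⟨rfl, _, ho, fun i => ?_⟩
    simp only [SqFamily.rep]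
    field_simp
  · exact (congrArg Cone.proj (dif_neg ho)).trans x.proj_rep

theorem SqFamily.isOpenZ_rep_ne_zero (o : ι) :
    (instSpaceWithFunctionsSqFamily F).IsOpenZ {x : SqFamily F | x.1.2.rep o ≠ 0} := by
  refine isOpenZ_iff.2 fun x hx => ?_
  obtain ⟨U, hU, hxU, h⟩ := IsGood.ne_zero (regularAt_sqFamily_ratio F o o hx) (by simpa using hx)
  exact ⟨U, hU, hxU, fun y hy h0 => h y hy (by rw [h0, div_zero])⟩

theorem SqFamily.regMapAt_normalize {o : ι} {x : SqFamily F} (ho : x.1.2.rep o ≠ 0) :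
    RegMapAt (instSpaceWithFunctionsSqFamily F) (instSpaceWithFunctionsCone F)
      (SqFamily.normalize o) x := by
  refine regMapAt_coordinates fun k => ?_
  rcases k with i | i
  · refine IsGood.congr (regMapAt_sqFamily_base F x _ (regularAt_ars i x.base))
      (SqFamily.isOpenZ_rep_ne_zero o) ho fun y hy => ?_
    rw [SqFamily.normalize_of_ne hy]
    rfl
  · refine IsGood.congr (regularAt_sqFamily_ratio F i o ho)
      (SqFamily.isOpenZ_rep_ne_zero o) ho fun y hy => ?_
    rw [SqFamily.normalize_of_ne hy]
    rfl

/-- Normalizing a nonvanishing homogeneous coordinate to one is a section of the cone that is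
regular near x; pulling f ∘ proj back along it returns f. -/
theorem Cone.descends_proj : Descends (Cone.proj (F := F)) := by
  intro f x h
  obtain ⟨o, ho⟩ := Function.ne_iff.1 x.1.2.rep_nonzero
  have := SqFamily.regMapAt_normalize ho _ (h _ (x.proj_normalize o))
  rwa [Function.comp_assoc, show Cone.proj ∘ SqFamily.normalize o = id from
    funext (SqFamily.proj_normalize o)] at this

/-- A map that is given by homogeneous expressions on cones can be checked to be regular at
normalized representatives. -/
theorem regMapAt_of_cone {X : Type*} {t : SpaceWithFunctions X} {φ : SqFamily F → X}
    {x : SqFamily F} (h : ∀ z : Cone F, z.proj = x →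
      RegMapAt (instSpaceWithFunctionsCone F) t (φ ∘ Cone.proj) z) :
    RegMapAt (instSpaceWithFunctionsSqFamily F) t φ x := fun f hf =>
  Cone.descends_proj _ _ fun z hz => h z hz f (by rwa [Function.comp_apply, hz])

end Cone

/-! ### Adjoining square roots -/

section SquareRoots

variable {B κ J : Type}

/-- The cover of `B` obtained by adjoining square roots of functions `h_j`. -/
def SqrtCover (h : J → B → ℂ) : Type := {p : B × (J → ℂ) // ∀ j, p.2 j ^ 2 = h j p.1}

variable {h : J → B → ℂ}

/-- The coordinates of the base, and the square roots. -/
def SqrtCover.coord (e : κ → B → ℂ) (h : J → B → ℂ) : κ ⊕ J → SqrtCover h → ℂ :=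
  Sum.elim (fun k z => e k z.1.1) (fun j z => z.1.2 j)

/-- Sign changes of the square roots. -/
def SqrtCover.signs (ζ : J → ℤˣ) (z : SqrtCover h) : SqrtCover h :=
  ⟨(z.1.1, signL ζ z.1.2), fun j => (congrFun (sq_signL ζ z.1.2) j).trans (z.2 j)⟩

/-- By linearity it suffices to treat a function of the base times a monomial in the square roots.
Its sum over all sign changes factors over j: an odd exponent gives 0, and an exponent 2l gives 2
h_j^l, which lives on the base. -/
theorem SqrtCover.exists_sum_signs [Fintype J] [DecidableEq J] {e : κ → B → ℂ}
    (hh : ∀ j, h j ∈ @regularFunctions B (coordinates e) _) {P : SqrtCover h → ℂ}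
    (hP : P ∈ Algebra.adjoin ℂ (Set.range (SqrtCover.coord e h))) :
    ∃ g ∈ @regularFunctions B (coordinates e) _, ∀ z, ∑ ζ, P (SqrtCover.signs ζ z) = g z.1.1 := by
  classical
  let : SpaceWithFunctions B := coordinates e
  have mono : ∀ P ∈ Submonoid.closure (Set.range (SqrtCover.coord e h)),
      ∃ A ∈ regularFunctions B, ∃ k : J → ℕ,
        ∀ z : SqrtCover h, P z = A z.1.1 * ∏ j, z.1.2 j ^ k j := by
    intro P hP
    induction hP using Submonoid.closure_induction with
    | mem P hP =>
      obtain ⟨k | j, rfl⟩ := hP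
      · exact ⟨e k, fun z => coordinates_regular k z, 0, fun z => by simp [SqrtCover.coord]⟩
      · refine ⟨1, one_mem _, Pi.single j 1, fun z => ?_⟩
        rw [Finset.prod_eq_single j (fun l _ hl => by simp [hl]) (by simp)]
        simp [SqrtCover.coord]
    | one => exact ⟨1, one_mem _, 0, by simp⟩
    | mul P Q _ _ h1 h2 =>
      obtain ⟨A, hA, k, hk⟩ := h1
      obtain ⟨A', hA', k', hk'⟩ := h2
      refine ⟨A * A', mul_mem hA hA', k + k', fun z => ?_⟩
      simp only [Pi.mul_apply, hk, hk', Pi.add_apply, pow_add, Finset.prod_mul_distrib]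
      ring
  have hspan : P ∈ Submodule.span ℂ
      (Submonoid.closure (Set.range (SqrtCover.coord e h)) : Set (SqrtCover h → ℂ)) := by
    rw [← Algebra.adjoin_eq_span]
    exact hP
  clear hP
  induction hspan using Submodule.span_induction with
  | mem P hP =>
    obtain ⟨A, hA, k, hk⟩ := mono P hP
    refine ⟨A * ∏ j, (if Even (k j) then (2 : ℂ) • h j ^ (k j / 2) else 0), mul_mem hA
      (prod_mem fun j _ => ?_), fun z => ?_⟩
    · split_ifs
      · exact Subalgebra.smul_mem _ (pow_mem (hh j) _) _
      · exact zero_mem _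
    · simp only [hk, Pi.mul_apply, Finset.prod_apply]
      change ∑ ζ : J → ℤˣ, A z.1.1 * ∏ j, (((ζ j : ℤ) : ℂ) * z.1.2 j) ^ k j = _
      rw [← Finset.mul_sum, ← Fintype.piFinset_univ,
        ← Finset.prod_univ_sum (fun _ => Finset.univ)
          (fun j (ε : ℤˣ) => (((ε : ℤ) : ℂ) * z.1.2 j) ^ k j)]
      congr 1
      refine Finset.prod_congr rfl fun j _ => ?_
      rw [show (Finset.univ : Finset ℤˣ) = {1, -1} from rfl, Finset.sum_pair (by decide)]
      split_ifs with hkj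
      · obtain ⟨l, hl⟩ := hkj
        rw [hl, ← two_mul, Nat.mul_div_cancel_left _ two_pos]
        simp only [Units.val_one, Int.cast_one, one_mul, Units.val_neg, Int.cast_neg, neg_mul,
          pow_mul, neg_sq, Pi.smul_apply, Pi.pow_apply, smul_eq_mul, z.2 j]
        ring
      · rw [Nat.not_even_iff_odd] at hkj
        simp [hkj.neg_pow]
  | zero => exact ⟨0, zero_mem _, by simp⟩
  | add P Q _ _ h1 h2 =>
    obtain ⟨g, hg, e1⟩ := h1
    obtain ⟨g', hg', e2⟩ := h2
    exact ⟨g + g', add_mem hg hg', fun z => by simp [Finset.sum_add_distrib, e1, e2]⟩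
  | smul c P _ h1 =>
    obtain ⟨g, hg, e1⟩ := h1
    exact ⟨c • g, Subalgebra.smul_mem _ hg c, fun z => by simp [← Finset.mul_sum, e1]⟩

theorem SqrtCover.surjective (h : J → B → ℂ) (b : B) : ∃ z : SqrtCover h, z.1.1 = b := by
  choose c hc using fun j => IsAlgClosed.exists_pow_nat_eq (h j b) two_pos
  exact ⟨⟨(b, c), hc⟩, rfl⟩

/-- Averaging over the sign group, applied to numerator and denominator of the pulled back function.
Vanishing of some h_j (ramification) is allowed. -/
theorem SqrtCover.descends [Fintype J] [DecidableEq J] {e : κ → B → ℂ}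
    (hh : ∀ j, h j ∈ @regularFunctions B (coordinates e) _) :
    @Descends (SqrtCover h) B (coordinates (SqrtCover.coord e h)) (coordinates e)
      (fun z => z.1.1) := by
  let : SpaceWithFunctions B := coordinates e
  intro f b hf
  obtain ⟨z, rfl⟩ := SqrtCover.surjective h b
  obtain ⟨P, hP, Q, hQ, hQz, hPQ⟩ := coordinates_regularAt (hf z rfl)
  refine regularAt_of_averages (G := J → ℤˣ) (π := fun z : SqrtCover h => z.1.1)
    SqrtCover.signs (fun _ _ => rfl) (fun z => congrFun hPQ z) (SqrtCover.surjective h) 1 ?_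
    (fun j => SqrtCover.exists_sum_signs hh (pow_mem hQ (j + 1)))
    (fun j => SqrtCover.exists_sum_signs hh (mul_mem hP (pow_mem hQ j)))
  have : SqrtCover.signs 1 z = z := Subtype.ext (Prod.ext rfl (funext fun i => by
    simp [SqrtCover.signs, signL]))
  rwa [this]

end SquareRoots

end

end QuadricTwist

/-! ### Factorization of binary forms, polarization, and interpolation at the a_i. -/

namespace QuadricTwist

noncomputable section

open SpaceWithFunctions

/-! ### Binary forms -/

section BinaryForms

open Polynomial

/-- The value at `(τ, υ)` of the homogenization of degree `n` of a polynomial. -/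
def formEval (n : ℕ) (p : ℂ[X]) (τ υ : ℂ) : ℂ :=
  ∑ j ∈ Finset.range (n + 1), p.coeff j * (τ ^ j * υ ^ (n - j))

theorem formEval_linear_mul {n : ℕ} {p : ℂ[X]} (hp : p.natDegree ≤ n) (t u τ υ : ℂ) :
    formEval (n + 1) ((C u * Polynomial.X - C t) * p) τ υ = (u * τ - t * υ) * formEval n p τ υ := by
  have h1 : ∑ j ∈ Finset.range (n + 1 + 1),
      (Polynomial.X * p).coeff j * (τ ^ j * υ ^ (n + 1 - j)) =
      τ * formEval n p τ υ := by
    rw [Finset.sum_range_succ', formEval, Finset.mul_sum]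
    simp only [coeff_X_mul, mul_coeff_zero, coeff_X_zero, zero_mul, add_zero]
    refine Finset.sum_congr rfl fun j _ => ?_
    rw [Nat.add_sub_add_right]
    ring
  have h2 : ∑ j ∈ Finset.range (n + 1 + 1), p.coeff j * (τ ^ j * υ ^ (n + 1 - j)) =
      υ * formEval n p τ υ := by
    rw [Finset.sum_range_succ, formEval, coeff_eq_zero_of_natDegree_lt (by omega), zero_mul,
      add_zero, Finset.mul_sum]
    refine Finset.sum_congr rfl fun j hj => ?_
    rw [Nat.succ_sub (Nat.lt_succ_iff.1 (Finset.mem_range.1 hj)), pow_succ]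
    ring
  have h3 : ∀ j, ((C u * Polynomial.X - C t) * p).coeff j =
      u * (Polynomial.X * p).coeff j - t * p.coeff j := by
    intro j
    rw [sub_mul, mul_assoc, coeff_sub, coeff_C_mul, coeff_C_mul]
  rw [formEval]
  simp only [h3]
  simp only [sub_mul, Finset.sum_sub_distrib, mul_assoc, ← Finset.mul_sum, h1, h2]

theorem natDegree_linear_le (t u : ℂ) : (C u * Polynomial.X - C t).natDegree ≤ 1 := by
  rw [sub_eq_add_neg, ← C_neg]
  exact Polynomial.natDegree_linear_le

theorem natDegree_prod_linear_le {n : ℕ} (t u : Fin n → ℂ) :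
    (∏ k, (C (u k) * Polynomial.X - C (t k))).natDegree ≤ n := by
  refine (natDegree_prod_le _ _).trans ?_
  refine (Finset.sum_le_card_nsmul _ _ 1 fun k _ => natDegree_linear_le _ _).trans ?_
  simp

theorem formEval_prod {n : ℕ} (t u : Fin n → ℂ) (τ υ : ℂ) :
    formEval n (∏ k, (C (u k) * Polynomial.X - C (t k))) τ υ = ∏ k, (u k * τ - t k * υ) := by
  induction n with
  | zero => simp [formEval]
  | succ n ih =>
    rw [Fin.prod_univ_succ, formEval_linear_mul (natDegree_prod_linear_le _ _),
      ih (fun k => t k.succ) (fun k => u k.succ), Fin.prod_univ_succ]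

theorem formEval_C_mul (n : ℕ) (c : ℂ) (p : ℂ[X]) (τ υ : ℂ) :
    formEval n (C c * p) τ υ = c * formEval n p τ υ := by
  simp [formEval, Finset.mul_sum, mul_assoc]

/-- A binary form is a product of linear forms. -/
theorem exists_linear_factors {n : ℕ} {p : ℂ[X]} (hp : p.natDegree ≤ n) :
    ∃ (c : ℂ) (t u : Fin n → ℂ), (∀ k, t k ≠ 0 ∨ u k ≠ 0) ∧
      p = C c * ∏ k, (C (u k) * Polynomial.X - C (t k)) := by
  induction n generalizing p with
  | zero =>
    exact ⟨p.coeff 0, Fin.elim0, Fin.elim0, fun k => k.elim0, by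
      simpa using eq_C_of_natDegree_le_zero hp⟩
  | succ n ih =>
    have key : ∀ (q : ℂ[X]) (t₀ u₀ : ℂ), q.natDegree ≤ n → (t₀ ≠ 0 ∨ u₀ ≠ 0) →
        p = (C u₀ * Polynomial.X - C t₀) * q → ∃ (c : ℂ) (t u : Fin (n + 1) → ℂ),
          (∀ k, t k ≠ 0 ∨ u k ≠ 0) ∧ p = C c * ∏ k, (C (u k) * Polynomial.X - C (t k)) := by
      intro q t₀ u₀ hq h0 hpq
      obtain ⟨c, t, u, hne, e⟩ := ih hq
      refine ⟨c, Fin.cons t₀ t, Fin.cons u₀ u, fun k => ?_, ?_⟩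
      · refine Fin.cases ?_ (fun k => ?_) k
        · simpa using h0
        · simpa using hne k
      · rw [Fin.prod_univ_succ, hpq, e]
        simp only [Fin.cons_zero, Fin.cons_succ]
        ring
    by_cases hd : p.natDegree ≤ n
    -- A vanishing top coefficient is a root at infinity. The corresponding linear factor, with (t,
    -- u) = (-1, 0), is the constant 1.
    · exact key p (-1) 0 hd (by simp) (by simp)
    · obtain ⟨r, hr⟩ := IsAlgClosed.exists_root p (by
        intro h0
        have : p.natDegree = 0 := natDegree_eq_of_degree_eq_some h0
        omega)
      obtain ⟨q, rfl⟩ := dvd_iff_isRoot.2 hr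
      refine key q r 1 ?_ (by simp) (by simp)
      have hq : q ≠ 0 := by
        rintro rfl
        simp at hd
      rw [natDegree_mul (X_sub_C_ne_zero r) hq, natDegree_X_sub_C] at hp
      omega

theorem linear_ne_zero {t u : ℂ} (h : t ≠ 0 ∨ u ≠ 0) : C u * Polynomial.X - C t ≠ 0 := by
  intro h0
  have h1 := congrArg (fun p => p.coeff 1) h0
  have h2 := congrArg (fun p => p.coeff 0) h0
  simp only [coeff_sub, coeff_C_mul, coeff_X_one, mul_one, coeff_C_succ, sub_zero,
    coeff_zero] at h1
  simp only [coeff_sub, mul_coeff_zero, coeff_X_zero, mul_zero, coeff_C_zero, zero_sub,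
    coeff_zero, neg_eq_zero] at h2
  tauto

open Classical in
/-- The point of `ℙ¹ = ℂ ∪ {∞}` with homogeneous coordinates `[t : u]`. -/
def linePoint (t u : ℂ) : Option ℂ := if u = 0 then none else some (t / u)

theorem linePoint_eq {t u t' u' : ℂ} (h : t ≠ 0 ∨ u ≠ 0) (h' : t' ≠ 0 ∨ u' ≠ 0)
    (e : linePoint t' u' = linePoint t u) : ∃ c : ℂ, c ≠ 0 ∧ t' = c * t ∧ u' = c * u := by
  unfold linePoint at e
  by_cases hu : u = 0 <;> by_cases hu' : u' = 0
  · simp only [hu, hu', ne_eq, not_true_eq_false, or_false] at h h'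
    exact ⟨t' / t, div_ne_zero h' h, by field_simp, by simp [hu, hu']⟩
  · simp [hu, hu'] at e
  · simp [hu, hu'] at e
  · simp only [hu, hu', if_false, Option.some.injEq] at e
    refine ⟨u' / u, div_ne_zero hu' hu, ?_, by field_simp⟩
    field_simp at e ⊢
    linear_combination e

theorem roots_linear (t u : ℂ) : (C u * Polynomial.X - C t).roots = if u = 0 then 0 else {t / u} := by
  split_ifs with hu
  · rw [hu, C_0, zero_mul, zero_sub, ← C_neg, roots_C]
  · rw [sub_eq_add_neg, ← C_neg, roots_C_mul_X_add_C _ hu]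
    congr 1
    field_simp

theorem natDegree_linear_eq (t u : ℂ) :
    (C u * Polynomial.X - C t).natDegree = if linePoint t u = none then 0 else 1 := by
  rw [sub_eq_add_neg, ← C_neg]
  by_cases hu : u = 0
  · simp [hu, linePoint]
  · rw [natDegree_linear hu]
    simp [hu, linePoint]

theorem card_linePoint_some {n : ℕ} {t u : Fin n → ℂ} (h : ∀ k, t k ≠ 0 ∨ u k ≠ 0) (r : ℂ) :
    Fintype.card {k // linePoint (t k) (u k) = some r} =
      (∏ k, (C (u k) * Polynomial.X - C (t k))).roots.count r := by
  classical
  rw [roots_prod _ _ (Finset.prod_ne_zero_iff.2 fun k _ => linear_ne_zero (h k)),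
    Multiset.count_bind, Fintype.card_subtype, Finset.card_filter]
  refine congrArg Multiset.sum (Multiset.map_congr rfl fun k _ => ?_)
  rw [roots_linear, linePoint]
  by_cases hu : u k = 0
  · simp [hu]
  · simp [hu, Multiset.count_singleton, eq_comm]

/-- Factors at infinity are constants, so their number is the defect of the degree from n. -/
theorem card_linePoint_none {n : ℕ} {t u : Fin n → ℂ} (h : ∀ k, t k ≠ 0 ∨ u k ≠ 0) :
    Fintype.card {k // linePoint (t k) (u k) = none} +
      (∏ k, (C (u k) * Polynomial.X - C (t k))).natDegree = n := by
  classical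
  rw [natDegree_prod _ _ (fun k _ => linear_ne_zero (h k)), Fintype.card_subtype,
    Finset.card_filter, ← Finset.sum_add_distrib]
  simp only [natDegree_linear_eq]
  calc _ = ∑ _k : Fin n, 1 := Finset.sum_congr rfl fun k _ => by split_ifs <;> rfl
    _ = n := by simp

/-- Uniqueness of the factorization of a binary form. -/
theorem exists_perm_of_prod_linear_eq {n : ℕ} {t u t' u' : Fin n → ℂ}
    (h : ∀ k, t k ≠ 0 ∨ u k ≠ 0) (h' : ∀ k, t' k ≠ 0 ∨ u' k ≠ 0) {c : ℂ} (hc : c ≠ 0)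
    (e : ∏ k, (C (u' k) * Polynomial.X - C (t' k)) = C c * ∏ k, (C (u k) * Polynomial.X - C (t k))) :
    ∃ σ : Equiv.Perm (Fin n), ∀ k, ∃ c : ℂ, c ≠ 0 ∧ t' k = c * t (σ k) ∧ u' k = c * u (σ k) := by
  classical
  -- Both tuples hit each point of ℙ¹ equally often: finite points are counted by root multiplicity,
  -- infinity by the degree defect. Equal fibre cardinalities yield the matching permutation.
  have hcard : ∀ p : Option ℂ, Fintype.card {k // linePoint (t' k) (u' k) = p} =
      Fintype.card {k // linePoint (t k) (u k) = p} := by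
    rintro (_ | r)
    · have h1 := card_linePoint_none h
      have h2 := card_linePoint_none h'
      rw [e, natDegree_C_mul hc] at h2
      omega
    · rw [card_linePoint_some h, card_linePoint_some h', e, roots_C_mul _ hc]
  refine ⟨Equiv.ofFiberEquiv (f := fun k => linePoint (t' k) (u' k))
    (g := fun k => linePoint (t k) (u k)) fun p => Fintype.equivOfCardEq (hcard p), fun k => ?_⟩
  refine linePoint_eq (h _) (h' k) ?_
  exact (Equiv.ofFiberEquiv_map (f := fun k => linePoint (t' k) (u' k))
    (g := fun k => linePoint (t k) (u k)) _ k).symm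

end BinaryForms

/-! ### Polarization -/

section Polarization

theorem sum_eq_zero_of_mul_right {G : Type*} [Group G] [Fintype G] {f : G → ℂ} (g₀ : G)
    (h : ∀ g, f (g * g₀) = -f g) : ∑ g, f g = 0 := by
  have hs := Equiv.sum_comp (Equiv.mulRight g₀) f
  simp only [Equiv.coe_mulRight, h, Finset.sum_neg_distrib] at hs
  exact self_eq_neg.1 hs.symm

/-- A sign-averaged form of polarization, expressing a permanent by products of linear
combinations of the rows. -/
theorem two_pow_mul_sum_perm {n : ℕ} (m : Fin n → Fin n → ℂ) :
    2 ^ n * ∑ σ : Equiv.Perm (Fin n), ∏ k, m (σ k) k =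
      ∑ ε : Fin n → ℤˣ, (∏ k, ((ε k : ℤ) : ℂ)) * ∏ j, ∑ k, ((ε k : ℤ) : ℂ) * m k j := by
  classical
  have h1 : ∀ ε : Fin n → ℤˣ, ∏ j, ∑ k, ((ε k : ℤ) : ℂ) * m k j =
      ∑ φ : Fin n → Fin n, (∏ j, ((ε (φ j) : ℤ) : ℂ)) * ∏ j, m (φ j) j := by
    intro ε
    rw [Finset.prod_univ_sum, Fintype.piFinset_univ]
    exact Finset.sum_congr rfl fun φ _ => Finset.prod_mul_distrib
  simp only [h1, Finset.mul_sum]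
  rw [Finset.sum_comm]
  -- After expanding the product over maps φ, the sum over signs keeps exactly the bijections. For a
  -- φ missing an index k₀, flipping the sign at k₀ changes only the factor ∏ ε_k and negates the
  -- term.
  have h2 : ∀ φ : Fin n → Fin n,
      ∑ ε : Fin n → ℤˣ, (∏ k, ((ε k : ℤ) : ℂ)) * ((∏ j, ((ε (φ j) : ℤ) : ℂ)) * ∏ j, m (φ j) j) =
        if Function.Bijective φ then 2 ^ n * ∏ j, m (φ j) j else 0 := by
    intro φ
    split_ifs with hφ
    · have : ∀ ε : Fin n → ℤˣ, (∏ k, ((ε k : ℤ) : ℂ)) *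
          ((∏ j, ((ε (φ j) : ℤ) : ℂ)) * ∏ j, m (φ j) j) = ∏ j, m (φ j) j := by
        intro ε
        rw [hφ.prod_comp (fun k => ((ε k : ℤ) : ℂ)), ← mul_assoc, ← Finset.prod_mul_distrib]
        simp only [sign_mul_self, Finset.prod_const_one, one_mul]
      simp [this]
    · rw [← Finite.surjective_iff_bijective] at hφ
      obtain ⟨k₀, hk₀⟩ := not_forall.1 hφ
      rw [not_exists] at hk₀
      have hinv : ∀ ε : Fin n → ℤˣ,
          (∏ k, (((ε * Pi.mulSingle k₀ (-1) : Fin n → ℤˣ) k : ℤ) : ℂ)) *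
            ((∏ j, (((ε * Pi.mulSingle k₀ (-1) : Fin n → ℤˣ) (φ j) : ℤ) : ℂ)) * ∏ j, m (φ j) j) =
          -((∏ k, ((ε k : ℤ) : ℂ)) * ((∏ j, ((ε (φ j) : ℤ) : ℂ)) * ∏ j, m (φ j) j)) := by
        intro ε
        have e1 : ∏ k, (((ε * Pi.mulSingle k₀ (-1) : Fin n → ℤˣ) k : ℤ) : ℂ) =
            -∏ k, ((ε k : ℤ) : ℂ) := by
          simp only [Pi.mul_apply, Units.val_mul, Int.cast_mul, Finset.prod_mul_distrib]
          rw [Finset.prod_eq_single k₀ (f := fun k =>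
            (((Pi.mulSingle k₀ (-1) : Fin n → ℤˣ) k : ℤ) : ℂ))
            (fun k _ hk => by simp [Pi.mulSingle_eq_of_ne hk]) (by simp)]
          simp
        have e2 : ∀ j, (((ε * Pi.mulSingle k₀ (-1) : Fin n → ℤˣ) (φ j) : ℤ) : ℂ) =
            ((ε (φ j) : ℤ) : ℂ) := by
          intro j
          simp [Pi.mulSingle_eq_of_ne (hk₀ j)]
        simp only [e1, e2, neg_mul]
      exact sum_eq_zero_of_mul_right (Pi.mulSingle k₀ (-1)) hinv
  rw [Finset.sum_congr rfl fun φ _ => h2 φ, ← Finset.sum_filter]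
  refine Finset.sum_bij (fun (σ : Equiv.Perm (Fin n)) _ => (σ : Fin n → Fin n))
    (fun σ _ => Finset.mem_filter.2 ⟨Finset.mem_univ _, σ.bijective⟩)
    (fun σ _ τ _ h => Equiv.coe_fn_injective h)
    (fun φ hφ => ⟨Equiv.ofBijective φ (Finset.mem_filter.1 hφ).2, Finset.mem_univ _, rfl⟩)
    (fun σ _ => rfl)

end Polarization

/-! ### Hyperplane configurations and Lagrange interpolation -/

section Configurations

open Polynomial

variable {N n : ℕ}

/-- The homogeneous coordinates `(τ, υ)` of the points `a_i` and `∞` of `ℙ¹`. -/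
def node (a : Ars N) (o : Option (Fin N)) : ℂ × ℂ := o.elim (1, 0) (fun i => (a.1 i, 1))

/-- The polynomial with given coefficients. -/
def coeffPoly (x : Fin (n + 1) → ℂ) : ℂ[X] := ∑ j : Fin (n + 1), C (x j) * Polynomial.X ^ (j : ℕ)

theorem coeff_coeffPoly (x : Fin (n + 1) → ℂ) (j : Fin (n + 1)) :
    (coeffPoly x).coeff j = x j := by
  simp only [coeffPoly, finsetSum_coeff, coeff_C_mul, coeff_X_pow]
  rw [Finset.sum_eq_single j (fun k _ hk => by simp [Fin.val_ne_of_ne hk.symm]) (by simp)]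
  simp

theorem natDegree_coeffPoly_le (x : Fin (n + 1) → ℂ) : (coeffPoly x).natDegree ≤ n := by
  refine natDegree_sum_le_of_forall_le _ _ fun j _ => ?_
  exact (natDegree_C_mul_X_pow_le _ _).trans (Nat.lt_succ_iff.1 j.2)

theorem coeffPoly_coeff {p : ℂ[X]} (hp : p.natDegree ≤ n) :
    coeffPoly (fun j : Fin (n + 1) => p.coeff j) = p := by
  ext j
  by_cases hj : j < n + 1
  · exact coeff_coeffPoly (fun j : Fin (n + 1) => p.coeff j) ⟨j, hj⟩
  · have := natDegree_coeffPoly_le (fun j : Fin (n + 1) => p.coeff j)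
    exact (coeff_eq_zero_of_natDegree_lt (by omega)).trans
      (coeff_eq_zero_of_natDegree_lt (by omega)).symm

theorem coeffPoly_symCoords (t u : Fin n → ℂ) :
    coeffPoly (symCoords t u) = ∏ k, (C (u k) * Polynomial.X - C (t k)) :=
  coeffPoly_coeff (natDegree_prod_linear_le t u)

theorem coeffPoly_smul (c : ℂ) (x : Fin (n + 1) → ℂ) :
    coeffPoly (c • x) = C c * coeffPoly x := by
  simp [coeffPoly, Finset.mul_sum, mul_assoc]

theorem H_some (a : Ars N) (i : Fin N) (x : Fin (n + 1) → ℂ) :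
    H a (some i) x = (coeffPoly x).eval (a.1 i) := by
  simp only [H, Option.elim, coeffPoly, eval_finsetSum, eval_mul, eval_C, eval_pow, eval_X]
  exact Finset.sum_congr rfl fun _ _ => mul_comm _ _

theorem H_none (a : Ars N) (x : Fin (n + 1) → ℂ) : H a none x = (coeffPoly x).coeff n :=
  (coeff_coeffPoly x (Fin.last n)).symm

theorem H_eq_formEval (a : Ars N) (o : Option (Fin N)) (x : Fin (n + 1) → ℂ) :
    H a o x = formEval n (coeffPoly x) (node a o).1 (node a o).2 := by
  cases o with
  | some i =>
    rw [H_some, formEval, eval_eq_sum_range' (Nat.lt_succ_of_le (natDegree_coeffPoly_le x))]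
    simp [node]
  | none =>
    rw [H_none, formEval, Finset.sum_range_succ, Finset.sum_eq_zero]
    · simp [node]
    · intro j hj
      have : n - j ≠ 0 := by
        have := Finset.mem_range.1 hj
        omega
      simp [node, this]

theorem H_symCoords (a : Ars N) (o : Option (Fin N)) (t u : Fin n → ℂ) :
    H a o (symCoords t u) = ∏ k, (u k * (node a o).1 - t k * (node a o).2) := by
  rw [H_eq_formEval, coeffPoly_symCoords, formEval_prod]

theorem H_smul (a : Ars N) (o : Option (Fin N)) (c : ℂ) (x : Fin (n + 1) → ℂ) :
    H a o (c • x) = c * H a o x := by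
  rw [H_eq_formEval, coeffPoly_smul, formEval_C_mul, H_eq_formEval]

/-- A point of `ℙ^n` is determined by the values of the forms `H_{a,i}`. -/
theorem coeffPoly_eq_interpolate (hn : n < N) (a : Ars N) {x : Fin (n + 1) → ℂ} :
    coeffPoly x = Lagrange.interpolate Finset.univ a.1 (fun i => H a (some i) x) := by
  simp only [H_some]
  refine Lagrange.eq_interpolate a.2.1.injOn ?_
  rw [Finset.card_univ, Fintype.card_fin]
  exact (degree_le_of_natDegree_le (natDegree_coeffPoly_le x)).trans_lt (by exact_mod_cast hn)

theorem eq_of_H_eq (hn : n < N) (a : Ars N) {x y : Fin (n + 1) → ℂ}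
    (h : ∀ i, H a (some i) x = H a (some i) y) : x = y := by
  have e : coeffPoly x = coeffPoly y := by
    rw [coeffPoly_eq_interpolate hn a, coeffPoly_eq_interpolate hn a]
    simp only [h]
  funext j
  rw [← coeff_coeffPoly x, ← coeff_coeffPoly y, e]

theorem d_ne_zero (a : Ars N) (i : Fin N) : d a i ≠ 0 :=
  Finset.prod_ne_zero_iff.2 fun _ hj => sub_ne_zero.2 fun h =>
    Finset.ne_of_mem_erase hj (a.2.1 h)

/-- The Lagrange formula for the coefficient of T^(N-1) has the denominators ∏(a_j - a_k), whereas
d_j is the product of the opposite differences. There are N - 1 of these, an even number. -/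
theorem sum_eval_div_d (hN : Odd N) (a : Ars N) {p : ℂ[X]} (hp : p.natDegree < N) :
    ∑ j, (d a j)⁻¹ * p.eval (a.1 j) = p.coeff (N - 1) := by
  have h := Lagrange.coeff_eq_sum (s := Finset.univ) (v := a.1) a.2.1.injOn (P := p) (by
    rw [Finset.card_univ, Fintype.card_fin]
    exact (degree_le_natDegree).trans_lt (by exact_mod_cast hp))
  rw [Finset.card_univ, Fintype.card_fin] at h
  rw [h]
  refine Finset.sum_congr rfl fun j _ => ?_
  rw [d, div_eq_inv_mul]
  congr 2
  rw [Finset.prod_congr rfl fun k _ => (neg_sub (a.1 j) (a.1 k)).symm, Finset.prod_neg,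
    Finset.card_erase_of_mem (Finset.mem_univ _), Finset.card_univ, Fintype.card_fin,
    (Nat.Odd.sub_odd hN odd_one).neg_one_pow, one_mul]

theorem sum_pow_mul_eval_div_d (hN : Odd N) (a : Ars N) {p : ℂ[X]} {i : ℕ}
    (hp : p.natDegree + i < N) :
    ∑ j, a.1 j ^ i * (d a j)⁻¹ * p.eval (a.1 j) = p.coeff (N - 1 - i) := by
  have h1 : (p * Polynomial.X ^ i).natDegree < N := by
    refine lt_of_le_of_lt natDegree_mul_le ?_
    rwa [natDegree_X_pow]
  have h := sum_eval_div_d hN a h1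
  rw [coeff_mul_X_pow', if_pos (by omega)] at h
  rw [← h]
  refine Finset.sum_congr rfl fun j _ => ?_
  simp only [eval_mul, eval_pow, eval_X]
  ring

/-- Once deg p ≤ N - 1 - i is known, the i-th sum equals the coefficient of T^(N-1-i), and its
vanishing lowers the bound by one. After m steps the bound is N - 1 - m = n. -/
theorem natDegree_le_of_sums {m : ℕ} (hN : Odd N) (a : Ars N) (hmn : N = m + n + 1) {p : ℂ[X]}
    (hp : p.natDegree < N) (h : ∀ i < m, ∑ j, a.1 j ^ i * (d a j)⁻¹ * p.eval (a.1 j) = 0) :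
    p.natDegree ≤ n := by
  have key : ∀ i ≤ m, p.natDegree + i < N := by
    intro i hi
    induction i with
    | zero => simpa using hp
    | succ i ih =>
      have h1 := ih (by omega)
      have h2 := sum_pow_mul_eval_div_d hN a h1
      rw [h i (by omega)] at h2
      by_contra hcon
      have h3 : p.natDegree = N - 1 - i := by omega
      rw [← h3, coeff_natDegree, eq_comm, leadingCoeff_eq_zero] at h2
      rw [h2, natDegree_zero] at h3
      omega
  have := key m le_rfl
  omega

theorem exists_H_of_sums {m : ℕ} (hN : Odd N) (a : Ars N) (hmn : N = m + n + 1) {q : Fin N → ℂ}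
    (h : ∀ i < m, ∑ j, a.1 j ^ i * (d a j)⁻¹ * q j = 0) :
    ∃ x : Fin (n + 1) → ℂ, ∀ i, q i = H a (some i) x := by
  have hev : ∀ i, (Lagrange.interpolate Finset.univ a.1 q).eval (a.1 i) = q i := fun i =>
    Lagrange.eval_interpolate_at_node q a.2.1.injOn (Finset.mem_univ i)
  have hdeg : (Lagrange.interpolate Finset.univ a.1 q).natDegree < N := by
    have h1 := Lagrange.degree_interpolate_lt (s := Finset.univ) (v := a.1) q a.2.1.injOn
    rw [Finset.card_univ, Fintype.card_fin] at h1
    by_cases h0 : Lagrange.interpolate Finset.univ a.1 q = 0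
    · rw [h0, natDegree_zero]
      omega
    · exact (natDegree_lt_iff_degree_lt h0).2 h1
  refine ⟨fun j => (Lagrange.interpolate Finset.univ a.1 q).coeff j, fun i => ?_⟩
  rw [H_some, coeffPoly_coeff (natDegree_le_of_sums hN a hmn hdeg fun i hi => ?_), hev]
  simpa only [hev] using h i hi

theorem sum_H {m : ℕ} (hN : Odd N) (a : Ars N) (hmn : N = m + n + 1) (x : Fin (n + 1) → ℂ) :
    (∀ i < m, ∑ j, a.1 j ^ i * (d a j)⁻¹ * H a (some j) x = 0) ∧
      ∑ j, a.1 j ^ m * (d a j)⁻¹ * H a (some j) x = H a none x := by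
  have hdeg := natDegree_coeffPoly_le x
  simp only [H_some]
  refine ⟨fun i hi => ?_, ?_⟩
  · rw [sum_pow_mul_eval_div_d hN a (by omega)]
    exact coeff_eq_zero_of_natDegree_lt (by omega)
  · rw [sum_pow_mul_eval_div_d hN a (by omega), H_none]
    congr 1
    omega

theorem mem_quadFamily_iff {m : ℕ} (hN : Odd N) (hmn : N = m + n + 1) (a : Ars N)
    (q : Fin N → ℂ) :
    q ∈ (quadFamily (N := N) (fun a j => (d a j)⁻¹) d_inv_smul m).E a ↔
      ∃ x : Fin (n + 1) → ℂ, ∀ i, q i = H a (some i) x := by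
  refine ⟨fun h => exists_H_of_sums hN a hmn h, ?_⟩
  rintro ⟨x, hx⟩ i hi
  simp only [hx]
  exact (sum_H hN a hmn x).1 i hi

theorem mem_VTilde'_iff {m : ℕ} (hN : Odd N) (hmn : N = m + n + 1) (a : Ars N)
    (q : Option (Fin N) → ℂ) :
    q ∈ (VTilde' N m).E a ↔ ∃ x : Fin (n + 1) → ℂ, ∀ o, q o = H a o x := by
  constructor
  · rintro ⟨h1, h2⟩
    obtain ⟨x, hx⟩ := exists_H_of_sums hN a hmn h1
    refine ⟨x, fun o => ?_⟩
    cases o with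
    | some i => exact hx i
    | none =>
      rw [← (sum_H hN a hmn x).2]
      simp only [hx] at h2
      linear_combination -h2
  · rintro ⟨x, hx⟩
    refine ⟨fun i hi => ?_, ?_⟩
    · simp only [hx]
      exact (sum_H hN a hmn x).1 i hi
    · simp only [hx]
      rw [(sum_H hN a hmn x).2, sub_self]

/-- Every point of `ℙ^n` comes from `n` points of `ℙ¹`. -/
theorem exists_symCoords (hn : 1 ≤ n) {x : Fin (n + 1) → ℂ} (hx : x ≠ 0) :
    ∃ t u : Fin n → ℂ, (∀ k, t k ≠ 0 ∨ u k ≠ 0) ∧ symCoords t u = x := by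
  obtain ⟨n, rfl⟩ := Nat.exists_eq_add_of_le' hn
  obtain ⟨c, t, u, hne, e⟩ := exists_linear_factors (natDegree_coeffPoly_le x)
  have hc : c ≠ 0 := by
    rintro rfl
    apply hx
    funext j
    rw [← coeff_coeffPoly x, e]
    simp
  -- The leading scalar of the factorization is absorbed into the first factor, which exists because
  -- n ≥ 1.
  refine ⟨fun k => (if k = 0 then c else 1) * t k, fun k => (if k = 0 then c else 1) * u k,
    fun k => ?_, ?_⟩
  · dsimp only
    split_ifs
    · simpa [hc] using hne k
    · simpa using hne k
  · funext j
    rw [← coeff_coeffPoly x, e, symCoords]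
    congr 1
    rw [Fin.prod_univ_succ, Fin.prod_univ_succ]
    simp only [if_true, Fin.succ_ne_zero, if_false, one_mul, C_mul]
    ring

/-- A family of polynomials whose coefficients belong to an algebra of functions. -/
def CoeffsIn {Z : Type*} (A : Subalgebra ℂ (Z → ℂ)) (p : Z → ℂ[X]) : Prop :=
  ∀ j, (fun z => (p z).coeff j) ∈ A

section CoeffsIn

variable {Z : Type*} {A : Subalgebra ℂ (Z → ℂ)}

theorem CoeffsIn.mul {p q : Z → ℂ[X]} (hp : CoeffsIn A p) (hq : CoeffsIn A q) :
    CoeffsIn A (fun z => p z * q z) := by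
  intro j
  have : (fun z => (p z * q z).coeff j) =
      ∑ k ∈ Finset.HasAntidiagonal.antidiagonal j,
        (fun z => (p z).coeff k.1) * (fun z => (q z).coeff k.2) := by
    funext z
    simp [coeff_mul, Finset.sum_apply]
  rw [this]
  exact sum_mem fun k _ => mul_mem (hp _) (hq _)

theorem CoeffsIn.C {f : Z → ℂ} (hf : f ∈ A) : CoeffsIn A (fun z => C (f z)) := by
  intro j
  simp only [coeff_C]
  split_ifs
  · exact hf
  · exact zero_mem _

theorem CoeffsIn.X_sub_C {f : Z → ℂ} (hf : f ∈ A) :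
    CoeffsIn A (fun z => Polynomial.X - Polynomial.C (f z)) := by
  intro j
  simp only [coeff_sub]
  exact sub_mem (Subalgebra.algebraMap_mem A (Polynomial.X.coeff j : ℂ)) (CoeffsIn.C hf j)

theorem CoeffsIn.prod {κ : Type*} (s : Finset κ) {p : κ → Z → ℂ[X]}
    (hp : ∀ k ∈ s, CoeffsIn A (p k)) : CoeffsIn A (fun z => ∏ k ∈ s, p k z) := by
  classical
  induction s using Finset.induction_on with
  | empty =>
    simp only [Finset.prod_empty]
    exact CoeffsIn.C (one_mem A)
  | insert k s hk ih =>
    simp only [Finset.prod_insert hk]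
    exact (hp k (Finset.mem_insert_self k s)).mul
      (ih fun l hl => hp l (Finset.mem_insert_of_mem hl))

/-- The only denominators in the Lagrange basis are differences of distinct nodes. -/
theorem CoeffsIn.interpolate {a : Z → Ars N} {q : Z → Fin N → ℂ}
    (ha : ∀ i, (fun z => (a z).1 i) ∈ A)
    (hinv : ∀ i j, i ≠ j → (fun z => ((a z).1 i - (a z).1 j)⁻¹) ∈ A)
    (hq : ∀ i, (fun z => q z i) ∈ A) :
    CoeffsIn A (fun z => Lagrange.interpolate Finset.univ (a z).1 (q z)) := by
  intro j
  simp only [Lagrange.interpolate_apply, finsetSum_coeff]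
  have : (fun z => ∑ i, (Polynomial.C (q z i) * Lagrange.basis Finset.univ (a z).1 i).coeff j) =
      ∑ i, fun z => (Polynomial.C (q z i) * Lagrange.basis Finset.univ (a z).1 i).coeff j := by
    funext z
    simp
  rw [this]
  refine sum_mem fun i _ => ?_
  refine ((CoeffsIn.C (hq i)).mul ?_) j
  refine CoeffsIn.prod _ fun k hk => ?_
  exact (CoeffsIn.C (hinv i k (Finset.ne_of_mem_erase hk).symm)).mul (CoeffsIn.X_sub_C (ha k))

end CoeffsIn

end Configurations

end

end QuadricTwist

/-! ### The product map on tuples of points of the curves, and averages of monomials. -/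

namespace QuadricTwist

noncomputable section

open SpaceWithFunctions

/-! ### Products of binary forms -/

section Forms

open Polynomial

theorem formEval_of_ne_zero {n : ℕ} {p : ℂ[X]} (hp : p.natDegree ≤ n) (τ : ℂ) {υ : ℂ}
    (hυ : υ ≠ 0) : formEval n p τ υ = υ ^ n * p.eval (τ / υ) := by
  rw [formEval, eval_eq_sum_range' (Nat.lt_succ_of_le hp), Finset.mul_sum]
  refine Finset.sum_congr rfl fun j hj => ?_
  obtain ⟨l, rfl⟩ := Nat.exists_eq_add_of_le (Nat.lt_succ_iff.1 (Finset.mem_range.1 hj))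
  rw [Nat.add_sub_cancel_left, pow_add, div_pow]
  field_simp

theorem formEval_zero_right (n : ℕ) (p : ℂ[X]) (τ : ℂ) :
    formEval n p τ 0 = p.coeff n * τ ^ n := by
  rw [formEval, Finset.sum_range_succ, Finset.sum_eq_zero]
  · simp
  · intro j hj
    have : n - j ≠ 0 := by
      have := Finset.mem_range.1 hj
      omega
    simp [this]

theorem formEval_mul {m n : ℕ} {p q : ℂ[X]} (hp : p.natDegree ≤ m) (hq : q.natDegree ≤ n)
    (τ υ : ℂ) : formEval (m + n) (p * q) τ υ = formEval m p τ υ * formEval n q τ υ := by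
  by_cases hυ : υ = 0
  · rw [hυ, formEval_zero_right, formEval_zero_right, formEval_zero_right,
      coeff_mul_add_eq_of_natDegree_le hp hq, pow_add]
    ring
  · rw [formEval_of_ne_zero hp τ hυ, formEval_of_ne_zero hq τ hυ,
      formEval_of_ne_zero (natDegree_mul_le.trans (add_le_add hp hq)) τ hυ, eval_mul, pow_add]
    ring

theorem formEval_pow {p : ℂ[X]} (hp : p.natDegree ≤ 1) (n : ℕ) (τ υ : ℂ) :
    formEval n (p ^ n) τ υ = formEval 1 p τ υ ^ n := by
  induction n with
  | zero => simp [formEval]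
  | succ n ih =>
    rw [pow_succ, formEval_mul (m := n) (n := 1) ?_ hp, ih, pow_succ]
    simpa using natDegree_pow_le_of_le n hp

theorem formEval_prod_pow {κ : Type*} (s : Finset κ) {p : κ → ℂ[X]}
    (hp : ∀ k, (p k).natDegree ≤ 1) (f : κ → ℕ) (τ υ : ℂ) :
    formEval (∑ k ∈ s, f k) (∏ k ∈ s, p k ^ f k) τ υ =
      ∏ k ∈ s, formEval 1 (p k) τ υ ^ f k := by
  classical
  have hdeg : ∀ k, (p k ^ f k).natDegree ≤ f k := fun k => by
    simpa using natDegree_pow_le_of_le (f k) (hp k)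
  induction s using Finset.induction_on with
  | empty => simp [formEval]
  | insert k s hk ih =>
    rw [Finset.sum_insert hk, Finset.prod_insert hk, Finset.prod_insert hk,
      formEval_mul (hdeg k) ((natDegree_prod_le _ _).trans (Finset.sum_le_sum fun l _ => hdeg l)),
      ih, formEval_pow (hp k)]

theorem formEval_sum {κ : Type*} (s : Finset κ) (c : κ → ℂ) (p : κ → ℂ[X]) (n : ℕ) (τ υ : ℂ) :
    formEval n (∑ k ∈ s, C (c k) * p k) τ υ = ∑ k ∈ s, c k * formEval n (p k) τ υ := by
  simp only [formEval, finsetSum_coeff, coeff_C_mul, Finset.sum_mul, Finset.mul_sum]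
  rw [Finset.sum_comm]
  exact Finset.sum_congr rfl fun _ _ => Finset.sum_congr rfl fun _ _ => mul_assoc _ _ _

theorem formEval_X_pow {n j : ℕ} (hj : j ≤ n) (τ υ : ℂ) :
    formEval n (Polynomial.X ^ j) τ υ = τ ^ j * υ ^ (n - j) := by
  rw [formEval, Finset.sum_eq_single j]
  · simp
  · intro k _ hk
    simp [coeff_X_pow, hk]
  · intro h
    exact absurd (Finset.mem_range.2 (Nat.lt_succ_of_le hj)) h

theorem CoeffsIn.pow {Z : Type*} {A : Subalgebra ℂ (Z → ℂ)} {p : Z → ℂ[X]} (hp : CoeffsIn A p)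
    (n : ℕ) : CoeffsIn A (fun z => p z ^ n) := by
  induction n with
  | zero =>
    simp only [pow_zero]
    exact CoeffsIn.C (one_mem A)
  | succ n ih =>
    simp only [pow_succ]
    exact ih.mul hp

/-- Suppose that an algebra of functions contains the coefficients of `∏_k (u_k T - t_k)`.  Then it
contains the functions of `(t, u)` that are symmetric and homogeneous of the same degree in each
pair `(t_k, u_k)`. -/
theorem sum_perm_formEval_mem {Z : Type*} {A : Subalgebra ℂ (Z → ℂ)} {n : ℕ}
    {t u : Z → Fin n → ℂ} (h : ∀ τ υ : ℂ, (fun z => ∏ k, (u z k * τ - t z k * υ)) ∈ A) {D : ℕ}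
    {p : Fin n → Z → ℂ[X]} (hp : ∀ k, CoeffsIn A (p k)) :
    (fun z => ∑ σ : Equiv.Perm (Fin n), ∏ k, formEval D (p k z) (t z (σ k)) (u z (σ k))) ∈ A := by
  -- The same constant form q in every pair: factoring q into linear forms and exchanging the two
  -- products expresses ∏_k q(t_k, u_k) through values of ∏_k(u_k τ - t_k υ), as for a resultant.
  have h1 : ∀ q : ℂ[X], q.natDegree ≤ D → (fun z => ∏ k, formEval D q (t z k) (u z k)) ∈ A := by
    intro q hq
    obtain ⟨c, r, s, -, rfl⟩ := exists_linear_factors hq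
    have : (fun z => ∏ k, formEval D (C c * ∏ l, (C (s l) * Polynomial.X - C (r l))) (t z k) (u z k)) =
        (algebraMap ℂ (Z → ℂ) (c ^ n)) *
          ∏ l, fun z => ∏ k, (u z k * -r l - t z k * -s l) := by
      funext z
      simp only [formEval_C_mul, formEval_prod, Finset.prod_mul_distrib, Pi.mul_apply,
        Finset.prod_apply]
      rw [Finset.prod_comm]
      congr 1
      · simp
      · exact Finset.prod_congr rfl fun _ _ => Finset.prod_congr rfl fun _ _ => by ring
    rw [this]
    exact mul_mem (Subalgebra.algebraMap_mem A _) (prod_mem fun l _ => h _ _)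
  -- Different constant forms q_k: polarization writes the symmetrized product as a combination of
  -- the previous case for the forms ∑ ±q_k.
  have h2 : ∀ q : Fin n → ℂ[X], (∀ k, (q k).natDegree ≤ D) →
      (fun z => ∑ σ : Equiv.Perm (Fin n), ∏ k, formEval D (q k) (t z (σ k)) (u z (σ k))) ∈ A := by
    intro q hq
    have e : (fun z => ∑ σ : Equiv.Perm (Fin n), ∏ k, formEval D (q k) (t z (σ k)) (u z (σ k))) =
        ((2 : ℂ) ^ n)⁻¹ • ∑ ε : Fin n → ℤˣ, (∏ k, ((ε k : ℤ) : ℂ)) •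
          fun z => ∏ j, formEval D (∑ k, C ((ε k : ℤ) : ℂ) * q k) (t z j) (u z j) := by
      funext z
      have h3 := two_pow_mul_sum_perm (fun k j => formEval D (q k) (t z j) (u z j))
      simp only [Pi.smul_apply, Finset.sum_apply, smul_eq_mul, formEval_sum]
      rw [← h3, inv_mul_cancel_left₀ (pow_ne_zero n two_ne_zero),
        ← Equiv.sum_comp (Equiv.inv (Equiv.Perm (Fin n)))]
      refine Finset.sum_congr rfl fun σ _ => ?_
      rw [← Equiv.prod_comp σ]
      simp
    rw [e]
    refine Subalgebra.smul_mem _ (sum_mem fun ε _ => Subalgebra.smul_mem _ (h1 _ ?_) _) _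
    exact natDegree_sum_le_of_forall_le _ _ fun k _ => (natDegree_C_mul_le _ _).trans (hq k)
  -- Forms with variable coefficients: the coefficients lie in A and can be taken out, leaving the
  -- constant forms T^β.
  have e : (fun z => ∑ σ : Equiv.Perm (Fin n), ∏ k, formEval D (p k z) (t z (σ k)) (u z (σ k))) =
      ∑ β ∈ Fintype.piFinset fun _ : Fin n => Finset.range (D + 1),
        (∏ k, fun z => (p k z).coeff (β k)) * fun z => ∑ σ : Equiv.Perm (Fin n),
          ∏ k, formEval D (Polynomial.X ^ β k) (t z (σ k)) (u z (σ k)) := by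
    funext z
    simp only [Finset.sum_apply, Pi.mul_apply, Finset.prod_apply, Finset.mul_sum]
    rw [Finset.sum_comm]
    refine Finset.sum_congr rfl fun σ _ => ?_
    rw [show ∏ k, formEval D (p k z) (t z (σ k)) (u z (σ k)) =
      ∏ k, ∑ j ∈ Finset.range (D + 1), (p k z).coeff j * (t z (σ k) ^ j * u z (σ k) ^ (D - j))
      from rfl, Finset.prod_univ_sum]
    refine Finset.sum_congr rfl fun β hβ => ?_
    rw [← Finset.prod_mul_distrib]
    refine Finset.prod_congr rfl fun k _ => ?_
    rw [formEval_X_pow (Nat.lt_succ_iff.1 (Finset.mem_range.1 (Fintype.mem_piFinset.1 hβ k)))]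
  rw [e]
  refine sum_mem fun β hβ => mul_mem (prod_mem fun k _ => hp k _) (h2 _ fun k => ?_)
  rw [natDegree_X_pow]
  exact Nat.lt_succ_iff.1 (Finset.mem_range.1 (Fintype.mem_piFinset.1 hβ k))

end Forms

/-! ### Curves and configurations -/

/-- The linear forms `t - a_i u` and `u`. -/
def lin {N : ℕ} (a : Ars N) (o : Option (Fin N)) (t u : ℂ) : ℂ :=
  o.elim u (fun i => t - a.1 i * u)

/-- A square root of `(-1)^n` for the first `N` indices, and one for the last index. -/
def signRoot {N : ℕ} (n : ℕ) (o : Option (Fin N)) : ℂ := o.elim 1 (fun _ => Complex.I ^ n)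

theorem signRoot_ne_zero {N : ℕ} (n : ℕ) (o : Option (Fin N)) : signRoot n o ≠ 0 := by
  cases o <;> simp [signRoot]

/-- The curve uses t - a_i u, while H evaluates to factors u a_i - t. The resulting (-1)^n is
compensated by the constant I^n in the first N coordinates; the last coordinate needs no correction.
-/
theorem signRoot_sq_mul_prod_lin {N n : ℕ} (a : Ars N) (o : Option (Fin N)) (t u : Fin n → ℂ) :
    signRoot n o ^ 2 * ∏ k, lin a o (t k) (u k) = H a o (symCoords t u) := by
  rw [H_symCoords]
  cases o with
  | none => simp [signRoot, lin, node]
  | some i =>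
    simp only [signRoot, lin, node, Option.elim, mul_one]
    rw [← pow_mul, mul_comm n 2, pow_mul, Complex.I_sq,
      Finset.prod_congr rfl fun k _ => (neg_sub (t k) (u k * a.1 i)).symm, Finset.prod_neg,
      Finset.card_univ, Fintype.card_fin]
    simp only [mul_comm (u _)]

theorem eq_zero_of_lin {N : ℕ} (hN : 2 ≤ N) (a : Ars N) {t u : ℂ}
    (h : ∀ i, lin a (some i) t u = 0) : t = 0 ∧ u = 0 := by
  have h0 := h ⟨0, by omega⟩
  have h1 := h ⟨1, by omega⟩
  simp only [lin, Option.elim] at h0 h1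
  have hu : u = 0 := by
    by_contra hu
    have : (⟨0, by omega⟩ : Fin N) = ⟨1, by omega⟩ := by
      apply a.2.1
      apply mul_right_cancel₀ hu
      linear_combination h1 - h0
    simp at this
  rw [hu] at h0
  exact ⟨by simpa using h0, hu⟩

/-- An equivariant identification of the index set with the first `N`, or all `N + 1`, indices. -/
structure Marking (N : ℕ) (ι : Type) [MulAction (W N) ι] where
  toOption : ι → Option (Fin N)
  ofFin : Fin N → ι
  toOption_ofFin : ∀ i, toOption (ofFin i) = some i
  toOption_smul : ∀ (w : W N) (o : ι), toOption (w • o) = w • toOption o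

section Marked

variable {N : ℕ} {ι : Type} [MulAction (W N) ι]

/-- The family of planes defining the curves. -/
def IsCurveFamily (μ : Marking N ι) (F : LinFamily N ι) : Prop :=
  ∀ a q, q ∈ F.E a ↔ ∃ t u : ℂ, ∀ o, q o = lin a (μ.toOption o) t u

/-- The family of subspaces parametrized by the forms `H_{a,o}`. -/
def IsConfigFamily (μ : Marking N ι) (n : ℕ) (F : LinFamily N ι) : Prop :=
  ∀ a q, q ∈ F.E a ↔ ∃ x : Fin (n + 1) → ℂ, ∀ o, q o = H a (μ.toOption o) x

/-- The fibre powers of the punctured cones over the curves. -/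
def MultiCone (F : LinFamily N ι) (n : ℕ) : Type :=
  {p : Ars N × (Fin n → ι → ℂ) // ∀ k, p.2 k ≠ 0 ∧ sq (p.2 k) ∈ F.E p.1}

/-- The coordinates `a_i`, `y_{k,o}`. -/
def MultiCone.coord (F : LinFamily N ι) (n : ℕ) : Fin N ⊕ (Fin n × ι) → MultiCone F n → ℂ :=
  Sum.elim (fun i z => z.1.1.1 i) (fun p z => z.1.2 p.1 p.2)

instance (F : LinFamily N ι) (n : ℕ) : SpaceWithFunctions (MultiCone F n) :=
  coordinates (MultiCone.coord F n)

instance (F : LinFamily N ι) (n : ℕ) : IsGood (instSpaceWithFunctionsMultiCone F n) :=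
  inferInstanceAs (IsGood (coordinates _))

theorem MultiCone.coord_mem (F : LinFamily N ι) (n : ℕ) (k : Fin N ⊕ (Fin n × ι)) :
    MultiCone.coord F n k ∈ regularFunctions (MultiCone F n) := fun z => coordinates_regular k z

variable {μ : Marking N ι} {n : ℕ} {F F' : LinFamily N ι}

theorem MultiCone.exists_lin (hF : IsCurveFamily μ F) (z : MultiCone F n) :
    ∃ t u : Fin n → ℂ, ∀ k, (t k ≠ 0 ∨ u k ≠ 0) ∧
      ∀ o, z.1.2 k o ^ 2 = lin z.1.1 (μ.toOption o) (t k) (u k) := by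
  choose t u h using fun k => (hF _ _).1 (z.2 k).2
  refine ⟨t, u, fun k => ⟨?_, h k⟩⟩
  by_contra! h0
  refine (z.2 k).1 (funext fun o => ?_)
  have := h k o
  rw [h0.1, h0.2] at this
  have h1 : lin z.1.1 (μ.toOption o) 0 0 = 0 := by
    cases μ.toOption o <;> simp [lin]
  rw [h1] at this
  simpa [sq] using this

theorem symCoords_ne_zero {t u : Fin n → ℂ} (h : ∀ k, t k ≠ 0 ∨ u k ≠ 0) : symCoords t u ≠ 0 := by
  intro h0
  have h1 := coeffPoly_symCoords t u
  rw [h0] at h1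
  have h2 : coeffPoly (0 : Fin (n + 1) → ℂ) = 0 := by simp [coeffPoly]
  rw [h2] at h1
  exact Finset.prod_ne_zero_iff.2 (fun k _ => linear_ne_zero (h k)) h1.symm

variable (μ) in
/-- The products `v_o = s_o ∏_k y_{k,o}`. -/
def prodCoords (y : Fin n → ι → ℂ) : ι → ℂ := fun o => signRoot n (μ.toOption o) * ∏ k, y k o

theorem sq_prodCoords {a : Ars N} {y : Fin n → ι → ℂ} {t u : Fin n → ℂ}
    (h : ∀ k o, y k o ^ 2 = lin a (μ.toOption o) (t k) (u k)) (o : ι) :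
    sq (prodCoords μ y) o = H a (μ.toOption o) (symCoords t u) := by
  rw [← signRoot_sq_mul_prod_lin]
  simp only [sq, prodCoords, mul_pow, ← Finset.prod_pow, h]

/-- The map from the fibre power of the cones to the cone over the configuration. -/
def MultiCone.toCone (hF : IsCurveFamily μ F) (hF' : IsConfigFamily μ n F') (hn : n < N)
    (z : MultiCone F n) : Cone F' :=
  ⟨(z.1.1, prodCoords μ z.1.2), by
    obtain ⟨t, u, h⟩ := z.exists_lin hF
    have hsq := sq_prodCoords (μ := μ) fun k => (h k).2
    refine ⟨fun h0 => symCoords_ne_zero (fun k => (h k).1) ?_, (hF' _ _).2 ⟨_, hsq⟩⟩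
    refine eq_of_H_eq hn z.1.1 fun i => ?_
    have h1 := hsq (μ.ofFin i)
    replace h0 : prodCoords μ z.1.2 = 0 := h0
    rw [h0, μ.toOption_ofFin] at h1
    rw [← h1]
    simp [sq, H]⟩

variable (hF : IsCurveFamily μ F) (hF' : IsConfigFamily μ n F') (hn : n < N)

-- Arbitrary square roots of the linear factors multiply to v up to one sign for each coordinate.
-- Changing these signs in the first vector alone corrects the product and leaves all squares
-- unchanged.
include hF in
theorem MultiCone.exists_signs_prod {a : Ars N} {v : ι → ℂ} (h1 : 1 ≤ n) (hN : 2 ≤ N)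
    {t u : Fin n → ℂ} (htu : ∀ k, t k ≠ 0 ∨ u k ≠ 0)
    (hv : ∀ o, v o ^ 2 = H a (μ.toOption o) (symCoords t u)) :
    ∃ z : MultiCone F n, z.1.1 = a ∧ prodCoords μ z.1.2 = v := by
  classical
  choose y hy using fun k o =>
    IsAlgClosed.exists_pow_nat_eq (lin a (μ.toOption o) (t k) (u k)) two_pos
  have hsgn : ∀ o, ∃ e : ℂ, e ^ 2 = 1 ∧ e * prodCoords μ y o = v o := by
    intro o
    have h2 : prodCoords μ y o ^ 2 = v o ^ 2 := (sq_prodCoords hy o).trans (hv o).symm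
    rcases sq_eq_sq_iff_eq_or_eq_neg.1 h2 with h3 | h3
    · exact ⟨1, one_pow 2, by rw [h3, one_mul]⟩
    · exact ⟨-1, by norm_num, by rw [h3]; ring⟩
  choose e he hev using hsgn
  let k₀ : Fin n := ⟨0, h1⟩
  have hy' : ∀ k o, ((if k = k₀ then e o else 1) * y k o) ^ 2 =
      lin a (μ.toOption o) (t k) (u k) := by
    intro k o
    rw [mul_pow, hy]
    split_ifs
    · rw [he, one_mul]
    · ring
  refine ⟨⟨(a, fun k o => (if k = k₀ then e o else 1) * y k o), fun k => ⟨fun h0 => ?_, ?_⟩⟩, rfl,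
    funext fun o => ?_⟩
  · have h3 : ∀ i, lin a (some i) (t k) (u k) = 0 := by
      intro i
      rw [← μ.toOption_ofFin i, ← hy' k]
      exact (pow_eq_zero_iff two_ne_zero).2 (congrFun h0 (μ.ofFin i))
    rcases htu k with h4 | h4
    · exact h4 (eq_zero_of_lin hN a h3).1
    · exact h4 (eq_zero_of_lin hN a h3).2
  · exact (hF _ _).2 ⟨t k, u k, hy' k⟩
  · rw [← hev o]
    simp only [prodCoords, Finset.prod_mul_distrib, Finset.prod_ite_eq', Finset.mem_univ, if_true]
    ring

theorem MultiCone.toCone_surjective (h1 : 1 ≤ n) :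
    Function.Surjective (MultiCone.toCone hF hF' hn) := by
  rintro ⟨⟨a, v⟩, hv0, hv⟩
  obtain ⟨x, hx⟩ := (hF' _ _).1 hv
  have hx0 : x ≠ 0 := by
    rintro rfl
    refine hv0 (funext fun o => ?_)
    have h2 : H a (μ.toOption o) (0 : Fin (n + 1) → ℂ) = 0 := by
      cases μ.toOption o <;> simp [H]
    have := (hx o).trans h2
    simpa [sq] using this
  obtain ⟨t, u, htu, rfl⟩ := exists_symCoords h1 hx0
  obtain ⟨z, rfl, rfl⟩ := MultiCone.exists_signs_prod hF (n := n) h1 (by omega) htu hx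
  exact ⟨z, rfl⟩

/-! ### Averages of multihomogeneous functions -/

/-- The algebra of functions on the fibre power of the cones that come from regular functions on
the cone over the configuration. -/
def descentAlgebra : Subalgebra ℂ (MultiCone F n → ℂ) :=
  (regularFunctions (Cone F')).map
    (AlgHom.pi fun z => Pi.evalAlgHom ℂ (fun _ : Cone F' => ℂ) (MultiCone.toCone hF hF' hn z))

theorem mem_descentAlgebra {P : MultiCone F n → ℂ} : P ∈ descentAlgebra hF hF' hn ↔
    ∃ h ∈ regularFunctions (Cone F'), ∀ z, P z = h (MultiCone.toCone hF hF' hn z) := by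
  refine ⟨?_, ?_⟩
  · rintro ⟨h, hh, rfl⟩
    exact ⟨h, hh, fun z => rfl⟩
  · rintro ⟨h, hh, e⟩
    exact ⟨h, hh, (funext e).symm⟩

theorem Cone.regMapAt_base (z : Cone F) :
    RegMapAt (instSpaceWithFunctionsCone F) (instSpaceWithFunctionsArs N) (fun z => z.1.1) z :=
  regMapAt_ars fun i => Cone.coord_mem (Sum.inl i) z

theorem inv_sub_mem_regularFunctions {i j : Fin N} (hij : i ≠ j) :
    (fun a : Ars N => (a.1 i - a.1 j)⁻¹) ∈ regularFunctions (Ars N) := by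
  refine inv_mem_regularFunctions (f := fun a : Ars N => a.1 i - a.1 j)
    (sub_mem (fun a => regularAt_ars i a) (fun a => regularAt_ars j a)) fun a h => ?_
  exact hij (a.2.1 (sub_eq_zero.1 h))

theorem base_mem_descentAlgebra {A : Ars N → ℂ} (hA : A ∈ regularFunctions (Ars N)) :
    (fun z : MultiCone F n => A z.1.1) ∈ descentAlgebra hF hF' hn :=
  (mem_descentAlgebra hF hF' hn).2 ⟨fun z => A z.1.1, fun z => Cone.regMapAt_base z A (hA _),
    fun _ => rfl⟩

theorem prod_mem_descentAlgebra (o : ι) :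
    (fun z : MultiCone F n => ∏ k, z.1.2 k o) ∈ descentAlgebra hF hF' hn := by
  refine (mem_descentAlgebra hF hF' hn).2 ⟨(signRoot n (μ.toOption o))⁻¹ • fun z => z.1.2 o,
    Subalgebra.smul_mem _ (Cone.coord_mem (Sum.inr o)) _, fun z => ?_⟩
  exact (inv_mul_cancel_left₀ (signRoot_ne_zero n _) _).symm

theorem Cone.coeffsIn_interpolate (μ : Marking N ι) :
    CoeffsIn (regularFunctions (Cone F)) (fun z : Cone F =>
      Lagrange.interpolate Finset.univ z.1.1.1 (fun i => z.1.2 (μ.ofFin i) ^ 2)) :=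
  CoeffsIn.interpolate (fun i => Cone.coord_mem (Sum.inl i))
    (fun _ _ hij z => Cone.regMapAt_base z _ (inv_sub_mem_regularFunctions hij z.1.1))
    (fun i => pow_mem (Cone.coord_mem (Sum.inr (μ.ofFin i))) 2)

/-- The squares v_i² are the values of ∏(u_k T - t_k) at the N > n nodes a_i, so its coefficients
are regular functions of (a, v) by interpolation. In particular t and u may be chosen without any
regularity. -/
theorem prod_linear_mem_descentAlgebra {t u : MultiCone F n → Fin n → ℂ}
    (h : ∀ z k o, z.1.2 k o ^ 2 = lin z.1.1 (μ.toOption o) (t z k) (u z k)) (τ υ : ℂ) :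
    (fun z => ∏ k, (u z k * τ - t z k * υ)) ∈ descentAlgebra hF hF' hn := by
  refine (mem_descentAlgebra hF hF' hn).2 ⟨fun z => formEval n
    (Lagrange.interpolate Finset.univ z.1.1.1 (fun i => z.1.2 (μ.ofFin i) ^ 2)) τ υ, ?_, fun z => ?_⟩
  · have : (fun z : Cone F' => formEval n (Lagrange.interpolate Finset.univ z.1.1.1
        (fun i => z.1.2 (μ.ofFin i) ^ 2)) τ υ) = ∑ j ∈ Finset.range (n + 1),
          (τ ^ j * υ ^ (n - j)) • fun z : Cone F' => (Lagrange.interpolate Finset.univ z.1.1.1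
            (fun i => z.1.2 (μ.ofFin i) ^ 2)).coeff j := by
      funext z
      simp [formEval, mul_comm]
    rw [this]
    exact sum_mem fun j _ => Subalgebra.smul_mem _ (Cone.coeffsIn_interpolate μ j) _
  · have e : ∀ i, (MultiCone.toCone hF hF' hn z).1.2 (μ.ofFin i) ^ 2 =
        H z.1.1 (some i) (symCoords (t z) (u z)) := by
      intro i
      rw [← μ.toOption_ofFin i]
      exact sq_prodCoords (h z) (μ.ofFin i)
    simp only [e]
    rw [← formEval_prod, ← coeffPoly_symCoords, coeffPoly_eq_interpolate hn z.1.1]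
    rfl

/-- The polynomials dehomogenizing the forms `t - a_i u` and `u`. -/
def linPoly (a : Ars N) (o : Option (Fin N)) : Polynomial ℂ :=
  o.elim 1 (fun i => Polynomial.X - Polynomial.C (a.1 i))

theorem natDegree_linPoly_le (a : Ars N) (o : Option (Fin N)) : (linPoly a o).natDegree ≤ 1 := by
  cases o with
  | none => simp [linPoly]
  | some i => exact (Polynomial.natDegree_X_sub_C _).le

theorem formEval_linPoly (a : Ars N) (o : Option (Fin N)) (t u : ℂ) :
    formEval 1 (linPoly a o) t u = lin a o t u := by
  cases o with
  | none => simp [linPoly, lin, formEval, Polynomial.coeff_one]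
  | some i =>
    simp [linPoly, lin, formEval, Finset.sum_range_succ, Polynomial.coeff_X, Polynomial.coeff_C]
    ring

theorem coeffsIn_linPoly (o : Option (Fin N)) :
    CoeffsIn (descentAlgebra hF hF' hn) (fun z => linPoly z.1.1 o) := by
  cases o with
  | none => exact CoeffsIn.C (one_mem _)
  | some i => exact CoeffsIn.X_sub_C (base_mem_descentAlgebra hF hF' hn fun a => regularAt_ars i a)

/-- Squares of the coordinates of y_k are linear forms in (t_k, u_k). Hence each factor is a binary
form of degree D, and the symmetric functions of such forms have been computed in
`sum_perm_formEval_mem`. -/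
theorem sum_perm_prod_sq_mem [Fintype ι] {D : ℕ} {f : Fin n → ι → ℕ} (hf : ∀ k, ∑ o, f k o = D) :
    (fun z : MultiCone F n => ∑ σ : Equiv.Perm (Fin n), ∏ k, ∏ o, (z.1.2 (σ k) o ^ 2) ^ f k o) ∈
      descentAlgebra hF hF' hn := by
  choose t u h using fun z : MultiCone F n => z.exists_lin hF
  have h' := fun z k => (h z k).2
  have e : (fun z : MultiCone F n =>
      ∑ σ : Equiv.Perm (Fin n), ∏ k, ∏ o, (z.1.2 (σ k) o ^ 2) ^ f k o) =
      fun z => ∑ σ : Equiv.Perm (Fin n), ∏ k, formEval D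
        (∏ o, linPoly z.1.1 (μ.toOption o) ^ f k o) (t z (σ k)) (u z (σ k)) := by
    funext z
    refine Finset.sum_congr rfl fun σ _ => Finset.prod_congr rfl fun k _ => ?_
    rw [← hf k, formEval_prod_pow _ fun o => natDegree_linPoly_le _ _]
    simp only [formEval_linPoly, h']
  rw [e]
  exact sum_perm_formEval_mem (prod_linear_mem_descentAlgebra hF hF' hn h') fun k =>
    CoeffsIn.prod _ fun o _ => (coeffsIn_linPoly hF hF' hn _).pow _

variable (ι n) in
/-- The group of tuples of sign changes with trivial product. -/
abbrev SignKernel : Type :=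
  MonoidHom.ker ({ toFun := fun ζ => ∏ k, ζ k
                   map_one' := by simp
                   map_mul' := fun ζ ξ => by simp [Finset.prod_mul_distrib] } :
    (Fin n → ι → ℤˣ) →* (ι → ℤˣ))

theorem SignKernel.prod_eq_one (ζ : SignKernel ι n) (o : ι) : ∏ k, ζ.1 k o = 1 := by
  have h : ∏ k, ζ.1 k = 1 := ζ.2
  rw [← Finset.prod_apply, h, Pi.one_apply]

/-- The action of sign changes with trivial product and permutations. -/
def MultiCone.act (g : SignKernel ι n × Equiv.Perm (Fin n)) (z : MultiCone F n) :
    MultiCone F n :=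
  ⟨(z.1.1, fun k => signL (g.1.1 k) (z.1.2 (g.2 k))), fun k =>
    ⟨fun h => (z.2 (g.2 k)).1 (signL_injective _ (h.trans (map_zero _).symm)), by
      rw [sq_signL]
      exact (z.2 (g.2 k)).2⟩⟩

theorem MultiCone.toCone_act (g : SignKernel ι n × Equiv.Perm (Fin n)) (z : MultiCone F n) :
    MultiCone.toCone hF hF' hn (MultiCone.act g z) = MultiCone.toCone hF hF' hn z := by
  refine Subtype.ext (Prod.ext rfl (funext fun o => ?_))
  change _ * ∏ k, ((g.1.1 k o : ℤ) : ℂ) * z.1.2 (g.2 k) o = _ * ∏ k, z.1.2 k o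
  have h : ∏ k, ((g.1.1 k o : ℤ) : ℂ) = 1 := by
    have := congrArg (fun e : ℤˣ => ((e : ℤ) : ℂ)) (g.1.prod_eq_one o)
    simpa using this
  rw [Finset.prod_mul_distrib, h, one_mul, Equiv.prod_comp g.2 (fun k => z.1.2 k o)]

open Classical in
/-- The average of a multihomogeneous monomial is a regular function of `(a, v)`. -/
theorem sum_act_monomial_mem [Fintype ι] {A : Ars N → ℂ} (hA : A ∈ regularFunctions (Ars N))
    {e : Fin n → ι → ℕ} {D : ℕ} (he : ∀ k, ∑ o, e k o = D) :
    (fun z : MultiCone F n => ∑ g, A (MultiCone.act g z).1.1 *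
      ∏ k, ∏ o, (MultiCone.act g z).1.2 k o ^ e k o) ∈ descentAlgebra hF hF' hn := by
  have hsum : (fun z : MultiCone F n => ∑ g, A (MultiCone.act g z).1.1 *
      ∏ k, ∏ o, (MultiCone.act g z).1.2 k o ^ e k o) = fun z : MultiCone F n => A z.1.1 *
        ((∑ ζ : SignKernel ι n, ∏ k, ∏ o, ((ζ.1 k o : ℤ) : ℂ) ^ e k o) *
          ∑ σ : Equiv.Perm (Fin n), ∏ k, ∏ o, z.1.2 (σ k) o ^ e k o) := by
    funext z
    rw [Fintype.sum_prod_type, Finset.sum_mul_sum, Finset.mul_sum]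
    refine Finset.sum_congr rfl fun ζ _ => ?_
    rw [Finset.mul_sum]
    refine Finset.sum_congr rfl fun σ _ => ?_
    change A z.1.1 * ∏ k, ∏ o, (((ζ.1 k o : ℤ) : ℂ) * z.1.2 (σ k) o) ^ e k o = _
    simp only [mul_pow, Finset.prod_mul_distrib]
  rw [hsum]
  -- If a coordinate o occurs with odd exponent in one vector and even exponent in another, flipping
  -- its sign in both stays in the kernel and negates the monomial, so the average is zero.
  by_cases hpar : ∃ k k' o, ¬ Even (e k o) ∧ Even (e k' o)
  · obtain ⟨k₁, k₂, o, h1, h2⟩ := hpar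
    have hk : k₁ ≠ k₂ := by
      rintro rfl
      exact h1 h2
    have hzero : ∑ ζ : SignKernel ι n, ∏ k, ∏ o, ((ζ.1 k o : ℤ) : ℂ) ^ e k o = 0 := by
      let s : ι → ℤˣ := Pi.mulSingle o (-1)
      let g : SignKernel ι n := ⟨Pi.mulSingle k₁ s * Pi.mulSingle k₂ s, by
        change ∏ k, (Pi.mulSingle k₁ s * Pi.mulSingle k₂ s : Fin n → ι → ℤˣ) k = 1
        simp only [Pi.mul_apply, Finset.prod_mul_distrib, Finset.prod_pi_mulSingle',
          Finset.mem_univ, if_true]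
        funext i
        exact Int.units_mul_self _⟩
      have hs : ∀ k₀ : Fin n, ∏ k, ∏ i,
          (((Pi.mulSingle k₀ s : Fin n → ι → ℤˣ) k i : ℤ) : ℂ) ^ e k i = (-1) ^ e k₀ o := by
        intro k₀
        rw [Finset.prod_eq_single k₀ (fun k _ hk => by simp [Pi.mulSingle_eq_of_ne hk]) (by simp),
          Finset.prod_eq_single o (fun i _ hi => by simp [s, Pi.mulSingle_eq_of_ne hi]) (by simp)]
        simp [s]
      refine sum_eq_zero_of_mul_right g fun ζ => ?_
      have : ∀ k i, (((ζ * g).1 k i : ℤ) : ℂ) = ((ζ.1 k i : ℤ) : ℂ) *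
          ((((Pi.mulSingle k₁ s : Fin n → ι → ℤˣ) k i : ℤ) : ℂ) *
            (((Pi.mulSingle k₂ s : Fin n → ι → ℤˣ) k i : ℤ) : ℂ)) := by
        intro k i
        simp [g]
      simp only [this, mul_pow, Finset.prod_mul_distrib, hs]
      rw [h2.neg_one_pow, (Nat.not_even_iff_odd.1 h1).neg_one_pow]
      ring
    simp only [hzero, zero_mul, mul_zero]
    exact zero_mem _
  · push Not at hpar
    refine mul_mem (base_mem_descentAlgebra hF hF' hn hA)
      (mul_mem (Subalgebra.algebraMap_mem _ (_ : ℂ)) ?_)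
    rcases Nat.eq_zero_or_pos n with rfl | hpos
    · have : (fun z : MultiCone F 0 => ∑ σ : Equiv.Perm (Fin 0),
          ∏ k, ∏ o, z.1.2 (σ k) o ^ e k o) = 1 := by
        funext z
        simp
      rw [this]
      exact one_mem _
    -- Otherwise the parity p_o does not depend on k. The odd parts combine to powers of ∏_k
    -- y_{k,o}, that is, of v_o up to a constant; the rest is a monomial in squares.
    let p : ι → ℕ := fun o => e ⟨0, hpos⟩ o % 2
    have hep : ∀ k o, e k o = 2 * (e k o / 2) + p o := by
      intro k o
      have h1 := hpar k ⟨0, hpos⟩ o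
      have h2 := hpar ⟨0, hpos⟩ k o
      simp only [Nat.even_iff] at h1 h2
      simp only [p]
      omega
    -- The monomials in squares have the same degree in every vector, because p is common to all of
    -- them.
    have hf : ∀ k, ∑ o, e k o / 2 = (D - ∑ o, p o) / 2 := by
      intro k
      have h1 := he k
      rw [Finset.sum_congr rfl fun o _ => hep k o, Finset.sum_add_distrib, ← Finset.mul_sum] at h1
      omega
    have : (fun z : MultiCone F n => ∑ σ : Equiv.Perm (Fin n),
        ∏ k, ∏ o, z.1.2 (σ k) o ^ e k o) = (∏ o, (fun z => ∏ k, z.1.2 k o) ^ p o) *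
          fun z => ∑ σ : Equiv.Perm (Fin n), ∏ k, ∏ o, (z.1.2 (σ k) o ^ 2) ^ (e k o / 2) := by
      funext z
      simp only [Pi.mul_apply, Finset.prod_apply, Pi.pow_apply, Finset.mul_sum]
      refine Finset.sum_congr rfl fun σ _ => ?_
      rw [Finset.prod_comm, Finset.prod_comm (f := fun k o => (z.1.2 (σ k) o ^ 2) ^ (e k o / 2)),
        ← Finset.prod_mul_distrib]
      refine Finset.prod_congr rfl fun o _ => ?_
      generalize z.1.2 = y
      rw [← Equiv.prod_comp σ (fun k => y k o), ← Finset.prod_pow, ← Finset.prod_mul_distrib]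
      refine Finset.prod_congr rfl fun k _ => ?_
      conv_lhs => rw [hep k o]
      rw [pow_add, pow_mul, mul_comm]
    rw [this]
    exact mul_mem (prod_mem fun o _ => pow_mem (prod_mem_descentAlgebra hF hF' hn o) _)
      (sum_perm_prod_sq_mem hF hF' hn hf)

end Marked

end

end QuadricTwist

/-! ### Multihomogeneous functions, and descent from tuples of points to the configuration. -/

namespace QuadricTwist

noncomputable section

open SpaceWithFunctions

/-! ### Homogenization, and descent to the configuration -/

section Homogenization

variable {N : ℕ} {ι : Type} [MulAction (W N) ι] {n : ℕ} {F F' : LinFamily N ι}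

/-- Normalizing one coordinate of each vector. -/
def MultiCone.normalize (c : Fin n → ι) (z : MultiCone F n) (hz : ∀ k, z.1.2 k (c k) ≠ 0) :
    MultiCone F n :=
  ⟨(z.1.1, fun k o => z.1.2 k o / z.1.2 k (c k)), fun k =>
    ⟨fun h => one_ne_zero ((div_self (hz k)).symm.trans (congrFun h (c k))), by
      have : sq (fun o => z.1.2 k o / z.1.2 k (c k)) =
          ((z.1.2 k (c k))⁻¹ ^ 2) • sq (z.1.2 k) := by
        funext i
        simp only [sq, Pi.smul_apply, smul_eq_mul]
        ring
      rw [this]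
      exact Submodule.smul_mem _ _ (z.2 k).2⟩⟩

variable {μ : Marking N ι} (hF : IsCurveFamily μ F) (hF' : IsConfigFamily μ n F') (hn : n < N)

theorem MultiCone.proj_toCone_normalize (c : Fin n → ι) (z : MultiCone F n)
    (hz : ∀ k, z.1.2 k (c k) ≠ 0) :
    ((z.normalize c hz).toCone hF hF' hn).proj = (z.toCone hF hF' hn).proj := by
  refine Cone.proj_eq_iff.2 ⟨rfl, ∏ k, z.1.2 k (c k), Finset.prod_ne_zero_iff.2 fun k _ => hz k,
    fun o => ?_⟩
  change _ * ∏ k, z.1.2 k o = _ * (_ * ∏ k, z.1.2 k o / z.1.2 k (c k))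
  rw [Finset.prod_div_distrib]
  have := Finset.prod_ne_zero_iff.2 fun k (_ : k ∈ Finset.univ) => hz k
  field_simp

variable [Fintype ι]

/-- Monomials of degree `D` in each vector `y_k`, with coefficients regular functions of `a`. -/
def multiMonomials (F : LinFamily N ι) (n D : ℕ) : Set (MultiCone F n → ℂ) :=
  {P | ∃ A ∈ regularFunctions (Ars N), ∃ e : Fin n → ι → ℕ, (∀ k, ∑ o, e k o = D) ∧
    ∀ z, P z = A z.1.1 * ∏ k, ∏ o, z.1.2 k o ^ e k o}

/-- Multihomogeneous functions of degree `D` in each vector `y_k`. -/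
def multiForms (F : LinFamily N ι) (n D : ℕ) : Submodule ℂ (MultiCone F n → ℂ) :=
  Submodule.span ℂ (multiMonomials F n D)

theorem multiForms_mul {D E : ℕ} {P Q : MultiCone F n → ℂ} (hP : P ∈ multiForms F n D)
    (hQ : Q ∈ multiForms F n E) : P * Q ∈ multiForms F n (D + E) := by
  have h := Submodule.mul_mem_mul hP hQ
  rw [multiForms, multiForms, Submodule.span_mul_span] at h
  refine Submodule.span_mono ?_ h
  rintro _ ⟨P, ⟨A, hA, e, he, hP⟩, Q, ⟨A', hA', e', he', hQ⟩, rfl⟩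
  refine ⟨A * A', mul_mem hA hA', e + e', fun k => ?_, fun z => ?_⟩
  · simp only [Pi.add_apply, Finset.sum_add_distrib, he, he']
  · simp only [Pi.mul_apply, hP, hQ, Pi.add_apply, pow_add, Finset.prod_mul_distrib]
    ring

theorem base_mem_multiForms {A : Ars N → ℂ} (hA : A ∈ regularFunctions (Ars N)) :
    (fun z => A z.1.1) ∈ multiForms F n 0 :=
  Submodule.subset_span ⟨A, hA, 0, by simp, by simp⟩

theorem multiForms_pow {D : ℕ} {P : MultiCone F n → ℂ} (hP : P ∈ multiForms F n D) (j : ℕ) :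
    P ^ j ∈ multiForms F n (j * D) := by
  induction j with
  | zero =>
    rw [pow_zero, zero_mul]
    exact base_mem_multiForms (one_mem _)
  | succ j ih =>
    rw [pow_succ, Nat.succ_mul]
    exact multiForms_mul ih hP

theorem prod_mem_multiForms (c : Fin n → ι) :
    (fun z => ∏ k, z.1.2 k (c k)) ∈ multiForms F n 1 := by
  classical
  refine Submodule.subset_span ⟨1, one_mem _, fun k => Pi.single (c k) 1, fun k => ?_, fun z => ?_⟩
  · simp
  · rw [Pi.one_apply, one_mul]
    refine Finset.prod_congr rfl fun k _ => ?_
    rw [Finset.prod_eq_single (c k) (fun o _ ho => by simp [ho]) (by simp)]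
    simp

/-- A polynomial in normalized vectors becomes multihomogeneous after multiplication by a power of
∏_k y_{k,c(k)}. Sums are brought to a common degree by further powers of this product. -/
theorem exists_homogenization (c : Fin n → ι) {P : MultiCone F n → ℂ}
    (hP : P ∈ Algebra.adjoin ℂ (Set.range (MultiCone.coord F n))) :
    ∃ D, ∃ P' ∈ multiForms F n D, ∀ z (hz : ∀ k, z.1.2 k (c k) ≠ 0),
      P' z = (∏ k, z.1.2 k (c k)) ^ D * P (z.normalize c hz) := by
  classical
  induction hP using Algebra.adjoin_induction with
  | mem P hP =>
    obtain ⟨i | ⟨k, o⟩, rfl⟩ := hP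
    · exact ⟨0, _, base_mem_multiForms fun a => regularAt_ars i a, fun z hz => by
        rw [pow_zero, one_mul]
        rfl⟩
    -- The homogenization of the coordinate y_{k,o} replaces the k-th factor of ∏_l y_{l,c(l)} by
    -- y_{k,o}, so that it has degree one in every vector.
    · refine ⟨1, _, prod_mem_multiForms (Function.update c k o), fun z hz => ?_⟩
      have : ∀ l, z.1.2 l (Function.update c k o l) =
          z.1.2 l (c l) * (if l = k then z.1.2 k o / z.1.2 k (c k) else 1) := by
        intro l
        by_cases hl : l = k
        · subst hl
          rw [Function.update_self, if_pos rfl, mul_div_cancel₀ _ (hz l)]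
        · rw [Function.update_of_ne hl, if_neg hl, mul_one]
      simp only [this, Finset.prod_mul_distrib, Finset.prod_ite_eq', Finset.mem_univ, if_true,
        pow_one]
      rfl
  | algebraMap r =>
    exact ⟨0, _, base_mem_multiForms (Subalgebra.algebraMap_mem _ r), fun z hz => by
      rw [pow_zero, one_mul]
      rfl⟩
  | add P Q _ _ h1 h2 =>
    obtain ⟨D, P', hP', hP⟩ := h1
    obtain ⟨E, Q', hQ', hQ⟩ := h2
    have h := prod_mem_multiForms (F := F) c
    have hE := multiForms_mul (multiForms_pow h E) hP'
    have hD := multiForms_mul (multiForms_pow h D) hQ'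
    rw [mul_one, add_comm] at hE
    rw [mul_one] at hD
    refine ⟨D + E, _, add_mem hE hD, fun z hz => ?_⟩
    simp only [Pi.add_apply, Pi.mul_apply, Pi.pow_apply, hP z hz, hQ z hz]
    ring
  | mul P Q _ _ h1 h2 =>
    obtain ⟨D, P', hP', hP⟩ := h1
    obtain ⟨E, Q', hQ', hQ⟩ := h2
    refine ⟨D + E, _, multiForms_mul hP' hQ', fun z hz => ?_⟩
    simp only [Pi.mul_apply, hP z hz, hQ z hz]
    ring

open Classical in
theorem sum_act_multiForms {D : ℕ} {P : MultiCone F n → ℂ} (hP : P ∈ multiForms F n D) :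
    ∃ h ∈ regularFunctions (Cone F'), ∀ z, ∑ g, P (MultiCone.act g z) =
      h (MultiCone.toCone hF hF' hn z) := by
  refine (mem_descentAlgebra hF hF' hn (P := fun z => ∑ g, P (MultiCone.act g z))).1 ?_
  induction hP using Submodule.span_induction with
  | mem P hP =>
    obtain ⟨A, hA, e, he, hP⟩ := hP
    simp only [hP]
    exact sum_act_monomial_mem hF hF' hn hA he
  | zero =>
    simp only [Pi.zero_apply, Finset.sum_const_zero]
    exact zero_mem _
  | add P Q _ _ h1 h2 =>
    simp only [Pi.add_apply, Finset.sum_add_distrib]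
    exact add_mem h1 h2
  | smul r P _ h1 =>
    simp only [Pi.smul_apply, smul_eq_mul, ← Finset.mul_sum]
    exact Subalgebra.smul_mem _ h1 r

/-- Functions on the configuration are regular if they are regular functions of tuples of points
of the curves. -/
theorem MultiCone.descends (h1 : 1 ≤ n) :
    Descends (fun z => (MultiCone.toCone hF hF' hn z).proj) := by
  classical
  intro f x hf
  refine Cone.descends_proj f x fun w hw => ?_
  obtain ⟨z, rfl⟩ := MultiCone.toCone_surjective hF hF' hn h1 w
  choose c hc using fun k => Function.ne_iff.1 (z.2 k).1
  obtain ⟨P, hP, Q, hQ, hQz, hPQ⟩ := coordinates_regularAt (hf (z.normalize c hc)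
    ((MultiCone.proj_toCone_normalize hF hF' hn c z hc).trans hw))
  obtain ⟨D, P', hP', eP⟩ := exists_homogenization c hP
  obtain ⟨E, Q', hQ', eQ⟩ := exists_homogenization c hQ
  have hm := prod_mem_multiForms (F := F) c
  -- With these exponents numerator and denominator both have degree D + E + 1. The additional
  -- factor makes both vanish where the normalization is impossible, so the relation holds for all
  -- tuples.
  have hQ'' := multiForms_mul hQ' (multiForms_pow hm (D + 1))
  have hP'' := multiForms_mul hP' (multiForms_pow hm (E + 1))
  refine regularAt_of_averages (π := MultiCone.toCone hF hF' hn) MultiCone.act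
    (MultiCone.toCone_act hF hF' hn) (f := f ∘ Cone.proj) ?_
    (MultiCone.toCone_surjective hF hF' hn h1) 1 ?_
    (fun j => sum_act_multiForms hF hF' hn (multiForms_pow hQ'' (j + 1)))
    (fun j => sum_act_multiForms hF hF' hn (multiForms_mul hP'' (multiForms_pow hQ'' j)))
  · intro y
    simp only [Function.comp_apply, Pi.mul_apply, Pi.pow_apply]
    by_cases hy : ∀ k, y.1.2 k (c k) ≠ 0
    · have h2 := congrFun hPQ (y.normalize c hy)
      rw [Pi.mul_apply, Function.comp_apply, MultiCone.proj_toCone_normalize] at h2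
      rw [eP y hy, eQ y hy, ← h2]
      ring
    · push Not at hy
      obtain ⟨k, hk⟩ := hy
      rw [Finset.prod_eq_zero (Finset.mem_univ k) hk]
      simp
  · have hone : MultiCone.act (1 : SignKernel ι n × Equiv.Perm (Fin n)) z = z :=
      Subtype.ext (Prod.ext rfl (funext fun k => funext fun o => by
        simp [MultiCone.act, signL]))
    have h3 : ∏ k, z.1.2 k (c k) ≠ 0 := Finset.prod_ne_zero_iff.2 fun k _ => hc k
    rw [hone, Pi.mul_apply, Pi.pow_apply, eQ z hc]
    exact mul_ne_zero (mul_ne_zero (pow_ne_zero _ h3) hQz) (pow_ne_zero _ h3)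

end Homogenization

end

end QuadricTwist

/-! ### The isomorphism between the quotient of the fibre power and the weighted family. -/

namespace QuadricTwist

noncomputable section

open SpaceWithFunctions

/-! ### The quotients of fibre powers as configurations -/

section SmulProj

variable {N : ℕ} {ι : Type} [MulAction (W N) ι] {F : LinFamily N ι}

/-- Sign changes on the cone. -/
def Cone.signs (ζ : ι → ℤˣ) (z : Cone F) : Cone F :=
  ⟨(z.1.1, signL ζ z.1.2), fun h => z.2.1 (signL_injective ζ (h.trans (map_zero _).symm)), by
    rw [sq_signL]
    exact z.2.2⟩

/-- Permutations on the cone. -/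
def Cone.perm (w : W N) (z : Cone F) : Cone F :=
  ⟨(w • z.1.1, permL w z.1.2), fun h => z.2.1 (permL_injective w (h.trans (map_zero _).symm)),
    F.perm_mem w _ _ z.2.2⟩

theorem Cone.smul_proj (ζ : ι → ℤˣ) (z : Cone F) :
    (QuotientGroup.mk ζ : I ι) • z.proj = (z.signs ζ).proj := rfl

theorem Cone.perm_proj (w : W N) (z : Cone F) : w • z.proj = (z.perm w).proj := rfl

theorem Cone.proj_eq_of_eq {z z' : Cone F} (ha : z.1.1 = z'.1.1) (hv : ∀ o, z.1.2 o = z'.1.2 o) :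
    z.proj = z'.proj := Cone.proj_eq_iff.2 ⟨ha, 1, one_ne_zero, fun o => by rw [hv, one_mul]⟩

theorem Cone.proj_eq_of_eq_mul {z z' : Cone F} (ha : z.1.1 = z'.1.1) {c : ℂ} (hc : c ≠ 0)
    (h : ∀ o, z.1.2 o = c * z'.1.2 o) : z.proj = z'.proj :=
  (Cone.proj_eq_iff.2 ⟨ha.symm, c, hc, h⟩).symm

theorem exists_sign_of_sq_eq {x y : ℂ} (h : x ^ 2 = y ^ 2) :
    ∃ e : ℤˣ, x = ((e : ℤ) : ℂ) * y := by
  rcases sq_eq_sq_iff_eq_or_eq_neg.1 h with h | h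
  · exact ⟨1, by simp [h]⟩
  · exact ⟨-1, by simp [h]⟩

/-- If no y_k vanishes, the signs are determined and multiply to e by cancellation. If some y_k = 0,
its sign is free and is used to enforce the product; this covers the branch points. -/
theorem exists_signs_prod_eq {n : ℕ} {x y : Fin n → ℂ} (h : ∀ k, x k ^ 2 = y k ^ 2) {e : ℤˣ}
    (he : ∏ k, x k = ((e : ℤ) : ℂ) * ∏ k, y k) :
    ∃ g : Fin n → ℤˣ, (∀ k, x k = ((g k : ℤ) : ℂ) * y k) ∧ ∏ k, g k = e := by
  classical
  choose g hg using fun k => exists_sign_of_sq_eq (h k)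
  by_cases h0 : ∃ k, y k = 0
  · obtain ⟨k, hk⟩ := h0
    refine ⟨g * Pi.mulSingle k (e * ∏ l, g l), fun l => ?_, ?_⟩
    · by_cases hl : l = k
      · subst hl
        rw [hg, hk, mul_zero, mul_zero]
      · rw [hg, Pi.mul_apply, Pi.mulSingle_eq_of_ne hl, mul_one]
    · simp only [Pi.mul_apply, Finset.prod_mul_distrib, Finset.prod_pi_mulSingle',
        Finset.mem_univ, if_true]
      rw [mul_comm e, ← mul_assoc, Int.units_mul_self, one_mul]
  · push Not at h0
    refine ⟨g, hg, ?_⟩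
    have h1 : ∏ k, y k ≠ 0 := Finset.prod_ne_zero_iff.2 fun k _ => h0 k
    rw [Finset.prod_congr rfl fun k _ => hg k, Finset.prod_mul_distrib] at he
    have h2 := mul_right_cancel₀ h1 he
    have h3 : ((∏ k, g k : ℤˣ) : ℤ) = (e : ℤ) := by
      have : (((∏ k, g k : ℤˣ) : ℤ) : ℂ) = ((e : ℤ) : ℂ) := by
        rw [← h2]
        simp
      exact_mod_cast this
    exact Units.ext h3

end SmulProj

section PowerQuot

variable {N : ℕ} {ι : Type} [MulAction (W N) ι] {n : ℕ} {F F' : LinFamily N ι}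

/-- The points of projective space below a tuple of points of the cone. -/
def MultiCone.toPower (z : MultiCone F n) : FibrePower F n :=
  ⟨(z.1.1, fun k => Cone.proj (F := F) ⟨(z.1.1, z.1.2 k), z.2 k⟩), fun _ => rfl⟩

/-- The chosen representatives of a tuple of points. -/
def FibrePower.rep (z : FibrePower F n) : MultiCone F n :=
  ⟨(z.1.1, fun k => (z.1.2 k).1.2.rep), fun k => ⟨(z.1.2 k).1.2.rep_nonzero, by
    have h := (z.1.2 k).2
    have h' : (z.1.2 k).1.1 = z.1.1 := z.2 k
    rwa [h'] at h⟩⟩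

theorem FibrePower.toPower_rep (z : FibrePower F n) : z.rep.toPower = z :=
  Subtype.ext (Prod.ext rfl (funext fun k => Subtype.ext (Prod.ext (z.2 k).symm
    (z.1.2 k).1.2.mk_rep)))

theorem MultiCone.exists_rep_toPower (z : MultiCone F n) :
    ∃ c : Fin n → ℂ, (∀ k, c k ≠ 0) ∧ ∀ k o, z.toPower.rep.1.2 k o = c k * z.1.2 k o := by
  choose c hc h using fun k => Cone.exists_rep_proj (F := F) ⟨(z.1.1, z.1.2 k), z.2 k⟩
  exact ⟨c, hc, h⟩

variable {μ : Marking N ι} (hF : IsCurveFamily μ F) (hF' : IsConfigFamily μ n F') (hn : n < N)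

/-- The map `(a, ([y_k])_k) ↦ (a, [∏_k y_k])`, up to constants. -/
def FibrePower.toConfig (z : FibrePower F n) : SqFamily F' := (z.rep.toCone hF hF' hn).proj

theorem FibrePower.toConfig_toPower (z : MultiCone F n) :
    z.toPower.toConfig hF hF' hn = (z.toCone hF hF' hn).proj := by
  obtain ⟨c, hc, h⟩ := z.exists_rep_toPower
  refine Cone.proj_eq_of_eq_mul (c := ∏ k, c k) rfl
    (Finset.prod_ne_zero_iff.2 fun k _ => hc k) fun o => ?_
  change _ * ∏ k, z.toPower.rep.1.2 k o = _ * (_ * ∏ k, z.1.2 k o)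
  simp only [h, Finset.prod_mul_distrib]
  ring

/-- Sign changes on the cones. -/
def MultiCone.signs (ζ : Fin n → ι → ℤˣ) (z : MultiCone F n) : MultiCone F n :=
  ⟨(z.1.1, fun k => signL (ζ k) (z.1.2 k)), fun k =>
    ⟨fun h => (z.2 k).1 (signL_injective _ (h.trans (map_zero _).symm)), by
      rw [sq_signL]
      exact (z.2 k).2⟩⟩

/-- Permutations of the factors. -/
def MultiCone.reindex (σ : Equiv.Perm (Fin n)) (z : MultiCone F n) : MultiCone F n :=
  ⟨(z.1.1, fun k => z.1.2 (σ k)), fun k => z.2 (σ k)⟩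

/-- The action of the Weyl group on the cones. -/
def MultiCone.perm (w : W N) (z : MultiCone F n) : MultiCone F n :=
  ⟨(w • z.1.1, fun k => permL w (z.1.2 k)), fun k =>
    ⟨fun h => (z.2 k).1 (permL_injective w (h.trans (map_zero _).symm)),
      F.perm_mem w _ _ (z.2 k).2⟩⟩

theorem MultiCone.proj_toCone_signs (ζ : Fin n → ι → ℤˣ) (z : MultiCone F n) :
    ((z.signs ζ).toCone hF hF' hn).proj =
      (QuotientGroup.mk (∏ k, ζ k) : I ι) • (z.toCone hF hF' hn).proj := by
  rw [Cone.smul_proj]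
  refine Cone.proj_eq_of_eq rfl fun o => ?_
  change _ * ∏ k, ((ζ k o : ℤ) : ℂ) * z.1.2 k o = (((∏ k, ζ k) o : ℤ) : ℂ) * (_ * ∏ k, z.1.2 k o)
  rw [Finset.prod_mul_distrib, Finset.prod_apply]
  push_cast
  ring

theorem MultiCone.proj_toCone_reindex (σ : Equiv.Perm (Fin n)) (z : MultiCone F n) :
    ((z.reindex σ).toCone hF hF' hn).proj = (z.toCone hF hF' hn).proj := by
  refine Cone.proj_eq_of_eq rfl fun o => ?_
  change _ * ∏ k, z.1.2 (σ k) o = _ * ∏ k, z.1.2 k o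
  rw [Equiv.prod_comp σ (fun k => z.1.2 k o)]

theorem signRoot_toOption_smul (w : W N) (o : ι) :
    signRoot n (μ.toOption (w • o)) = signRoot n (μ.toOption o) := by
  rw [μ.toOption_smul]
  cases μ.toOption o <;> rfl

theorem MultiCone.proj_toCone_perm (w : W N) (z : MultiCone F n) :
    ((z.perm w).toCone hF hF' hn).proj = w • (z.toCone hF hF' hn).proj := by
  rw [Cone.perm_proj]
  refine Cone.proj_eq_of_eq rfl fun o => ?_
  change signRoot n (μ.toOption o) * ∏ k, z.1.2 k (w⁻¹ • o) =
    signRoot n (μ.toOption (w⁻¹ • o)) * ∏ k, z.1.2 k (w⁻¹ • o)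
  rw [signRoot_toOption_smul]

/-- Equivalent tuples have representatives that differ by signs and a permutation. -/
theorem MultiCone.exists_signs_of_rel {z z' : FibrePower F n} (h : (powerSetoid F n).r z z') :
    ∃ (σ : Equiv.Perm (Fin n)) (ζ : Fin n → ι → ℤˣ),
      (QuotientGroup.mk (∏ k, ζ k) : I ι) = 1 ∧ z' = ((z.rep.reindex σ).signs ζ).toPower := by
  obtain ⟨ha, σ, g, hg, hz⟩ := h
  choose ζ hζ using fun k => QuotientGroup.mk_surjective (g k)
  refine ⟨σ, ζ, ?_, Subtype.ext (Prod.ext ha (funext fun k => ?_))⟩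
  · rw [← hg, ← Finset.prod_congr rfl fun k _ => hζ k]
    exact map_prod (QuotientGroup.mk' (diagSigns ι)) ζ Finset.univ
  · rw [hz k, ← hζ k]
    conv_lhs => rw [← z.toPower_rep]
    rfl

/-- The map `𝒴 → X` induced by the products of the coordinates. -/
def PowerQuot.toConfig : PowerQuot F n → SqFamily F' :=
  Quotient.lift (FibrePower.toConfig hF hF' hn) (by
    intro z z' h
    obtain ⟨σ, ζ, hζ, rfl⟩ := MultiCone.exists_signs_of_rel h
    rw [FibrePower.toConfig_toPower, MultiCone.proj_toCone_signs, hζ, one_smul,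
      MultiCone.proj_toCone_reindex]
    rfl)

theorem PowerQuot.toConfig_mk (z : MultiCone F n) :
    PowerQuot.toConfig hF hF' hn (PowerQuot.mk z.toPower) = (z.toCone hF hF' hn).proj :=
  FibrePower.toConfig_toPower hF hF' hn z

theorem PowerQuot.exists_multiCone (y : PowerQuot F n) :
    ∃ z : MultiCone F n, y = PowerQuot.mk z.toPower := by
  induction y using Quotient.inductionOn with
  | h z => exact ⟨z.rep, by rw [z.toPower_rep]; rfl⟩

theorem PowerQuot.toConfig_base (y : PowerQuot F n) :
    (PowerQuot.toConfig hF hF' hn y).base = y.base := by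
  obtain ⟨z, rfl⟩ := y.exists_multiCone
  rfl

theorem PowerQuot.toConfig_smul (h1 : 1 ≤ n) (g : I ι) (y : PowerQuot F n) :
    PowerQuot.toConfig hF hF' hn (g • y) = g • PowerQuot.toConfig hF hF' hn y := by
  obtain ⟨z, rfl⟩ := y.exists_multiCone
  induction g using QuotientGroup.induction_on with
  | H ζ =>
    have h2 : ∀ ζ : Fin n → ι → ℤˣ, PowerQuot.mk (z.signs ζ).toPower =
        (QuotientGroup.mk (∏ k, ζ k) : I ι) • PowerQuot.mk z.toPower := by
      intro ζ
      have e : (QuotientGroup.mk (∏ k, ζ k) : I ι) = ∏ k, (QuotientGroup.mk (ζ k) : I ι) :=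
        map_prod (QuotientGroup.mk' (diagSigns ι)) ζ Finset.univ
      rw [e, ← PowerQuot.mk_signs h1]
      rfl
    have h3 : ∏ k, (Pi.mulSingle (⟨0, h1⟩ : Fin n) ζ : Fin n → ι → ℤˣ) k = ζ := by
      rw [Finset.prod_pi_mulSingle']
      simp
    rw [← h3, ← h2, PowerQuot.toConfig_mk, PowerQuot.toConfig_mk, MultiCone.proj_toCone_signs]

theorem PowerQuot.toConfig_perm (w : W N) (y : PowerQuot F n) :
    PowerQuot.toConfig hF hF' hn (w • y) = w • PowerQuot.toConfig hF hF' hn y := by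
  obtain ⟨z, rfl⟩ := y.exists_multiCone
  rw [PowerQuot.toConfig_mk, ← MultiCone.proj_toCone_perm, ← PowerQuot.toConfig_mk]
  rfl

theorem PowerQuot.toConfig_surjective (h1 : 1 ≤ n) :
    Function.Surjective (PowerQuot.toConfig (F := F) hF hF' hn) := by
  intro x
  obtain ⟨w, rfl⟩ := Cone.proj_surjective x
  obtain ⟨z, rfl⟩ := MultiCone.toCone_surjective hF hF' hn h1 w
  exact ⟨_, PowerQuot.toConfig_mk hF hF' hn z⟩

/-- Equal images give proportional polynomials ∏(u_k T - t_k), hence the same points of ℙ¹ up to a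
permutation. Over these points the vectors differ by scalars and signs, and comparing the products
shows that in every coordinate the signs multiply to the same e. -/
theorem PowerQuot.toConfig_injective :
    Function.Injective (PowerQuot.toConfig (F := F) hF hF' hn) := by
  intro y y' h
  obtain ⟨z, rfl⟩ := y.exists_multiCone
  obtain ⟨z', rfl⟩ := y'.exists_multiCone
  rw [PowerQuot.toConfig_mk, PowerQuot.toConfig_mk, Cone.proj_eq_iff] at h
  obtain ⟨ha, l, hl, hv⟩ := h
  obtain ⟨⟨a, y⟩, hy⟩ := z
  obtain ⟨⟨a', y'⟩, hy'⟩ := z'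
  replace ha : a = a' := ha
  subst ha
  obtain ⟨t, u, htu⟩ := MultiCone.exists_lin hF ⟨(a, y), hy⟩
  obtain ⟨t', u', htu'⟩ := MultiCone.exists_lin hF ⟨(a, y'), hy'⟩
  have hyl : ∀ k o, y k o ^ 2 = lin a (μ.toOption o) (t k) (u k) := fun k => (htu k).2
  have hyl' : ∀ k o, y' k o ^ 2 = lin a (μ.toOption o) (t' k) (u' k) := fun k => (htu' k).2
  replace hv : ∀ o, prodCoords μ y' o = l * prodCoords μ y o := hv
  have hsym : symCoords t' u' = l ^ 2 • symCoords t u := by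
    refine eq_of_H_eq hn a fun i => ?_
    have e1 := sq_prodCoords hyl (μ.ofFin i)
    have e2 := sq_prodCoords hyl' (μ.ofFin i)
    simp only [sq, hv, mul_pow, μ.toOption_ofFin] at e1 e2
    rw [H_smul, ← e1, e2]
  have hpoly : ∏ k, (Polynomial.C (u' k) * Polynomial.X - Polynomial.C (t' k)) =
      Polynomial.C (l ^ 2) * ∏ k, (Polynomial.C (u k) * Polynomial.X - Polynomial.C (t k)) := by
    rw [← coeffPoly_symCoords, ← coeffPoly_symCoords, hsym, coeffPoly_smul]
  obtain ⟨σ, hσ⟩ := exists_perm_of_prod_linear_eq (fun k => (htu k).1) (fun k => (htu' k).1)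
    (pow_ne_zero 2 hl) hpoly
  choose c hc ht hu using hσ
  -- Rescaling (t_k, u_k) by c_k rescales all squared coordinates, so the vector itself is rescaled
  -- by a square root of c_k, up to signs.
  choose r hr using fun k => IsAlgClosed.exists_pow_nat_eq (c k) two_pos
  have hr0 : ∀ k, r k ≠ 0 := fun k h0 => hc k (by rw [← hr k, h0]; norm_num)
  have hlin : ∀ k o, y' k o ^ 2 = (r k * y (σ k) o) ^ 2 := by
    intro k o
    rw [mul_pow, hyl, hyl', hr, ht, hu]
    cases μ.toOption o with
    | none => rfl
    | some i =>
      simp only [lin, Option.elim]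
      ring
  have hprodc : ∏ k, c k = l ^ 2 := by
    have h2 : ∏ k, (Polynomial.C (u' k) * Polynomial.X - Polynomial.C (t' k)) =
        Polynomial.C (∏ k, c k) *
          ∏ k, (Polynomial.C (u k) * Polynomial.X - Polynomial.C (t k)) := by
      rw [← Equiv.prod_comp σ (fun k => Polynomial.C (u k) * Polynomial.X - Polynomial.C (t k)),
        map_prod, ← Finset.prod_mul_distrib]
      refine Finset.prod_congr rfl fun k _ => ?_
      rw [ht, hu, Polynomial.C_mul, Polynomial.C_mul]
      ring
    rw [hpoly] at h2
    have h3 : ∏ k, (Polynomial.C (u k) * Polynomial.X - Polynomial.C (t k)) ≠ 0 :=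
      Finset.prod_ne_zero_iff.2 fun k _ => linear_ne_zero (htu k).1
    exact (Polynomial.C_injective (mul_right_cancel₀ h3 h2)).symm
  have hle : l ^ 2 = (∏ k, r k) ^ 2 := by
    rw [← hprodc, ← Finset.prod_pow]
    exact Finset.prod_congr rfl fun k _ => (hr k).symm
  -- Since l and ∏ r_k are both square roots of ∏ c_k, they differ by a sign e. It does not depend
  -- on the coordinate o, so the product of the sign vectors is diagonal and trivial in I.
  obtain ⟨e, he⟩ := exists_sign_of_sq_eq hle
  have hprod : ∀ o, ∏ k, y' k o = ((e : ℤ) : ℂ) * ∏ k, r k * y (σ k) o := by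
    intro o
    refine mul_left_cancel₀ (signRoot_ne_zero n (μ.toOption o)) ((hv o).trans ?_)
    rw [he, prodCoords, Finset.prod_mul_distrib, Equiv.prod_comp σ (fun k => y k o)]
    ring
  choose ζ hζ hζe using fun o => exists_signs_prod_eq (fun k => hlin k o) (hprod o)
  refine Quotient.sound ⟨rfl, σ, fun k => QuotientGroup.mk (fun o => ζ o k), ?_, fun k => ?_⟩
  · have h4 : ∏ k, (QuotientGroup.mk (fun o => ζ o k) : I ι) =
        QuotientGroup.mk (∏ k, fun o => ζ o k) :=
      (map_prod (QuotientGroup.mk' (diagSigns ι)) (fun k o => ζ o k) Finset.univ).symm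
    rw [h4]
    refine (QuotientGroup.eq_one_iff _).2 (mem_diagSigns.2 ⟨e, fun o => ?_⟩)
    rw [Finset.prod_apply, hζe]
  · refine Cone.proj_eq_of_eq_mul (F := F) (z := ⟨(a, y' k), hy' k⟩)
      (z' := Cone.signs (fun o => ζ o k) ⟨(a, y (σ k)), hy (σ k)⟩) rfl (hr0 k) fun o => ?_
    change y' k o = r k * (((ζ o k : ℤ) : ℂ) * y (σ k) o)
    rw [hζ]
    ring

/-- The bijection between `𝒴` and the family of configurations. -/
def PowerQuot.equivConfig (h1 : 1 ≤ n) : PowerQuot F n ≃ SqFamily F' :=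
  Equiv.ofBijective (PowerQuot.toConfig hF hF' hn)
    ⟨PowerQuot.toConfig_injective hF hF' hn, PowerQuot.toConfig_surjective hF hF' hn h1⟩

theorem MultiCone.regMapAt_toPower (z : MultiCone F n) :
    RegMapAt (instSpaceWithFunctionsMultiCone F n) (instSpaceWithFunctionsFibrePower F n)
      MultiCone.toPower z := by
  refine regMapAt_subtype (Y := Ars N × (Fin n → SqFamily F)) (regMapAt_prod ?_ ?_)
  · exact regMapAt_ars fun i => MultiCone.coord_mem F n (Sum.inl i) z
  · refine regMapAt_pi fun k => ?_
    exact regMapAt_sqFamily (v := fun z : MultiCone F n => z.1.2 k)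
      (fun i => MultiCone.coord_mem F n (Sum.inl i) z)
      (fun o => MultiCone.coord_mem F n (Sum.inr (k, o)) z) (z.2 k).1 fun _ _ => rfl

theorem MultiCone.regMapAt_mk (z : MultiCone F n) :
    RegMapAt (instSpaceWithFunctionsMultiCone F n) (instSpaceWithFunctionsPowerQuot F n)
      (fun z => PowerQuot.mk z.toPower) z :=
  RegMapAt.comp (regMapAt_push_map (π := Quotient.mk (powerSetoid F n)) _)
    (MultiCone.regMapAt_toPower z)

theorem FibrePower.regMapAt_base (z : FibrePower F n) :
    RegMapAt (instSpaceWithFunctionsFibrePower F n) (instSpaceWithFunctionsArs N)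
      (fun z => z.1.1) z :=
  RegMapAt.comp (regMapAt_fst _) (regMapAt_subtype_val (X := Ars N × (Fin n → SqFamily F)) z)

theorem FibrePower.regMapAt_component (k : Fin n) (z : FibrePower F n) :
    RegMapAt (instSpaceWithFunctionsFibrePower F n) (instSpaceWithFunctionsSqFamily F)
      (fun z => z.1.2 k) z :=
  RegMapAt.comp (regMapAt_eval k _) (RegMapAt.comp (regMapAt_snd _)
    (regMapAt_subtype_val (X := Ars N × (Fin n → SqFamily F)) z))

theorem FibrePower.regMapAt_toConfig (z : FibrePower F n) :
    RegMapAt (instSpaceWithFunctionsFibrePower F n) (instSpaceWithFunctionsSqFamily F')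
      (FibrePower.toConfig hF hF' hn) z := by
  choose c hc using fun k => Function.ne_iff.1 (z.1.2 k).1.2.rep_nonzero
  have hreg : ∀ k o, (instSpaceWithFunctionsFibrePower F n).RegularAt
      (fun z => (z.1.2 k).1.2.rep o / (z.1.2 k).1.2.rep (c k)) z := fun k o =>
    FibrePower.regMapAt_component k z _ (regularAt_sqFamily_ratio F o (c k) (hc k))
  refine regMapAt_sqFamily (v := fun z : FibrePower F n => prodCoords μ
      fun k o => (z.1.2 k).1.2.rep o / (z.1.2 k).1.2.rep (c k))
    (fun i => FibrePower.regMapAt_base z _ (regularAt_ars i _)) (fun o => ?_) ?_ fun w hw => ?_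
  · have : (fun w : FibrePower F n => prodCoords μ
        (fun k o => (w.1.2 k).1.2.rep o / (w.1.2 k).1.2.rep (c k)) o) =
        signRoot n (μ.toOption o) •
          ∏ k, fun w : FibrePower F n => (w.1.2 k).1.2.rep o / (w.1.2 k).1.2.rep (c k) := by
      funext w
      simp [prodCoords]
    rw [this]
    exact Subalgebra.smul_mem (regularFunctionsAt _ z) (prod_mem fun k _ => hreg k o) _
  · exact ((z.rep.normalize c hc).toCone hF hF' hn).2.1
  -- Division by zero gives zero: if one chosen coordinate vanished at w, all the products would
  -- vanish.
  · have hcw : ∀ k, (w.1.2 k).1.2.rep (c k) ≠ 0 := by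
      intro k h0
      refine hw (funext fun o => ?_)
      simp only [prodCoords]
      rw [Finset.prod_eq_zero (Finset.mem_univ k) (by rw [h0, div_zero]), mul_zero]
      rfl
    exact congrArg (fun x : SqFamily F' => x.1.2)
      (MultiCone.proj_toCone_normalize hF hF' hn c w.rep hcw).symm

theorem PowerQuot.regMapAt_toConfig (y : PowerQuot F n) :
    RegMapAt (instSpaceWithFunctionsPowerQuot F n) (instSpaceWithFunctionsSqFamily F')
      (PowerQuot.toConfig hF hF' hn) y :=
  regMapAt_push (π := Quotient.mk (powerSetoid F n)) (FibrePower.regMapAt_toConfig hF hF' hn) y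

/-- The cones over tuples map regularly to the quotient, and the composite to the configuration is
the product map, along which regularity descends by averaging. -/
theorem PowerQuot.isIsomorphism_equivConfig [Fintype ι] (h1 : 1 ≤ n) :
    IsIsomorphism (PowerQuot.equivConfig (F := F) hF hF' hn h1) := by
  refine isIsomorphism_of_descends (PowerQuot.regMapAt_toConfig hF hF' hn)
    MultiCone.regMapAt_mk ?_
  have : (PowerQuot.equivConfig (F := F) hF hF' hn h1) ∘ (fun z => PowerQuot.mk z.toPower) =
      fun z => (MultiCone.toCone hF hF' hn z).proj :=
    funext fun z => PowerQuot.toConfig_mk hF hF' hn z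
  rw [this]
  exact MultiCone.descends hF hF' hn h1

end PowerQuot

end

end QuadricTwist

/-! ### The concrete families, and the quotients by the sign of the last coordinate. -/

namespace QuadricTwist

noncomputable section

open SpaceWithFunctions

/-! ### The families of the theorem -/

section Concrete

variable {N m n : ℕ}

/-- The marking of the indices `1, …, N`. -/
def finMarking (N : ℕ) : Marking N (Fin N) := ⟨some, id, fun _ => rfl, fun _ _ => rfl⟩

/-- The marking of the indices `1, …, N + 1`. -/
def optionMarking (N : ℕ) : Marking N (Option (Fin N)) := ⟨id, some, fun _ => rfl, fun _ _ => rfl⟩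

theorem isCurveFamily_curveFamily (N : ℕ) : IsCurveFamily (finMarking N) (curveFamily N) :=
  fun _ _ => Iff.rfl

theorem isCurveFamily_curveFamilyTilde (N : ℕ) :
    IsCurveFamily (optionMarking N) (curveFamilyTilde N) := fun a q => by
  refine exists_congr fun t => exists_congr fun u => ⟨fun h o => ?_, fun h => ?_⟩
  · cases o with
    | none => exact h.2
    | some i => exact h.1 i
  · exact ⟨fun i => h (some i), h none⟩

theorem isConfigFamily_quadFamily (hN : Odd N) (hmn : N = m + n + 1) :
    IsConfigFamily (finMarking N) n (quadFamily (N := N) (fun a j => (d a j)⁻¹) d_inv_smul m) :=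
  mem_quadFamily_iff hN hmn

theorem isConfigFamily_VTilde' (hN : Odd N) (hmn : N = m + n + 1) :
    IsConfigFamily (optionMarking N) n (VTilde' N m) := mem_VTilde'_iff hN hmn

end Concrete

section Covers

variable {N m n : ℕ} {hF : IsCurveFamily (optionMarking N) (curveFamilyTilde N)}
  {hF' : IsConfigFamily (optionMarking N) n (VTilde' N m)} {hn : n < N} {h1 : 1 ≤ n}

theorem coversConfigurations_symm :
    CoversConfigurations (PowerQuot.equivConfig hF hF' hn h1).symm := by
  intro x z hx t u htu
  have h2 : x = (z.rep.toCone hF hF' hn).proj := (Equiv.symm_apply_eq _).1 hx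
  obtain ⟨c, hc, h⟩ := (z.rep.toCone hF hF' hn).exists_rep_proj
  refine ⟨c ^ 2, pow_ne_zero 2 hc, fun o => ?_⟩
  rw [h2, h, mul_pow]
  refine congrArg (c ^ 2 * ·) (sq_prodCoords (μ := optionMarking N) (a := z.1.1)
    (y := fun k => (z.1.2 k).1.2.rep) (fun k o => ?_) o)
  cases o with
  | none => exact (htu k).2
  | some i => exact (htu k).1 i

end Covers

/-! ### Forgetting the last coordinate -/

section Forget

variable {N n : ℕ} {F' G' : LinFamily N (Option (Fin N))} {F G : LinFamily N (Fin N)}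

/-- Forgetting the last coordinate on cones. -/
def Cone.forget (h : Forgets F' F) (z : Cone F') : Cone F :=
  ⟨(z.1.1, fun i => z.1.2 (some i)), h.ne_zero z.2.1 z.2.2, h.mem _ _ z.2.2⟩

theorem Cone.forget_proj (h : Forgets F' F) (z : Cone F') :
    QuadricTwist.forget h z.proj = (z.forget h).proj :=
  Subtype.ext (forget_mk h z.1.1 z.1.2 z.2.1 _)

theorem regMapAt_forget (h : Forgets F' F) (x : SqFamily F') :
    RegMapAt (instSpaceWithFunctionsSqFamily F') (instSpaceWithFunctionsSqFamily F)
      (forget h) x := by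
  refine regMapAt_of_cone fun z _ => ?_
  rw [show forget h ∘ Cone.proj = Cone.proj ∘ Cone.forget h from funext (Cone.forget_proj h)]
  refine RegMapAt.comp (Cone.regMapAt_proj _) (regMapAt_coordinates fun k => ?_)
  rcases k with i | i
  · exact Cone.coord_mem (Sum.inl i) z
  · exact Cone.coord_mem (Sum.inr (some i)) z

/-- Coordinates are multiplied separately, with the same constants at the first N indices for both
markings, so omitting the last coordinate commutes with the product map. -/
theorem toConfig_forgetPower (h : Forgets F' F) (k : Forgets G' G)
    (hF' : IsCurveFamily (optionMarking N) F') (hF : IsCurveFamily (finMarking N) F)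
    (hG' : IsConfigFamily (optionMarking N) n G') (hG : IsConfigFamily (finMarking N) n G)
    (hn : n < N) (y : PowerQuot F' n) :
    PowerQuot.toConfig hF hG hn (forgetPower h n y) =
      forget k (PowerQuot.toConfig hF' hG' hn y) := by
  obtain ⟨z, rfl⟩ := y.exists_multiCone
  let z' : MultiCone F n := ⟨(z.1.1, fun k i => z.1.2 k (some i)), fun k =>
    (Cone.forget h ⟨(z.1.1, z.1.2 k), z.2 k⟩).2⟩
  have e : forgetPower h n (PowerQuot.mk z.toPower) = PowerQuot.mk z'.toPower :=
    congrArg PowerQuot.mk (Subtype.ext (Prod.ext rfl (funext fun k =>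
      Cone.forget_proj h ⟨(z.1.1, z.1.2 k), z.2 k⟩)))
  rw [e, PowerQuot.toConfig_mk, PowerQuot.toConfig_mk, Cone.forget_proj]
  exact Cone.proj_eq_of_eq rfl fun _ => rfl

/-- A family in which the last coordinate is a function of the others. -/
def IsGraph (L : Ars N → (Fin N → ℂ) → ℂ) (F' : LinFamily N (Option (Fin N)))
    (F : LinFamily N (Fin N)) : Prop :=
  ∀ a q, q ∈ F'.E a ↔ (fun i => q (some i)) ∈ F.E a ∧ q none = L a (fun i => q (some i))

theorem mk_last_smul_proj {z z' : Cone F'} {c : ℂ} (hc : c ≠ 0) (ha : z'.1.1 = z.1.1)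
    (hv : ∀ i, z'.1.2 (some i) = c * z.1.2 (some i)) (e : ℤˣ)
    (hl : z'.1.2 none = ((e : ℤ) : ℂ) * (c * z.1.2 none)) :
    (QuotientGroup.mk (fun o => o.elim e (fun _ => 1)) : I (Option (Fin N))) • z.proj =
      z'.proj := by
  rw [Cone.smul_proj]
  refine Cone.proj_eq_iff.2 ⟨ha.symm, c, hc, fun o => ?_⟩
  cases o with
  | none =>
    refine hl.trans ?_
    simp only [Cone.signs, signL, LinearMap.coe_mk, AddHom.coe_mk, Option.elim]
    ring
  | some i =>
    refine (hv i).trans ?_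
    simp [Cone.signs, signL]

theorem forget_lastSign_zpow (h : Forgets F' F) (k : ℤ) (x : SqFamily F') :
    forget h ((lastSign N ^ k) • x) = forget h x := by
  have : forgetI N (lastSign N) = 1 := rfl
  rw [forget_smul, map_zpow, this, one_zpow, one_smul]

theorem mem_zpowers_lastSign (e : ℤˣ) :
    (QuotientGroup.mk (fun o => o.elim e (fun _ => 1)) : I (Option (Fin N))) ∈
      Subgroup.zpowers (lastSign N) := by
  rcases Int.units_eq_one_or e with rfl | rfl
  · have : (QuotientGroup.mk (fun o => o.elim 1 (fun _ => 1)) : I (Option (Fin N))) = 1 :=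
      congrArg QuotientGroup.mk (funext fun o => by cases o <;> rfl)
    rw [this]
    exact one_mem _
  · exact Subgroup.mem_zpowers _

variable {L : Ars N → (Fin N → ℂ) → ℂ}

/-- The square of the last coordinate is a homogeneous function of the other squares. Once the other
coordinates agree up to a scalar, only the sign of the last one is left. -/
theorem exists_smul_of_forget_eq (hL : IsGraph L F' F)
    (hLs : ∀ a c q, L a (fun i => c * q i) = c * L a q) (h : Forgets F' F) {x y : SqFamily F'}
    (hxy : forget h x = forget h y) : ∃ g ∈ Subgroup.zpowers (lastSign N), g • x = y := by
  obtain ⟨z, rfl⟩ := Cone.proj_surjective x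
  obtain ⟨z', rfl⟩ := Cone.proj_surjective y
  rw [Cone.forget_proj, Cone.forget_proj, Cone.proj_eq_iff] at hxy
  obtain ⟨ha, c, hc, hv⟩ := hxy
  have hsq : z'.1.2 none ^ 2 = (c * z.1.2 none) ^ 2 := by
    have e1 := ((hL _ _).1 z.2.2).2
    have e2 := ((hL _ _).1 z'.2.2).2
    have ha' : z'.1.1 = z.1.1 := ha.symm
    have hv' : ∀ i, z'.1.2 (some i) = c * z.1.2 (some i) := hv
    simp only [sq, hv', mul_pow, hLs, ha'] at e1 e2
    rw [e2, mul_pow, e1]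
  obtain ⟨e, he⟩ := exists_sign_of_sq_eq hsq
  exact ⟨_, mem_zpowers_lastSign e, mk_last_smul_proj hc ha.symm hv e he⟩

/-- The lift of a point of the cone given by a square root. -/
def lastRoot (hL : IsGraph L F' F)
    (z : SqrtCover (fun (_ : Unit) (b : Cone F) => L b.1.1 (sq b.1.2))) : Cone F' :=
  ⟨(z.1.1.1.1, fun o => o.elim (z.1.2 ()) z.1.1.1.2), fun h0 => z.1.1.2.1
    (funext fun i => congrFun h0 (some i)), (hL _ _).2 ⟨z.1.1.2.2, z.2 ()⟩⟩

/-- On cones, forgetting ε is the cover adjoining a square root of the regular function L(v²). The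
orbit space maps bijectively because such roots exist and are unique up to sign; regularity descends
through the root and then through the cone. -/
theorem isLastSignQuotient_forget (hL : IsGraph L F' F)
    (hLs : ∀ a c q, L a (fun i => c * q i) = c * L a q)
    (hLr : (fun b : Cone F => L b.1.1 (sq b.1.2)) ∈ regularFunctions (Cone F))
    (h : Forgets F' F) : IsLastSignQuotient (N := N) (forget h) := by
  have hr : ∀ z, forget h (lastRoot hL z).proj = z.1.1.proj := fun z => Cone.forget_proj h _
  let p : Quotient (MulAction.orbitRel (Subgroup.zpowers (lastSign N)) (SqFamily F')) →
      SqFamily F := Quotient.lift (forget h) (by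
    rintro x y ⟨⟨_, k, rfl⟩, rfl⟩
    exact forget_lastSign_zpow h k y)
  have hp : Function.Bijective p := by
    constructor
    · intro x y
      induction x using Quotient.inductionOn with
      | h x =>
        induction y using Quotient.inductionOn with
        | h y =>
          intro hxy
          obtain ⟨g, hg, rfl⟩ := exists_smul_of_forget_eq hL hLs h hxy
          exact (Quotient.sound (s := MulAction.orbitRel _ _)
            (show g • x ∈ MulAction.orbit _ x from ⟨⟨g, hg⟩, rfl⟩)).symm
    · intro y
      obtain ⟨b, rfl⟩ := Cone.proj_surjective y
      obtain ⟨z, rfl⟩ := SqrtCover.surjective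
        (fun (_ : Unit) (b : Cone F) => L b.1.1 (sq b.1.2)) b
      exact ⟨Quotient.mk _ (lastRoot hL z).proj, hr z⟩
  refine ⟨Equiv.ofBijective p hp, ?_, fun x => rfl⟩
  let : SpaceWithFunctions (SqrtCover (fun (_ : Unit) (b : Cone F) => L b.1.1 (sq b.1.2))) :=
    coordinates (SqrtCover.coord (Cone.coord F) _)
  refine isIsomorphism_of_descends (q := fun z => Quotient.mk _ (lastRoot hL z).proj)
    (regMapAt_push (π := Quotient.mk _) (regMapAt_forget h)) (fun z => ?_) ?_
  · refine RegMapAt.comp (regMapAt_push_map (π := Quotient.mk _) _)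
      (RegMapAt.comp (Cone.regMapAt_proj _) (regMapAt_coordinates fun k => ?_))
    rcases k with i | o
    · exact coordinates_regular (e := SqrtCover.coord (Cone.coord F) _) (Sum.inl (Sum.inl i)) z
    · cases o with
      | none => exact coordinates_regular (e := SqrtCover.coord (Cone.coord F) _) (Sum.inr ()) z
      | some i =>
        exact coordinates_regular (e := SqrtCover.coord (Cone.coord F) _) (Sum.inl (Sum.inr i)) z
  · rw [show Equiv.ofBijective p hp ∘ (fun z => Quotient.mk _ (lastRoot hL z).proj) =
      Cone.proj ∘ fun z => z.1.1 from funext hr]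
    exact Cone.descends_proj.comp (SqrtCover.descends fun _ => hLr)

theorem d_mem_regularFunctions (j : Fin N) :
    (fun a : Ars N => d a j) ∈ regularFunctions (Ars N) := by
  have : (fun a : Ars N => d a j) =
      ∏ i ∈ Finset.univ.erase j, ((fun a : Ars N => a.1 i) - fun a => a.1 j) := by
    funext a
    rw [Finset.prod_apply]
    rfl
  rw [this]
  exact prod_mem fun i _ => sub_mem (fun a => regularAt_ars i a) (fun a => regularAt_ars j a)

theorem Cone.d_mem_regularFunctions {ι : Type} [MulAction (W N) ι] (F : LinFamily N ι)
    (j : Fin N) : (fun b : Cone F => d b.1.1 j) ∈ regularFunctions (Cone F) := fun b =>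
  Cone.regMapAt_base b _ (QuadricTwist.d_mem_regularFunctions j _)

theorem isLastSignQuotient_forget_X' (N m : ℕ) :
    IsLastSignQuotient (N := N) (forget (forgets_X' N m)) := by
  refine isLastSignQuotient_forget (L := fun a q => ∑ j, a.1 j ^ m * (d a j)⁻¹ * q j)
    (fun a q => ?_) (fun a c q => ?_) ?_ _
  · exact and_congr Iff.rfl (sub_eq_zero.trans eq_comm)
  · rw [Finset.mul_sum]
    exact Finset.sum_congr rfl fun j _ => by ring
  · generalize quadFamily (N := N) (fun a j => (d a j)⁻¹) d_inv_smul m = F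
    have : (fun b : Cone F => ∑ j, b.1.1.1 j ^ m * (d b.1.1 j)⁻¹ * sq b.1.2 j) =
        ∑ j, Cone.coord F (Sum.inl j) ^ m * (fun b : Cone F => d b.1.1 j)⁻¹ *
          Cone.coord F (Sum.inr j) ^ 2 := by
      funext b
      rw [Finset.sum_apply]
      rfl
    rw [this]
    exact sum_mem fun j _ => mul_mem (mul_mem (pow_mem (Cone.coord_mem _) _)
      (inv_mem_regularFunctions (Cone.d_mem_regularFunctions F j) fun b => d_ne_zero _ _))
      (pow_mem (Cone.coord_mem _) _)

end Forget

/-- Quotients by the last sign can be transported along equivariant isomorphisms. -/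
theorem IsLastSignQuotient.transport {N : ℕ} {X X₂ Y Y₂ : Type} [sX : SpaceWithFunctions X]
    [sX₂ : SpaceWithFunctions X₂] [SpaceWithFunctions Y] [SpaceWithFunctions Y₂] [IsGood sX]
    [IsGood sX₂] [MulAction (I (Option (Fin N))) X]
    [MulAction (I (Option (Fin N))) X₂] {p : X → Y} {p₂ : X₂ → Y₂}
    (h : IsLastSignQuotient (N := N) p) {ψ : X ≃ X₂} {χ : Y ≃ Y₂} (hψ : IsIsomorphism ψ)
    (hχ : IsIsomorphism χ) (hsmul : ∀ (g : I (Option (Fin N))) x, ψ (g • x) = g • ψ x)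
    (hp : ∀ x, χ (p x) = p₂ (ψ x)) : IsLastSignQuotient (N := N) p₂ := by
  obtain ⟨e, he, hep⟩ := h
  let q : Quotient (MulAction.orbitRel (Subgroup.zpowers (lastSign N)) X) ≃
      Quotient (MulAction.orbitRel (Subgroup.zpowers (lastSign N)) X₂) :=
    Quotient.congr ψ fun x y => by
      refine exists_congr fun g => ?_
      change g.1 • y = x ↔ g.1 • ψ y = ψ x
      rw [← hsmul, ψ.apply_eq_iff_eq]
  have hq : IsIsomorphism q := by
    refine ⟨isMorphism_iff.2 (regMapAt_push (π := Quotient.mk _) fun x => ?_),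
      isMorphism_iff.2 (regMapAt_push (π := Quotient.mk _) fun x => ?_)⟩
    · exact RegMapAt.comp (φ := ψ) (regMapAt_push_map (π := Quotient.mk _) _)
        (isMorphism_iff.1 hψ.1 x)
    · exact RegMapAt.comp (φ := ψ.symm) (regMapAt_push_map (π := Quotient.mk _) _)
        (isMorphism_iff.1 hψ.2 x)
  refine ⟨q.symm.trans (e.trans χ), hq.symm.trans (he.trans hχ), fun x => ?_⟩
  obtain ⟨x, rfl⟩ := ψ.surjective x
  have : q.symm (Quotient.mk _ (ψ x)) = Quotient.mk _ x := q.symm_apply_eq.2 rfl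
  rw [Equiv.trans_apply, this, Equiv.trans_apply, hep, hp]

end

end QuadricTwist

/-! ### Part 3 of the theorem: trivialization of the bundle by binary forms. -/

namespace QuadricTwist

noncomputable section

open SpaceWithFunctions

/-! ### The equivalence of hyperplane configurations -/

section HyperplaneConfigurations

variable {N m n : ℕ}

theorem coeff_interpolate_H (hn : n < N) (a : Ars N) (x : Fin (n + 1) → ℂ) (j : Fin (n + 1)) :
    (Lagrange.interpolate Finset.univ a.1 (fun i => H a (some i) x)).coeff j = x j := by
  rw [← coeffPoly_eq_interpolate hn, coeff_coeffPoly]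

/-- The isomorphism of the trivial bundle `ℂ^{n+1} × 𝔞^{rs}` with `Ṽ'_m`. -/
def configEquiv (hN : Odd N) (hmn : N = m + n + 1) :
    (Ars N × (Fin (n + 1) → ℂ)) ≃ VectorBundle (VTilde' N m) where
  toFun p := ⟨(p.1, fun o => H p.1 o p.2), (mem_VTilde'_iff hN hmn _ _).2 ⟨p.2, fun _ => rfl⟩⟩
  invFun p := (p.1.1, fun j =>
    (Lagrange.interpolate Finset.univ p.1.1.1 (fun i => p.1.2 (some i))).coeff j)
  left_inv p := Prod.ext rfl (funext (coeff_interpolate_H (by omega) p.1 p.2))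
  right_inv := by
    rintro ⟨⟨a, q⟩, hq⟩
    obtain ⟨x, hx⟩ := (mem_VTilde'_iff hN hmn _ _).1 hq
    obtain rfl : q = fun o => H a o x := funext hx
    refine Subtype.ext (Prod.ext rfl (funext fun o => ?_))
    exact congrArg (H a o) (funext (coeff_interpolate_H (by omega) a x))

theorem isIsomorphism_configEquiv (hN : Odd N) (hmn : N = m + n + 1) :
    IsIsomorphism (configEquiv (m := m) (n := n) hN hmn) := by
  refine ⟨isMorphism_iff.2 fun p => ?_, isMorphism_iff.2 fun p => ?_⟩
  · refine regMapAt_subtype (Y := Ars N × (Option (Fin N) → ℂ))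
      (regMapAt_prod (regMapAt_fst p) (regMapAt_affine fun o => ?_))
    have hx : ∀ j, prod.RegularAt (fun p : Ars N × (Fin (n + 1) → ℂ) => p.2 j) p := fun j =>
      regMapAt_snd p _ (affine_regularAt_coord j _)
    cases o with
    | none => exact hx (Fin.last n)
    | some i =>
      have : (fun p : Ars N × (Fin (n + 1) → ℂ) => H p.1 (some i) p.2) =
          ∑ j : Fin (n + 1), (fun p => p.1.1 i) ^ (j : ℕ) * fun p => p.2 j := by
        funext p
        rw [Finset.sum_apply]
        rfl
      change prod.RegularAt (fun p : Ars N × (Fin (n + 1) → ℂ) => H p.1 (some i) p.2) p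
      rw [this]
      have hi : (fun p : Ars N × (Fin (n + 1) → ℂ) => p.1.1 i) ∈ regularFunctionsAt prod p :=
        regMapAt_fst p _ (regularAt_ars i _)
      exact (regularFunctionsAt prod p).sum_mem fun j _ => mul_mem (pow_mem hi _) (hx j)
  · have hfst : ∀ p : VectorBundle (VTilde' N m), RegMapAt
        (instSpaceWithFunctionsVectorBundle (VTilde' N m)) (instSpaceWithFunctionsArs N)
        (fun p => p.1.1) p := fun p =>
      RegMapAt.comp (regMapAt_fst _)
        (regMapAt_subtype_val (X := Ars N × (Option (Fin N) → ℂ)) p)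
    refine regMapAt_prod (hfst p) (regMapAt_affine fun j => ?_)
    refine CoeffsIn.interpolate (A := regularFunctions (VectorBundle (VTilde' N m)))
      (a := fun p => p.1.1) (q := fun p i => p.1.2 (some i))
      (fun i p => hfst p _ (regularAt_ars i _))
      (fun _ _ hij p => hfst p _ (inv_sub_mem_regularFunctions hij _)) (fun i p => ?_) j p
    exact RegMapAt.comp (regMapAt_snd _)
      (regMapAt_subtype_val (X := Ars N × (Option (Fin N) → ℂ)) p) _
      (affine_regularAt_coord (some i) _)

end HyperplaneConfigurations

end

end QuadricTwist

/-! ### Square roots of the weights 1/d_j on the torsor, and their behaviour under signs and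
permutations. -/

namespace QuadricTwist

noncomputable section

open SpaceWithFunctions

/-! ### The twisting functions -/

section Delta

variable {N : ℕ}

/-- A square root of `∏_i d_i`: a multiple of the Vandermonde determinant. -/
def delta (a : Ars N) : ℂ :=
  (∏ i : Fin N, Complex.I ^ (Finset.Ioi i).card) * (Matrix.vandermonde a.1).det

/-- Each unordered pair {i, j} contributes (a_j - a_i)(a_i - a_j) = -(a_j - a_i)², which gives the
squared Vandermonde product and one sign for each pair. -/
theorem prod_d (a : Ars N) : ∏ i, d a i =
    (∏ i : Fin N, (-1) ^ (Finset.Ioi i).card) * (∏ i, ∏ j ∈ Finset.Ioi i, (a.1 j - a.1 i)) ^ 2 := by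
  have h1 : ∀ i, d a i =
      (∏ j ∈ Finset.Ioi i, (a.1 j - a.1 i)) * ∏ j ∈ Finset.Iio i, (a.1 j - a.1 i) := by
    intro i
    rw [← Finset.prod_union (Finset.disjoint_left.2 fun j hj hj' =>
      lt_asymm (Finset.mem_Ioi.1 hj) (Finset.mem_Iio.1 hj'))]
    refine Finset.prod_congr (Finset.ext fun j => ?_) fun _ _ => rfl
    simp only [Finset.mem_erase, Finset.mem_univ, and_true, Finset.mem_union, Finset.mem_Ioi,
      Finset.mem_Iio]
    exact lt_or_lt_iff_ne.symm.trans or_comm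
  have h2 : ∏ i : Fin N, ∏ j ∈ Finset.Iio i, (a.1 j - a.1 i) =
      ∏ i : Fin N, ∏ j ∈ Finset.Ioi i, (a.1 i - a.1 j) :=
    Finset.prod_comm' (by simp)
  rw [Finset.prod_congr rfl fun i _ => h1 i, Finset.prod_mul_distrib, h2, pow_two,
    mul_left_comm, ← Finset.prod_mul_distrib (f := fun i : Fin N => (-1 : ℂ) ^ _)]
  congr 1
  refine Finset.prod_congr rfl fun i _ => ?_
  rw [← Finset.prod_neg]
  exact Finset.prod_congr rfl fun j _ => (neg_sub _ _).symm

theorem delta_sq (a : Ars N) : delta a ^ 2 = ∏ i, d a i := by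
  rw [prod_d, delta, mul_pow, Matrix.det_vandermonde, ← Finset.prod_pow]
  congr 1
  refine Finset.prod_congr rfl fun i _ => ?_
  rw [← pow_mul, mul_comm, pow_mul, Complex.I_sq]

theorem delta_ne_zero (a : Ars N) : delta a ≠ 0 := fun h => by
  have h1 := delta_sq a
  rw [h, zero_pow two_ne_zero] at h1
  exact Finset.prod_ne_zero_iff.2 (fun i _ => d_ne_zero a i) h1.symm

/-- A permutation of the rows multiplies the Vandermonde determinant by its sign. This is where the
factor sgn(w) of the action through SO_N originates. -/
theorem delta_smul (w : W N) (a : Ars N) :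
    delta (w • a) = ((Equiv.Perm.sign w : ℤ) : ℂ) * delta a := by
  have h1 : Matrix.vandermonde (w • a).1 = (Matrix.vandermonde a.1).submatrix (w⁻¹ : W N) id := rfl
  rw [delta, delta, h1, Matrix.det_permute, Equiv.Perm.sign_inv]
  ring

theorem delta_mem_regularFunctions : (delta : Ars N → ℂ) ∈ regularFunctions (Ars N) := by
  have : (delta : Ars N → ℂ) = (∏ i : Fin N, Complex.I ^ (Finset.Ioi i).card) •
      ∏ i : Fin N, ∏ j ∈ Finset.Ioi i, ((fun a : Ars N => a.1 j) - fun a => a.1 i) := by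
    funext a
    simp [delta, Matrix.det_vandermonde]
  rw [this]
  refine Subalgebra.smul_mem _ (Subalgebra.prod_mem _ fun i _ =>
    Subalgebra.prod_mem _ fun j _ => ?_) _
  exact sub_mem (fun a => regularAt_ars j a) (fun a => regularAt_ars i a)

/-- The weights `1 / d_i`, and `1` for the last index. -/
def weight (a : Ars N) (o : Option (Fin N)) : ℂ := o.elim 1 (fun j => (d a j)⁻¹)

/-- Square roots of the weights, on which `(ℤ/2)^N` acts through `kappaSigns`. -/
def RootCover.root (p : RootCover N) (o : Option (Fin N)) : ℂ :=
  o.elim 1 (fun j => p.1.2 j * (∏ i, p.1.2 i) * (delta p.1.1 * d p.1.1 j)⁻¹)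

theorem RootCover.root_sq (p : RootCover N) (o : Option (Fin N)) :
    p.root o ^ 2 = weight p.1.1 o := by
  cases o with
  | none => exact one_pow 2
  | some j =>
    have h1 := d_ne_zero p.1.1 j
    have h2 : ∏ i, d p.1.1 i ≠ 0 := Finset.prod_ne_zero_iff.2 fun i _ => d_ne_zero _ i
    simp only [root, weight, Option.elim, mul_pow, inv_pow, delta_sq, p.2, ← Finset.prod_pow]
    field_simp

/-- The purpose of the factor (∏ c_i)/δ in the root: its square is one, so the weight is not
changed, but it turns the character ζ_j into ζ_j ∏ ζ_i, the j-th component of κ. For N odd this is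
trivial on the diagonal, so the root is defined on the quotient by ±1. -/
theorem RootCover.root_signs (ζ : Fin N → ℤˣ) (p : RootCover N) (o : Option (Fin N)) :
    (RootCover.signs ζ p).root o = ((kappaSigns N ζ o : ℤ) : ℂ) * p.root o := by
  cases o with
  | none => simp [root, kappaSigns]
  | some j =>
    change ((ζ j : ℤ) : ℂ) * p.1.2 j * (∏ i, ((ζ i : ℤ) : ℂ) * p.1.2 i) *
        (delta p.1.1 * d p.1.1 j)⁻¹ =
      (((ζ j * ∏ i, ζ i : ℤˣ) : ℤ) : ℂ) *
        (p.1.2 j * (∏ i, p.1.2 i) * (delta p.1.1 * d p.1.1 j)⁻¹)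
    rw [Finset.prod_mul_distrib]
    push_cast
    ring

/-- The signs `sgn(w)` for the first `N` coordinates. -/
def soSigns (w : W N) (o : Option (Fin N)) : ℤˣ := o.elim 1 (fun _ => Equiv.Perm.sign w)

theorem RootCover.root_perm (w : W N) (p : RootCover N) (o : Option (Fin N)) :
    (RootCover.perm w p).root o = ((soSigns w o : ℤ) : ℂ) * p.root (w⁻¹ • o) := by
  cases o with
  | none =>
    change (1 : ℂ) = _ * 1
    simp [soSigns]
  | some j =>
    change p.1.2 (w⁻¹ • j) * (∏ i, p.1.2 (w⁻¹ • i)) * (delta (w • p.1.1) * d (w • p.1.1) j)⁻¹ =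
      ((Equiv.Perm.sign w : ℤ) : ℂ) *
        (p.1.2 (w⁻¹ • j) * (∏ i, p.1.2 i) * (delta p.1.1 * d p.1.1 (w⁻¹ • j))⁻¹)
    rw [show ∏ i, p.1.2 (w⁻¹ • i) = ∏ i, p.1.2 i from Equiv.prod_comp w⁻¹ p.1.2, delta_smul,
      d_smul, mul_assoc (((Equiv.Perm.sign w : ℤ) : ℂ)), mul_inv (((Equiv.Perm.sign w : ℤ) : ℂ)),
      inv_eq_of_mul_eq_one_right (sign_mul_self (Equiv.Perm.sign w))]
    ring

theorem kappaSigns_diag (hN : Odd N) {ζ : Fin N → ℤˣ} (h : ζ ∈ diagSigns (Fin N)) :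
    kappaSigns N ζ = 1 := by
  obtain ⟨e, he⟩ := mem_diagSigns.1 h
  funext o
  cases o with
  | none => rfl
  | some i =>
    change ζ i * ∏ j, ζ j = 1
    simp only [he, Finset.prod_const, Finset.card_univ, Fintype.card_fin]
    rw [← pow_succ', ← Nat.two_mul_div_two_of_even hN.add_one, pow_mul, Int.units_sq, one_pow]

/-- The square roots of the weights, as functions on the torsor. -/
def ATilde.root (hN : Odd N) : ATilde N → Option (Fin N) → ℂ :=
  Quotient.lift RootCover.root (by
    rintro p q ⟨ζ, hζ, rfl⟩
    funext o
    simp [RootCover.root_signs, kappaSigns_diag hN hζ])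

theorem ATilde.root_sq (hN : Odd N) (C : ATilde N) (o : Option (Fin N)) :
    C.root hN o ^ 2 = weight C.base o := by
  induction C using Quotient.inductionOn with
  | h p => exact p.root_sq o

theorem ATilde.root_ne_zero (hN : Odd N) (C : ATilde N) (o : Option (Fin N)) :
    C.root hN o ≠ 0 := fun h => by
  have h1 := C.root_sq hN o
  rw [h, zero_pow two_ne_zero] at h1
  cases o with
  | none => exact zero_ne_one h1
  | some j => exact inv_ne_zero (d_ne_zero C.base j) h1.symm

theorem ATilde.root_smul (hN : Odd N) (ζ : Fin N → ℤˣ) (C : ATilde N) (o : Option (Fin N)) :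
    ATilde.root hN ((QuotientGroup.mk ζ : I (Fin N)) • C) o =
      ((kappaSigns N ζ o : ℤ) : ℂ) * C.root hN o := by
  induction C using Quotient.inductionOn with
  | h p => exact p.root_signs ζ o

theorem ATilde.root_perm (hN : Odd N) (w : W N) (C : ATilde N) (o : Option (Fin N)) :
    ATilde.root hN (w • C) o = ((soSigns w o : ℤ) : ℂ) * C.root hN (w⁻¹ • o) := by
  induction C using Quotient.inductionOn with
  | h p => exact p.root_perm w o

theorem ATilde.exists_smul_eq {C C' : ATilde N} (h : C.base = C'.base) :
    ∃ g : I (Fin N), g • C = C' := by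
  induction C using Quotient.inductionOn with
  | h p =>
    induction C' using Quotient.inductionOn with
    | h q =>
      replace h : p.1.1 = q.1.1 := h
      choose ζ hζ using fun i => exists_sign_of_sq_eq
        ((q.2 i).trans ((congrArg (fun a => d a i) h.symm).trans (p.2 i).symm))
      exact ⟨QuotientGroup.mk ζ, congrArg (Quotient.mk (rootSetoid N))
        (Subtype.ext (Prod.ext h (funext fun i => (hζ i).symm)))⟩

theorem RootCover.regMapAt_base (p : RootCover N) : RegMapAt (instSpaceWithFunctionsRootCover N)
    (instSpaceWithFunctionsArs N) (fun p => p.1.1) p :=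
  RegMapAt.comp (regMapAt_fst _) (regMapAt_subtype_val (X := Ars N × (Fin N → ℂ)) p)

theorem RootCover.root_mem_regularFunctions (o : Option (Fin N)) :
    (fun p : RootCover N => p.root o) ∈ regularFunctions (RootCover N) := by
  have hc : ∀ j, (fun p : RootCover N => p.1.2 j) ∈ regularFunctions (RootCover N) := fun j p =>
    RegMapAt.comp (regMapAt_snd _) (regMapAt_subtype_val (X := Ars N × (Fin N → ℂ)) p) _
      (affine_regularAt_coord j _)
  cases o with
  | none => exact one_mem _
  | some j =>
    have h1 : (fun a : Ars N => delta a * d a j)⁻¹ ∈ regularFunctions (Ars N) :=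
      inv_mem_regularFunctions (mul_mem delta_mem_regularFunctions (d_mem_regularFunctions j))
        fun a => mul_ne_zero (delta_ne_zero a) (d_ne_zero a j)
    have h2 := mul_mem (mul_mem (hc j) (prod_mem fun i (_ : i ∈ Finset.univ) => hc i))
      (fun p => p.regMapAt_base _ (h1 _) :
        (fun a : Ars N => delta a * d a j)⁻¹ ∘ (fun p : RootCover N => p.1.1) ∈ regularFunctions _)
    convert h2 using 1
    funext p
    simp only [Pi.mul_apply, Finset.prod_apply]
    rfl

theorem ATilde.regMapAt_mk (p : RootCover N) : RegMapAt (instSpaceWithFunctionsRootCover N)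
    (instSpaceWithFunctionsATilde N) (Quotient.mk (rootSetoid N)) p := regMapAt_push_map p

theorem ATilde.root_mem_regularFunctions (hN : Odd N) (o : Option (Fin N)) :
    (fun C : ATilde N => C.root hN o) ∈ regularFunctions (ATilde N) := by
  intro C
  refine ⟨Set.univ, isOpenZ_univ (instSpaceWithFunctionsRootCover N), trivial, fun p _ => ?_⟩
  exact RootCover.root_mem_regularFunctions o p

end Delta

end

end QuadricTwist

/-! ### Rescaling by the roots: from the twist to the unweighted families. -/

namespace QuadricTwist

noncomputable section

open SpaceWithFunctions

/-! ### The twist as a family of intersections of quadrics -/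

section Rescale

variable {N : ℕ} {ι : Type} [MulAction (W N) ι] {F G : LinFamily N ι}

/-- The family `G` is obtained from `F` by dividing the coordinates by the `d_i`. -/
def IsWeighted (μ : Marking N ι) (F G : LinFamily N ι) : Prop :=
  ∀ a q, q ∈ F.E a ↔ (fun o => weight a (μ.toOption o) * q o) ∈ G.E a

variable {μ : Marking N ι} (hG : IsWeighted μ F G) (hN : Odd N)

theorem sq_mul_root (C : ATilde N) (v : ι → ℂ) :
    sq (fun o => v o * C.root hN (μ.toOption o)) =
      fun o => weight C.base (μ.toOption o) * sq v o := by
  funext o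
  rw [← C.root_sq hN]
  simp only [sq]
  ring

/-- Multiplication of the coordinates by the square roots of the weights. -/
def Cone.scale (z : Cone F) (C : ATilde N) (h : z.1.1 = C.base) : Cone G :=
  ⟨(z.1.1, fun o => z.1.2 o * C.root hN (μ.toOption o)), by
    refine ⟨fun h0 => z.2.1 (funext fun o => ?_), ?_⟩
    · exact (mul_eq_zero.1 (congrFun h0 o)).resolve_right (C.root_ne_zero hN _)
    · change sq (fun o => z.1.2 o * C.root hN (μ.toOption o)) ∈ G.E z.1.1
      rw [sq_mul_root, ← h]
      exact (hG _ _).1 z.2.2⟩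

/-- Division of the coordinates by the square roots of the weights. -/
def Cone.unscale (z : Cone G) (C : ATilde N) (h : z.1.1 = C.base) : Cone F :=
  ⟨(z.1.1, fun o => z.1.2 o * (C.root hN (μ.toOption o))⁻¹), by
    refine ⟨fun h0 => z.2.1 (funext fun o => ?_), (hG _ _).2 ?_⟩
    · exact (mul_eq_zero.1 (congrFun h0 o)).resolve_right (inv_ne_zero (C.root_ne_zero hN _))
    · rw [h, ← sq_mul_root hN]
      have : (fun o => z.1.2 o * (C.root hN (μ.toOption o))⁻¹ * C.root hN (μ.toOption o)) =
          z.1.2 := funext fun o => inv_mul_cancel_right₀ (C.root_ne_zero hN _) _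
      rw [this, ← h]
      exact z.2.2⟩

/-- Multiplication of the homogeneous coordinates by the square roots of the weights. -/
def SqFamily.scale (x : SqFamily F) (C : ATilde N) (h : x.base = C.base) : SqFamily G :=
  (x.rep.scale hG hN C h).proj

theorem SqFamily.scale_proj (z : Cone F) (C : ATilde N) (h : z.1.1 = C.base) :
    SqFamily.scale hG hN z.proj C h = (z.scale hG hN C h).proj := by
  obtain ⟨c, hc, hz⟩ := z.exists_rep_proj
  refine Cone.proj_eq_of_eq_mul rfl hc fun o => ?_
  change z.proj.1.2.rep o * _ = c * (z.1.2 o * _)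
  rw [hz, mul_assoc]

theorem SqFamily.scale_injective {x y : SqFamily F} {C : ATilde N} (hx : x.base = C.base)
    (hy : y.base = C.base) (h : SqFamily.scale hG hN x C hx = SqFamily.scale hG hN y C hy) :
    x = y := by
  obtain ⟨z, rfl⟩ := Cone.proj_surjective x
  obtain ⟨z', rfl⟩ := Cone.proj_surjective y
  obtain ⟨ha, c, hc, hv⟩ := Cone.proj_eq_iff.1 ((SqFamily.scale_proj hG hN z C hx).symm.trans
    (h.trans (SqFamily.scale_proj hG hN z' C hy)))
  refine Cone.proj_eq_iff.2 ⟨ha, c, hc, fun o => ?_⟩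
  refine mul_right_cancel₀ (C.root_ne_zero hN (μ.toOption o)) ((hv o).trans ?_)
  exact (mul_assoc _ _ _).symm

theorem SqFamily.scale_smul (ζ : ι → ℤˣ) (x : SqFamily F) (C : ATilde N) (h : x.base = C.base) :
    SqFamily.scale hG hN ((QuotientGroup.mk ζ : I ι) • x) C h =
      (QuotientGroup.mk ζ : I ι) • SqFamily.scale hG hN x C h := by
  obtain ⟨z, rfl⟩ := Cone.proj_surjective x
  refine (SqFamily.scale_proj hG hN (z.signs ζ) C h).trans (Eq.trans ?_
    (congrArg ((QuotientGroup.mk ζ : I ι) • ·) (SqFamily.scale_proj hG hN z C h).symm))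
  exact Cone.proj_eq_of_eq (z' := (z.scale hG hN C h).signs ζ) rfl fun o => mul_assoc _ _ _

/-- The coordinates and the roots change by the same signs, which cancel in the product; hence the
rescaled point depends only on the class in the twist. -/
theorem SqFamily.scale_smul_smul (ζ : Fin N → ℤˣ) (x : SqFamily F) (C : ATilde N)
    (h : x.base = C.base)
    (h' : x.base = ATilde.base ((QuotientGroup.mk ζ : I (Fin N)) • C)) :
    SqFamily.scale hG hN
      ((QuotientGroup.mk (fun o => kappaSigns N ζ (μ.toOption o)) : I ι) • x)
      ((QuotientGroup.mk ζ : I (Fin N)) • C) h' = SqFamily.scale hG hN x C h := by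
  obtain ⟨z, rfl⟩ := Cone.proj_surjective x
  refine (SqFamily.scale_proj hG hN (z.signs _) _ h').trans
    (Eq.trans ?_ (SqFamily.scale_proj hG hN z C h).symm)
  refine Cone.proj_eq_of_eq rfl fun o => ?_
  change ((kappaSigns N ζ (μ.toOption o) : ℤ) : ℂ) * z.1.2 o * ATilde.root hN _ _ = z.1.2 o * _
  rw [ATilde.root_smul, mul_mul_mul_comm, sign_mul_self, one_mul]

theorem SqFamily.scale_perm (w : W N) (x : SqFamily F) (C : ATilde N) (h : x.base = C.base)
    (h' : (w • x).base = (w • C).base) :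
    SqFamily.scale hG hN (w • x) (w • C) h' =
      (QuotientGroup.mk (fun o => soSigns w (μ.toOption o)) : I ι) •
        w • SqFamily.scale hG hN x C h := by
  obtain ⟨z, rfl⟩ := Cone.proj_surjective x
  refine (SqFamily.scale_proj hG hN (z.perm w) _ h').trans (Eq.trans ?_
    (congrArg (fun x => (QuotientGroup.mk (fun o => soSigns w (μ.toOption o)) : I ι) • w • x)
      (SqFamily.scale_proj hG hN z C h).symm))
  refine Cone.proj_eq_of_eq (z' := ((z.scale hG hN C h).perm w).signs _) rfl fun o => ?_
  change z.1.2 (w⁻¹ • o) * ATilde.root hN _ _ =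
    ((soSigns w (μ.toOption o) : ℤ) : ℂ) * (z.1.2 (w⁻¹ • o) * C.root hN (μ.toOption (w⁻¹ • o)))
  rw [ATilde.root_perm, μ.toOption_smul]
  ring

end Rescale

section Twist

variable {N n : ℕ} {ι : Type} [MulAction (W N) ι] {F F' G : LinFamily N ι} {κ : IHom N ι}
  {μ : Marking N ι} (hF : IsCurveFamily μ F) (hF' : IsConfigFamily μ n F') (hn : n < N)
  (hG : IsWeighted μ F' G) (hN : Odd N)

/-- The map `(y, C) ↦ v r(C)`, where `v` is the configuration corresponding to `y`, and `r(C)` are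
the square roots of the weights. -/
def FibreProduct.toQuad (p : FibreProduct F n) : SqFamily G :=
  SqFamily.scale hG hN (PowerQuot.toConfig hF hF' hn p.1.1) p.1.2
    ((PowerQuot.toConfig_base hF hF' hn _).trans p.2)

/-- The homomorphism `κ` is given by `kappaSigns`. -/
def IsKappa (μ : Marking N ι) (κ : IHom N ι) : Prop :=
  ∀ ζ : Fin N → ℤˣ, κ.hom (QuotientGroup.mk ζ) =
    QuotientGroup.mk (fun o => kappaSigns N ζ (μ.toOption o))

variable (hκ : IsKappa μ κ) (h1 : 1 ≤ n)

/-- The action of `I_N` on the fibre product. -/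
def FibreProduct.act (κ : IHom N ι) (g : I (Fin N)) (p : FibreProduct F n) : FibreProduct F n :=
  ⟨(κ.hom g • p.1.1, g • p.1.2), ((PowerQuot.base_smul _ _).trans p.2).trans
    (ATilde.base_smul _ _).symm⟩

include hκ h1 in
theorem FibreProduct.toQuad_act (g : I (Fin N)) (p : FibreProduct F n) :
    FibreProduct.toQuad hF hF' hn hG hN (p.act κ g) = p.toQuad hF hF' hn hG hN := by
  induction g using QuotientGroup.induction_on with
  | H ζ =>
    refine Eq.trans ?_ (SqFamily.scale_smul_smul hG hN ζ
      (PowerQuot.toConfig hF hF' hn p.1.1) p.1.2 _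
      (((PowerQuot.toConfig_base hF hF' hn _).trans p.2).trans (ATilde.base_smul _ _).symm))
    have : PowerQuot.toConfig hF hF' hn (p.act κ (QuotientGroup.mk ζ)).1.1 =
        (QuotientGroup.mk (fun o => kappaSigns N ζ (μ.toOption o)) : I ι) •
          PowerQuot.toConfig hF hF' hn p.1.1 := by
      rw [← PowerQuot.toConfig_smul hF hF' hn h1, ← hκ]
      rfl
    simp only [FibreProduct.toQuad, this]
    rfl

/-- The map from the twist to the family of intersections of quadrics. -/
def Twist.toQuad : Twist F n κ → SqFamily G :=
  Quotient.lift (FibreProduct.toQuad hF hF' hn hG hN) (by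
    rintro p q ⟨g, hg⟩
    have : q = p.act κ g := Subtype.ext hg
    rw [this, FibreProduct.toQuad_act hF hF' hn hG hN hκ h1])

theorem Twist.toQuad_base (t : Twist F n κ) :
    (Twist.toQuad hF hF' hn hG hN hκ h1 t).base = t.base := by
  induction t using Quotient.inductionOn with
  | h p => exact PowerQuot.toConfig_base hF hF' hn _

theorem Twist.toQuad_smul (g : I ι) (t : Twist F n κ) :
    Twist.toQuad hF hF' hn hG hN hκ h1 (g • t) =
      g • Twist.toQuad hF hF' hn hG hN hκ h1 t := by
  induction t using Quotient.inductionOn with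
  | h p =>
    induction g using QuotientGroup.induction_on with
    | H ζ =>
      refine Eq.trans ?_ (SqFamily.scale_smul hG hN ζ (PowerQuot.toConfig hF hF' hn p.1.1) p.1.2
        ((PowerQuot.toConfig_base hF hF' hn _).trans p.2))
      simp only [← PowerQuot.toConfig_smul hF hF' hn h1]
      rfl

theorem Twist.toQuad_perm (w : W N) (t : Twist F n κ) :
    Twist.toQuad hF hF' hn hG hN hκ h1 (w • t) =
      (QuotientGroup.mk (fun o => soSigns w (μ.toOption o)) : I ι) •
        w • Twist.toQuad hF hF' hn hG hN hκ h1 t := by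
  induction t using Quotient.inductionOn with
  | h p =>
    have h2 : (PowerQuot.toConfig hF hF' hn p.1.1).base = p.1.2.base :=
      (PowerQuot.toConfig_base hF hF' hn _).trans p.2
    refine Eq.trans ?_ (SqFamily.scale_perm hG hN w (PowerQuot.toConfig hF hF' hn p.1.1) p.1.2
      h2 ((congrArg (w • ·) h2).trans (ATilde.base_smul' w _).symm))
    simp only [← PowerQuot.toConfig_perm hF hF' hn]
    rfl

/-- Since I_N acts transitively on the fibres of the torsor, two representatives can be moved to the
same point of it. There the rescaling is by fixed nonzero numbers, hence injective. -/
theorem Twist.toQuad_injective :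
    Function.Injective (Twist.toQuad (F := F) hF hF' hn hG hN hκ h1) := by
  intro t t'
  induction t using Quotient.inductionOn with
  | h p =>
    induction t' using Quotient.inductionOn with
    | h q =>
      intro h
      have hb : p.1.2.base = q.1.2.base := by
        have e : ∀ t : Twist F n κ, (Twist.toQuad hF hF' hn hG hN hκ h1 t).base = t.base :=
          Twist.toQuad_base hF hF' hn hG hN hκ h1
        exact p.2.symm.trans ((e _).symm.trans ((congrArg SqFamily.base h).trans
          ((e _).trans q.2)))
      obtain ⟨g, hg⟩ := ATilde.exists_smul_eq hb
      refine Quotient.sound ⟨g, ?_⟩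
      have h2 : FibreProduct.toQuad hF hF' hn hG hN (p.act κ g) =
          q.toQuad hF hF' hn hG hN := (FibreProduct.toQuad_act hF hF' hn hG hN hκ h1 g p).trans h
      obtain ⟨⟨y, C⟩, hp⟩ := p
      obtain ⟨⟨y', C'⟩, hq⟩ := q
      replace hg : g • C = C' := hg
      subst hg
      have h3 := PowerQuot.toConfig_injective hF hF' hn (SqFamily.scale_injective hG hN _ _ h2)
      exact Prod.ext h3.symm rfl

/-- The inverse map, on the cover of the cone given by the square roots of the `d_i`. -/
def Twist.ofCone (z : SqrtCover (fun j (b : Cone G) => d b.1.1 j)) : FibreProduct F n :=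
  ⟨((PowerQuot.equivConfig hF hF' hn h1).symm (Cone.unscale hG hN z.1.1
    (Quotient.mk _ ⟨(z.1.1.1.1, z.1.2), z.2⟩) rfl).proj,
      Quotient.mk _ ⟨(z.1.1.1.1, z.1.2), z.2⟩), by
    refine (PowerQuot.toConfig_base hF hF' hn _).symm.trans ?_
    exact congrArg SqFamily.base ((PowerQuot.equivConfig hF hF' hn h1).apply_symm_apply _)⟩

theorem Twist.toQuad_ofCone (z : SqrtCover (fun j (b : Cone G) => d b.1.1 j)) :
    Twist.toQuad hF hF' hn hG hN hκ h1 (Quotient.mk _ (Twist.ofCone hF hF' hn hG hN h1 z)) =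
      z.1.1.proj := by
  have h2 : PowerQuot.toConfig hF hF' hn (Twist.ofCone hF hF' hn hG hN h1 z).1.1 =
      (Cone.unscale hG hN z.1.1 (Quotient.mk _ ⟨(z.1.1.1.1, z.1.2), z.2⟩) rfl).proj :=
    (PowerQuot.equivConfig hF hF' hn h1).apply_symm_apply _
  change FibreProduct.toQuad hF hF' hn hG hN _ = _
  simp only [FibreProduct.toQuad, h2]
  refine (SqFamily.scale_proj hG hN _ _ _).trans (Cone.proj_eq_of_eq rfl fun o => ?_)
  exact inv_mul_cancel_right₀ (ATilde.root_ne_zero hN _ _) _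

/-- The bijection between the twist and the family of intersections of quadrics. -/
def Twist.equivQuad : Twist F n κ ≃ SqFamily G :=
  Equiv.ofBijective (Twist.toQuad hF hF' hn hG hN hκ h1)
    ⟨Twist.toQuad_injective hF hF' hn hG hN hκ h1, fun x => by
      obtain ⟨b, rfl⟩ := Cone.proj_surjective x
      obtain ⟨z, rfl⟩ := SqrtCover.surjective (fun j (b : Cone G) => d b.1.1 j) b
      exact ⟨_, Twist.toQuad_ofCone hF hF' hn hG hN hκ h1 z⟩⟩

theorem FibreProduct.regMapAt_toQuad (p : FibreProduct F n) :
    RegMapAt (instSpaceWithFunctionsFibreProduct F n) (instSpaceWithFunctionsSqFamily G)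
      (FibreProduct.toQuad hF hF' hn hG hN) p := by
  have hval := regMapAt_subtype_val (X := PowerQuot F n × ATilde N) p
  have hfst : RegMapAt (instSpaceWithFunctionsFibreProduct F n)
      (instSpaceWithFunctionsSqFamily F') (fun p => PowerQuot.toConfig hF hF' hn p.1.1) p :=
    RegMapAt.comp (PowerQuot.regMapAt_toConfig hF hF' hn _)
      (RegMapAt.comp (regMapAt_fst _) hval)
  have hsnd : RegMapAt (instSpaceWithFunctionsFibreProduct F n) (instSpaceWithFunctionsATilde N)
      (fun p => p.1.2) p := RegMapAt.comp (regMapAt_snd _) hval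
  obtain ⟨c, hc⟩ := Function.ne_iff.1 (PowerQuot.toConfig hF hF' hn p.1.1).1.2.rep_nonzero
  refine regMapAt_sqFamily (v := fun p : FibreProduct F n => fun o =>
      (PowerQuot.toConfig hF hF' hn p.1.1).1.2.rep o /
        (PowerQuot.toConfig hF hF' hn p.1.1).1.2.rep c * p.1.2.root hN (μ.toOption o))
    (fun i => ?_) (fun o => ?_) ?_ fun q hq => ?_
  · exact hfst _ (regMapAt_sqFamily_base _ _ _ (regularAt_ars i _))
  · exact IsGood.mul (hfst _ (regularAt_sqFamily_ratio F' o c hc))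
      (hsnd _ (ATilde.root_mem_regularFunctions hN (μ.toOption o) _))
  · exact Function.ne_iff.2 ⟨c, mul_ne_zero (div_ne_zero hc hc) (ATilde.root_ne_zero hN _ _)⟩
  -- Again a vanishing denominator would make every ratio zero, contrary to `hq`.
  · have hcq : (PowerQuot.toConfig hF hF' hn q.1.1).1.2.rep c ≠ 0 := fun h0 =>
      hq (funext fun o => by simp [h0])
    refine (Projectivization.mk_eq_mk_iff' ℂ _ _ _ hq).2
      ⟨(PowerQuot.toConfig hF hF' hn q.1.1).1.2.rep c, funext fun o => ?_⟩
    change _ * (_ / _ * _) = (PowerQuot.toConfig hF hF' hn q.1.1).1.2.rep o * _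
    rw [← mul_assoc, mul_div_cancel₀ _ hcq]

theorem Twist.regMapAt_ofCone [Fintype ι] (z : SqrtCover (fun j (b : Cone G) => d b.1.1 j)) :
    RegMapAt (coordinates (SqrtCover.coord (Cone.coord G) _))
      (instSpaceWithFunctionsFibreProduct F n) (Twist.ofCone hF hF' hn hG hN h1) z := by
  let e := SqrtCover.coord (Cone.coord G) (fun j (b : Cone G) => d b.1.1 j)
  have ha : ∀ i, (coordinates e).RegularAt (fun z => z.1.1.1.1.1 i) z := fun i =>
    coordinates_regular (Sum.inl (Sum.inl i)) z
  have hroot : RegMapAt (coordinates e) (instSpaceWithFunctionsRootCover N)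
      (fun z => ⟨(z.1.1.1.1, z.1.2), z.2⟩) z :=
    regMapAt_subtype (Y := Ars N × (Fin N → ℂ)) (regMapAt_prod (regMapAt_ars ha)
      (regMapAt_affine fun j => coordinates_regular (Sum.inr j) z))
  have htilde : RegMapAt (coordinates e) (instSpaceWithFunctionsATilde N)
      (fun z => Quotient.mk _ ⟨(z.1.1.1.1, z.1.2), z.2⟩) z :=
    RegMapAt.comp (ATilde.regMapAt_mk _) hroot
  refine regMapAt_subtype (Y := PowerQuot F n × ATilde N) (regMapAt_prod ?_ htilde)
  refine RegMapAt.comp (ψ := (PowerQuot.equivConfig hF hF' hn h1).symm)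
    (isMorphism_iff.1 (PowerQuot.isIsomorphism_equivConfig hF hF' hn h1).2 _)
    (RegMapAt.comp (Cone.regMapAt_proj _) (regMapAt_coordinates fun k => ?_))
  rcases k with i | o
  · exact ha i
  · exact IsGood.mul (coordinates_regular (e := e) (Sum.inl (Sum.inr o)) z)
      (IsGood.inv (htilde _ (ATilde.root_mem_regularFunctions hN (μ.toOption o) _))
        (ATilde.root_ne_zero hN _ _))

/-- After the c_j are adjoined to the cone, the inverse can be written down: divide by the roots,
then apply the inverse of `PowerQuot.equivConfig`. Regularity of functions descends from this cover
through the square roots and the cone. -/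
theorem Twist.isIsomorphism_equivQuad [Fintype ι] :
    IsIsomorphism (Twist.equivQuad (F := F) hF hF' hn hG hN hκ h1) := by
  let : SpaceWithFunctions (SqrtCover (fun j (b : Cone G) => d b.1.1 j)) :=
    coordinates (SqrtCover.coord (Cone.coord G) _)
  refine isIsomorphism_of_descends
    (q := fun z => Quotient.mk _ (Twist.ofCone (F := F) hF hF' hn hG hN h1 z))
    (regMapAt_push (π := Quotient.mk _) (FibreProduct.regMapAt_toQuad hF hF' hn hG hN))
    (fun z => RegMapAt.comp (regMapAt_push_map (π := Quotient.mk _) _)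
      (Twist.regMapAt_ofCone hF hF' hn hG hN h1 z)) ?_
  rw [show Twist.equivQuad (F := F) hF hF' hn hG hN hκ h1 ∘
      (fun z => Quotient.mk _ (Twist.ofCone (F := F) hF hF' hn hG hN h1 z)) =
    Cone.proj ∘ fun z => z.1.1 from
      funext (Twist.toQuad_ofCone hF hF' hn hG hN hκ h1)]
  exact Cone.descends_proj.comp (SqrtCover.descends fun j => Cone.d_mem_regularFunctions G j)

end Twist

end

end QuadricTwist

/-! ### Equivariance, and the hypotheses of the general statements for the concrete families. -/

namespace QuadricTwist

noncomputable section

open SpaceWithFunctions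

/-! ### The isomorphisms of the theorem -/

section Equivariance

variable {N n : ℕ} {ι : Type} [MulAction (W N) ι] {F F' G : LinFamily N ι} {κ : IHom N ι}
  {μ : Marking N ι} (hF : IsCurveFamily μ F) (hF' : IsConfigFamily μ n F') (hn : n < N)
  (h1 : 1 ≤ n)

theorem PowerQuot.base_equivConfig_symm (x : SqFamily F') :
    ((PowerQuot.equivConfig hF hF' hn h1).symm x).base = x.base := by
  obtain ⟨y, rfl⟩ := (PowerQuot.equivConfig hF hF' hn h1).surjective x
  rw [Equiv.symm_apply_apply]
  exact (PowerQuot.toConfig_base hF hF' hn y).symm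

theorem PowerQuot.equivConfig_symm_smul (g : I ι) (x : SqFamily F') :
    (PowerQuot.equivConfig hF hF' hn h1).symm (g • x) =
      g • (PowerQuot.equivConfig hF hF' hn h1).symm x := by
  refine (Equiv.symm_apply_eq _).2 (Eq.trans ?_ (PowerQuot.toConfig_smul hF hF' hn h1 g _).symm)
  exact congrArg (g • ·) ((PowerQuot.equivConfig hF hF' hn h1).apply_symm_apply x).symm

theorem PowerQuot.equivConfig_symm_smul_smul (g : I ι) (w : W N) (x : SqFamily F') :
    (PowerQuot.equivConfig hF hF' hn h1).symm (g • w • x) =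
      g • w • (PowerQuot.equivConfig hF hF' hn h1).symm x := by
  rw [PowerQuot.equivConfig_symm_smul]
  congr 1
  refine (Equiv.symm_apply_eq _).2 (Eq.trans ?_ (PowerQuot.toConfig_perm hF hF' hn w _).symm)
  exact congrArg (w • ·) ((PowerQuot.equivConfig hF hF' hn h1).apply_symm_apply x).symm

include hF hF' hn h1 in
/-- The isomorphism with the twist, equivariant for the action of `W` corrected by signs. -/
theorem Twist.exists_isIsomorphism [Fintype ι] (hG : IsWeighted μ F' G) (hN : Odd N)
    (hκ : IsKappa μ κ) (act : W N → SqFamily G → SqFamily G)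
    (hact : ∀ w x, act w x =
      (QuotientGroup.mk (fun o => soSigns w (μ.toOption o)) : I ι) • w • x) :
    ∃ φ : SqFamily G ≃ Twist F n κ, IsIsomorphism φ ∧ (∀ x, (φ x).base = x.base) ∧
      ∀ (g : I ι) (w : W N) (x : SqFamily G), φ (g • act w x) = g • w • φ x := by
  refine ⟨(Twist.equivQuad (F := F) hF hF' hn hG hN hκ h1).symm,
    (Twist.isIsomorphism_equivQuad hF hF' hn hG hN hκ h1).symm, fun x => ?_, fun g w x => ?_⟩
  · obtain ⟨t, rfl⟩ := (Twist.equivQuad (F := F) hF hF' hn hG hN hκ h1).surjective x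
    rw [Equiv.symm_apply_apply]
    exact (Twist.toQuad_base hF hF' hn hG hN hκ h1 t).symm
  · obtain ⟨t, rfl⟩ := (Twist.equivQuad (F := F) hF hF' hn hG hN hκ h1).surjective x
    rw [Equiv.symm_apply_apply, Equiv.symm_apply_eq, hact]
    refine (Eq.trans (Twist.toQuad_smul hF hF' hn hG hN hκ h1 g _) ?_).symm
    exact congrArg (g • ·) (Twist.toQuad_perm hF hF' hn hG hN hκ h1 w t)

end Equivariance

section Concrete

variable {N : ℕ}

theorem isWeighted_quadFamily (m : ℕ) : IsWeighted (finMarking N)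
    (quadFamily (N := N) (fun a j => (d a j)⁻¹) d_inv_smul m)
    (quadFamily (N := N) (fun _ _ => 1) (fun _ _ _ => rfl) m) := by
  intro a q
  refine forall₂_congr fun i _ => Eq.congr (Finset.sum_congr rfl fun j _ => ?_) rfl
  change _ = a.1 j ^ i * 1 * ((d a j)⁻¹ * q j)
  ring

theorem isWeighted_quadFamilyTilde (m : ℕ) : IsWeighted (optionMarking N) (VTilde' N m)
    (quadFamilyTilde (N := N) (fun _ _ => 1) (fun _ _ _ => rfl) m) := by
  intro a q
  have h : ∀ i, ∑ j, a.1 j ^ i * (d a j)⁻¹ * q (some j) =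
      ∑ j, a.1 j ^ i * 1 * ((d a j)⁻¹ * q (some j)) := fun i =>
    Finset.sum_congr rfl fun j _ => by ring
  refine and_congr (forall₂_congr fun i _ => Eq.congr (h i) rfl) (Eq.congr ?_ rfl)
  change _ = ∑ j, a.1 j ^ m * 1 * ((d a j)⁻¹ * q (some j)) - 1 * q none
  rw [h, one_mul]

/-- The vectors ζ and ζ ∏ ζ_j differ by a diagonal element, so on N coordinates κ is the identity of
I_N. -/
theorem isKappa_id (N : ℕ) : IsKappa (finMarking N) (IHom.id N) := by
  intro ζ
  refine QuotientGroup.eq.2 (mem_diagSigns.2 ⟨∏ j, ζ j, fun i => ?_⟩)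
  change (ζ i)⁻¹ * (ζ i * ∏ j, ζ j) = _
  rw [inv_mul_cancel_left]

theorem isKappa_kappa (hN : Odd N) : IsKappa (optionMarking N) (kappa hN) := fun _ => rfl

/-- Without the coordinate ε the factor sgn(w) is a scalar, which is why X_m carries the plain
permutation action. -/
theorem smul_soSigns_finMarking {G : LinFamily N (Fin N)} (w : W N) (x : SqFamily G) :
    w • x = (QuotientGroup.mk (fun o => soSigns w ((finMarking N).toOption o)) : I (Fin N)) •
      w • x := by
  have : (QuotientGroup.mk (fun o => soSigns w ((finMarking N).toOption o)) : I (Fin N)) = 1 :=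
    (QuotientGroup.eq_one_iff _).2 (mem_diagSigns.2 ⟨Equiv.Perm.sign w, fun _ => rfl⟩)
  rw [this, one_smul]

end Concrete

end

end QuadricTwist

/-! ### The theorem. -/

theorem mainTheorem8 (N m n : ℕ) (hN : Odd N) (hn : 1 ≤ n) (hmn : N = m + n + 1) :
    -- the twist for `X_m`
    (∃ φ : X N m ≃ YTwist N n, SpaceWithFunctions.IsIsomorphism φ ∧ (∀ x, (φ x).base = x.base) ∧
      ∀ (g : I (Fin N)) (w : W N) (x : X N m), φ (g • w • x) = g • w • φ x) ∧
    -- the twist for the double cover `X̃_m`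
    (∃ φ : XTilde N m ≃ YTildeTwist hN n, SpaceWithFunctions.IsIsomorphism φ ∧ (∀ x, (φ x).base = x.base) ∧
      ∀ (g : I (Option (Fin N))) (w : W N) (x : XTilde N m),
        φ (g • weylK w x) = g • w • φ x) ∧
    -- the equivalence of hyperplane configurations
    (∃ θ : (Ars N × (Fin (n + 1) → ℂ)) ≃ VectorBundle (VTilde' N m), SpaceWithFunctions.IsIsomorphism θ ∧
      ∀ a x, (θ (a, x)).1.1 = a ∧ ∀ o, (θ (a, x)).1.2 o = H a o x) ∧
    -- the isomorphism `X̃'_m ≅ 𝒴̃_m` covering it, and the induced isomorphism `X'_m ≅ 𝒴_m` of the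
    -- quotients by `ℤ/2`
    (∃ (ψ : XTilde' N m ≃ YTilde N n) (χ : X' N m ≃ Y N n),
      (SpaceWithFunctions.IsIsomorphism ψ ∧ (∀ x, (ψ x).base = x.base) ∧
        (∀ (g : I (Option (Fin N))) (w : W N) (x : XTilde' N m),
          ψ (g • w • x) = g • w • ψ x) ∧
        CoversConfigurations ψ) ∧
      (SpaceWithFunctions.IsIsomorphism χ ∧ (∀ x, (χ x).base = x.base) ∧
        ∀ (g : I (Fin N)) (w : W N) (x : X' N m), χ (g • w • x) = g • w • χ x) ∧
      ∀ x, χ (forget (forgets_X' N m) x) =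
        forgetPower (forgets_curve (by omega)) n (ψ x)) ∧
    IsLastSignQuotient (N := N) (forget (forgets_X' N m)) ∧
    IsLastSignQuotient (N := N)
      (forgetPower (forgets_curve (N := N) (by omega)) n) := by
  have hn' : n < N := by omega
  have hC := isCurveFamily_curveFamily N
  have hCt := isCurveFamily_curveFamilyTilde N
  have hX := isConfigFamily_quadFamily hN hmn
  have hXt := isConfigFamily_VTilde' hN hmn
  have hχ : SpaceWithFunctions.IsIsomorphism (PowerQuot.equivConfig hC hX hn' hn) :=
    PowerQuot.isIsomorphism_equivConfig hC hX hn' hn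
  have hψ : SpaceWithFunctions.IsIsomorphism (PowerQuot.equivConfig hCt hXt hn' hn) :=
    PowerQuot.isIsomorphism_equivConfig hCt hXt hn' hn
  refine ⟨?_, ?_, ⟨configEquiv hN hmn, isIsomorphism_configEquiv hN hmn,
      fun _ _ => ⟨rfl, fun _ => rfl⟩⟩,
    ⟨(PowerQuot.equivConfig hCt hXt hn' hn).symm, (PowerQuot.equivConfig hC hX hn' hn).symm,
      ⟨hψ.symm, PowerQuot.base_equivConfig_symm _ _ _ _,
        PowerQuot.equivConfig_symm_smul_smul _ _ _ _,
        coversConfigurations_symm⟩,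
      ⟨hχ.symm, PowerQuot.base_equivConfig_symm _ _ _ _,
        PowerQuot.equivConfig_symm_smul_smul _ _ _ _⟩,
      fun x => ?_⟩, isLastSignQuotient_forget_X' N m, ?_⟩
  · exact Twist.exists_isIsomorphism hC hX hn' hn (isWeighted_quadFamily m) hN (isKappa_id N)
      (fun w x => w • x) smul_soSigns_finMarking
  · exact Twist.exists_isIsomorphism hCt hXt hn' hn (isWeighted_quadFamilyTilde m) hN
      (isKappa_kappa hN) weylK fun w x => rfl
  · refine (Equiv.symm_apply_eq _).2 ?_
    refine Eq.trans ?_ (toConfig_forgetPower _ (forgets_X' N m) hCt hC hXt hX hn' _).symm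
    exact congrArg _ ((PowerQuot.equivConfig hCt hXt hn' hn).apply_symm_apply x).symm
  -- The quotient property for the double cover of 𝒴_m is carried over from that of X'_m by the
  -- commuting square of equivariant isomorphisms.
  · refine (isLastSignQuotient_forget_X' N m).transport hψ.symm hχ.symm
      (PowerQuot.equivConfig_symm_smul hCt hXt hn' hn) fun x => ?_
    refine (Equiv.symm_apply_eq _).2 ?_
    refine Eq.trans ?_ (toConfig_forgetPower _ (forgets_X' N m) hCt hC hXt hX hn' _).symm
    exact congrArg _ ((PowerQuot.equivConfig hCt hXt hn' hn).apply_symm_apply x).symm
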